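/- **Model.** Let $G=(V,E)$ be a finite undirected graph with $n=|V|$ nodes. Anonymous randomized processes, one per node, proceed in synchronous rounds $0,1,2,\dots$. All processes start asleep; an oblivious adversary (fixing its choices in advance) decides in which round a node wakes up (if ever) and in which round it crashes permanently (if ever). A process that wakes up starts in a fixed initial state and has no access to identifiers, the round number, $G$ or $n$. In each round a participating process (awake and not crashed), using private randomness, either beeps, and then gets no feedback, or listens, and then learns only whether at least one participating neighbour beeps. At any time a process is *inactive*, *competing* or in the *MIS*. A participating node is *stable* if it is in the MIS and all its participating neighbours are inactive, or if it has a participating neighbour with this property. **Simple wake-up dynamics with parameter $\delta$** (which may depend on the current round): call a node *old* if it has been awake for at least $\delta$ rounds. The nodes woken up in round $0$ are arbitrary; every node woken up in a later round has at that moment a participating old neighbour; a node may be crashed only if all its participating neighbours are old. **Las Vegas algorithm.** With probability one, all participating nodes are eventually stable, and a stable node that does not crash remains stable as long as no MIS node crashes. **Statement.** 1. There are a Las Vegas algorithm (for simple wake-up dynamics with the following $\delta$) and a non-decreasing function $\delta(t)=O(\log t)$ such that for every constant $c\ge 1$ there is a constant $C$ with the following property: for every finite graph $G$ and every execution with simple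 wake-up dynamics in which a node counts as old in round $s$ if it has been awake for at least $\delta(s)$ rounds, if no wake-ups and crashes happen in the $T$ rounds following round $t$, where $T\ge C(\log^2 n+\log t)$ (with the convention $\log 0 = 0$), then after these $T$ rounds all participating nodes are stable with probability at least $1-n^{-c}$. In particular, if wake-ups and crashes occur only up to time $t$, the MIS problem is solved within a further $O(\log^2 n+\log t)$ rounds with high probability. 2. There are algorithms $A_\Delta$ ($\Delta\in\mathbb N$) and a function $\delta(\Delta)=O(\log\log\Delta)$ such that, on all graphs of maximum degree at most $\Delta$ under simple wake-up dynamics with parameter $\delta(\Delta)$, $A_\Delta$ is a Las Vegas algorithm, and for every constant $c\ge1$ there is a constant $C$ (depending neither on $\Delta$ nor on the graph or the execution) such that, if no wake-ups and crashes happen during $T\ge C\log^2 n$ rounds, then after these $T$ rounds all participating nodes are stable with probability at least $1-n^{-c}$. -/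

import Mathlib

open MeasureTheory Filter Asymptotics

namespace Beeping

/-- The three externally visible states of a process. -/
inductive Status where
  | inactive
  | competing
  | mis

/-- What a process perceives in a round: a beeping process gets no feedback, a listening process
can only tell silence from the presence of at least one beeping neighbour. -/
inductive Feedback where
  | noFeedback
  | silence
  | beep

/-- A randomized algorithm for the discrete beeping model, run by all (anonymous) processes.
In every round a process draws a fresh private random `Seed` from `law`; its current state and the
seed determine whether it beeps or listens; state, seed and feedback determine its next state.
A process is in the state `init` when it is woken up. Nothing else (identifiers, the round number,
the graph, its size) is available to it. -/
structure Algorithm where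
  State : Type
  countable_state : Countable State
  Seed : Type
  [seedSpace : MeasurableSpace Seed]
  law : Measure Seed
  [law_prob : IsProbabilityMeasure law]
  init : State
  beeps : State → Seed → Bool
  next : State → Seed → Feedback → State
  status : State → Status
  measurable_beeps : ∀ s, MeasurableSet {x | beeps s x = true}
  measurable_next : ∀ s f s', MeasurableSet {x | next s x f = s'}

attribute [instance] Algorithm.seedSpace Algorithm.law_prob

/-- The choices of an oblivious adversary: the round in which each node is woken up (`⊤`: never)
and the round from which on it has crashed (`⊤`: never). -/
structure Execution (V : Type) where
  wake : V → ℕ∞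
  crash : V → ℕ∞
  wake_lt_crash : ∀ v, wake v ≠ ⊤ → wake v < crash v

variable {V : Type}

/-- `v` participates in round `r`. -/
def Execution.Participates (E : Execution V) (v : V) (r : ℕ) : Prop :=
  E.wake v ≤ r ∧ (r : ℕ∞) < E.crash v

/-- At round `r`, node `u` has been around for at least `d` rounds. -/
def Execution.Old (E : Execution V) (d : ℕ) (u : V) (r : ℕ) : Prop :=
  E.wake u + (d : ℕ∞) ≤ r

/-- Simple wake-up dynamics, where `δ s` is the age that counts as old in round `s`. The nodes
woken up in round `0` are arbitrary. A node woken up in a round `s > 0` has in that round a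
participating neighbour that is old, and a node is crashed in round `s + 1` only if all its
neighbours (those participating in round `s`, when it was last around) are then old. -/
structure SimpleWakeUp (G : SimpleGraph V) (E : Execution V) (δ : ℕ → ℕ) : Prop where
  wakeUp : ∀ (v : V) (s : ℕ), 0 < s → E.wake v = s →
    ∃ u, G.Adj v u ∧ E.Participates u s ∧ E.Old (δ s) u s
  crash : ∀ (v : V) (s : ℕ), E.Participates v s → ¬ E.Participates v (s + 1) →
    ∀ u, G.Adj v u → E.Participates u s → E.Old (δ (s + 1)) u (s + 1)

/-- No node wakes up or crashes in the `T` rounds `t + 1, …, t + T`. -/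
def Execution.Quiet (E : Execution V) (t T : ℕ) : Prop :=
  ∀ r, t ≤ r → r ≤ t + T → ∀ v, E.Participates v r ↔ E.Participates v t

namespace Algorithm

variable (A : Algorithm) (G : SimpleGraph V) (E : Execution V)

/-- The random seeds of all nodes in all rounds. -/
abbrev Seeds (_A : Algorithm) (V : Type) : Type := V × ℕ → _A.Seed

/-- All seeds are independent with distribution `A.law`. -/
noncomputable def prob (V : Type) : Measure (A.Seeds V) :=
  Measure.infinitePi fun _ : V × ℕ => A.law

/-- Given the states at the beginning of round `r`, node `v` beeps in round `r`. -/
def Beeps (ω : A.Seeds V) (r : ℕ) (σ : V → A.State) (v : V) : Prop :=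
  E.Participates v r ∧ A.beeps (σ v) (ω (v, r)) = true

open Classical in
/-- The feedback of node `v` in round `r`, given the states at the beginning of that round. -/
noncomputable def feedback (ω : A.Seeds V) (r : ℕ) (σ : V → A.State) (v : V) : Feedback :=
  if A.Beeps E ω r σ v then Feedback.noFeedback
  else if ∃ u, G.Adj v u ∧ A.Beeps E ω r σ u then Feedback.beep
  else Feedback.silence

open Classical in
/-- The states of all nodes at the beginning of each round. A node that does not participate in a
round does not change its state; in particular it is in state `init` when it is woken up. -/
noncomputable def state (ω : A.Seeds V) : ℕ → V → A.State
  | 0 => fun _ => A.init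
  | r + 1 => fun v =>
      if E.Participates v r then
        A.next (state ω r v) (ω (v, r)) (A.feedback G E ω r (state ω r) v)
      else state ω r v

/-- `v` participates in round `r` and is in the MIS. -/
def InMIS (ω : A.Seeds V) (r : ℕ) (v : V) : Prop :=
  E.Participates v r ∧ A.status (A.state G E ω r v) = Status.mis

/-- `v` is in the MIS and all its (participating) neighbours are inactive. -/
def StableMIS (ω : A.Seeds V) (r : ℕ) (v : V) : Prop :=
  A.InMIS G E ω r v ∧
    ∀ u, G.Adj v u → E.Participates u r → A.status (A.state G E ω r u) = Status.inactive

/-- `v` is stable: it is in the MIS and all its neighbours are inactive, or it has such a neighbour.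
-/
def Stable (ω : A.Seeds V) (r : ℕ) (v : V) : Prop :=
  E.Participates v r ∧
    (A.StableMIS G E ω r v ∨ ∃ u, G.Adj v u ∧ A.StableMIS G E ω r u)

/-- All nodes participating in round `r` are stable. -/
def AllStable (ω : A.Seeds V) (r : ℕ) : Prop :=
  ∀ v, E.Participates v r → A.Stable G E ω r v

/-- The Las Vegas guarantee: with probability one all nodes eventually become stable, and a stable
node that does not crash remains stable as long as no node in the MIS crashes. -/
def LasVegas : Prop :=
  (∀ᵐ ω ∂(A.prob V), ∀ᶠ r in atTop, A.AllStable G E ω r) ∧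
  (∀ᵐ ω ∂(A.prob V), ∀ r, (∀ u, A.InMIS G E ω r u → E.Participates u (r + 1)) →
    ∀ v, E.Participates v (r + 1) → A.Stable G E ω r v → A.Stable G E ω (r + 1) v)

/-- In the execution `E` on the graph `G`, whenever no wake-ups and crashes happen after round `t`
for `T ≥ τ t` rounds, then all nodes are stable with probability at least `1 - n ^ (-c)`, where
`n` is the number of nodes of `G`. -/
def SolvesMISWithin [Fintype V] (c : ℝ) (τ : ℕ → ℝ) : Prop :=
  ∀ t T : ℕ, τ t ≤ T → E.Quiet t T →
    1 - (Fintype.card V : ℝ) ^ (-c) ≤ (A.prob V).real {ω | A.AllStable G E ω (t + T)}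

end Algorithm

end Beeping

open MeasureTheory Filter Asymptotics

set_option linter.unusedSectionVars false

/-! Time is cut into frames of 18 rounds. A running process keeps an exponent `e` and, unless it is
blocked, contends in a frame with probability `2 ^ (-e)`; exponent `0` marks a candidate for the
MIS. Beeping processes hear nothing, so collisions are detected only by chance: a contender is loud
with probability 1/8, a non-loud one with a loud neighbour raises its exponent, every other
contender takes exponent `0`. Competition raises the exponent of non-contenders, silence lowers it.
A candidate without candidate neighbours dominates them for good; it and its neighbours are then
settled.

Drift. Let `load` be the total weight `2 ^ (-e)` of the unsettled neighbours of an unsettled node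
`v`. For a tiny `a`, the potential `(load + 1/16) ^ a * (1 + a/20) ^ e v`, set to `0` on settling,
shrinks by a constant factor per frame (`integral_pot_nextE_le`). Either enough load sits on
neighbours with little competition, one of which wins with constant probability; or the load faces
strong competition and decays; or the load is small, and `v` lowers its exponent or, at exponent
`1`, wins itself. So `O(log n + e)` frames suffice from exponents at most `e`.

Lottery. Exponents can be large compared with `log n`. In a frame with level `L`, exponents above `3
* L` are cut to `3 * L` unless a ticket of probability `2 ^ (-2 * L)` is drawn within distance two.
If many nodes around `v` are eligible, a ticket probably vetoes the cut; if few are, the cut adds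
little load. Hence the drift survives (`integral_pot_clipE_le`), whereas for `n` small against `2 ^
(2 * L)` probably no ticket is drawn and all large exponents are cut (`frameE_large_prob`). It
remains to meet soon a frame whose level is at least a multiple `Λ` of `log n`, but not much above
`Λ ^ 2` (`GoodOften`).

Clocks. Levels are read off a common frame number, broadcast bit by bit. An unlimited counter needs
`O(log t)` frames to be learned. If `Δ` is known, exponents are capped near `log Δ`; levels `14 * 2
^ 2 ^ i` then suffice, and the frame number matters only modulo `O(log log Δ)`. The wake-up dynamics
give every young process an old neighbour that cannot crash and knows the clock, which yields
synchronization and learning (`phaseInv`).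

In quiet times the configurations at frame starts form a Markov chain driven by fresh seeds
(`cfg_succ`, `lintegral_cfg_frameSeeds`), to which the drift applies (`allStable_prob`). Replacing
`n` by arbitrarily large `N` in the failure bound gives the Las Vegas property. -/

namespace Beeping

/-! ### Geometric random variables and product measures -/

/-- The geometric distribution with success probability `1/2`. -/
noncomputable def geo : Measure ℕ :=
  ProbabilityTheory.geometricMeasure ⟨1 / 2, by norm_num, by norm_num⟩

instance : IsProbabilityMeasure geo := by unfold geo; infer_instance

/-- The weight `2 ^ (-k)`. -/
noncomputable def wt (k : ℕ) : ℝ := (1 / 2) ^ k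

lemma wt_pos (k : ℕ) : 0 < wt k := by unfold wt; positivity

lemma wt_nonneg (k : ℕ) : 0 ≤ wt k := (wt_pos k).le

lemma wt_le_one (k : ℕ) : wt k ≤ 1 := pow_le_one₀ (by norm_num) (by norm_num)

@[simp] lemma wt_zero : wt 0 = 1 := by simp [wt]

lemma wt_succ (k : ℕ) : wt (k + 1) = wt k / 2 := by unfold wt; rw [pow_succ]; ring

lemma wt_anti {k l : ℕ} (h : k ≤ l) : wt l ≤ wt k :=
  pow_le_pow_of_le_one (by norm_num) (by norm_num) h

lemma geo_singleton (k : ℕ) : geo.real {k} = wt (k + 1) := by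
  unfold geo wt
  rw [ProbabilityTheory.geometricMeasure_real_singleton]
  · norm_num [pow_succ]
  · intro h
    have := congrArg Subtype.val h
    norm_num at this

lemma geo_ge (k : ℕ) : geo.real {n | k ≤ n} = wt k := by
  induction k with
  | zero => simp
  | succ k ih =>
    have h : {n | k ≤ n} = {k} ∪ {n | k + 1 ≤ n} := by ext n; simp; omega
    rw [h, measureReal_union (by simp) (MeasurableSet.of_discrete), geo_singleton] at ih
    rw [wt_succ] at ih ⊢
    linarith

section Pi

variable {P α : Type} [Fintype P] [Countable α] [MeasurableSpace α] [MeasurableSingletonClass α]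
  (ρ : Measure α) [IsProbabilityMeasure ρ]

instance discreteMeasurableSpace_pi : DiscreteMeasurableSpace (P → α) := by
  infer_instance

lemma integrable_of_bdd {Ω : Type} [MeasurableSpace Ω] [DiscreteMeasurableSpace Ω]
    {μ : Measure Ω} [IsFiniteMeasure μ] {f : Ω → ℝ} (C : ℝ) (h : ∀ x, |f x| ≤ C) :
    Integrable f μ :=
  Integrable.of_bound (Measurable.of_discrete).aestronglyMeasurable C
    (ae_of_all _ h)

lemma pi_real_rectangle (F : Finset P) (S : P → Set α) :
    (Measure.pi fun _ : P => ρ).real {ξ | ∀ x ∈ F, ξ x ∈ S x} = ∏ x ∈ F, ρ.real (S x) := by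
  classical
  have h : {ξ : P → α | ∀ x ∈ F, ξ x ∈ S x} =
      Set.pi Set.univ (fun x => if x ∈ F then S x else Set.univ) := by
    ext ξ
    simp only [Set.mem_ofPred_eq, Set.mem_pi, Set.mem_univ, true_implies]
    refine forall_congr' fun x => ?_
    by_cases hx : x ∈ F <;> simp [hx]
  rw [measureReal_def, h, Measure.pi_pi, ENNReal.toReal_prod, ← Finset.prod_subset (Finset.subset_univ F)]
  · exact Finset.prod_congr rfl fun x hx => by simp [hx, measureReal_def]
  · intro x _ hx; simp [hx]

lemma pi_real_insert_rectangle {u : P} {F : Finset P} (hu : u ∉ F) (A : Set α) (S : P → Set α) :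
    (Measure.pi fun _ : P => ρ).real {ξ | ξ u ∈ A ∧ ∀ x ∈ F, ξ x ∈ S x} =
      ρ.real A * ∏ x ∈ F, ρ.real (S x) := by
  classical
  have h := pi_real_rectangle ρ (insert u F) (Function.update S u A)
  rw [Finset.prod_insert hu] at h
  have h1 : ∏ x ∈ F, ρ.real (Function.update S u A x) = ∏ x ∈ F, ρ.real (S x) :=
    Finset.prod_congr rfl fun x hx => by
      rw [Function.update_of_ne (by rintro rfl; exact hu hx)]
  rw [h1, Function.update_self] at h
  rw [← h]
  congr 1
  ext ξ
  simp only [Set.mem_ofPred_eq, Finset.mem_insert, forall_eq_or_imp, Function.update_self]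
  refine and_congr_right fun _ => forall₂_congr fun x hx => ?_
  rw [Function.update_of_ne (by rintro rfl; exact hu hx)]

lemma pi_real_eval (u : P) (A : Set α) :
    (Measure.pi fun _ : P => ρ).real {ξ | ξ u ∈ A} = ρ.real A := by
  simpa using pi_real_insert_rectangle ρ (Finset.notMem_empty u) A (fun _ => Set.univ)

end Pi

lemma prod_one_sub_le_exp {ι : Type} (F : Finset ι) (y : ι → ℝ) (h1 : ∀ x ∈ F, y x ≤ 1) :
    ∏ x ∈ F, (1 - y x) ≤ Real.exp (-∑ x ∈ F, y x) := by
  rw [← Finset.sum_neg_distrib, Real.exp_sum]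
  refine Finset.prod_le_prod (fun x hx => by linarith [h1 x hx]) fun x _ => ?_
  linarith [Real.add_one_le_exp (-y x)]

/-- The factor `2` pays for inverting `1 + x ≤ exp x`: on `[0, 1/2]` one has `(1 + 2 * y) * (1 - y)
≥ 1`. -/
lemma exp_le_prod_one_sub {ι : Type} (F : Finset ι) (y : ι → ℝ) (h0 : ∀ x ∈ F, 0 ≤ y x)
    (h1 : ∀ x ∈ F, y x ≤ 1 / 2) :
    Real.exp (-(2 * ∑ x ∈ F, y x)) ≤ ∏ x ∈ F, (1 - y x) := by
  rw [Finset.mul_sum, ← Finset.sum_neg_distrib, Real.exp_sum]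
  refine Finset.prod_le_prod (fun x _ => (Real.exp_pos _).le) fun x hx => ?_
  rw [Real.exp_neg]
  have h2 : 1 + 2 * y x ≤ Real.exp (2 * y x) := by linarith [Real.add_one_le_exp (2 * y x)]
  have h3 : 0 < 1 + 2 * y x := by linarith [h0 x hx]
  calc (Real.exp (2 * y x))⁻¹ ≤ (1 + 2 * y x)⁻¹ := inv_anti₀ h3 h2
    _ ≤ 1 - y x := by
      rw [inv_le_iff_one_le_mul₀ h3]
      nlinarith [h0 x hx, h1 x hx]

/-! ### One frame of the contention process -/

section Contention

open scoped Classical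

variable {P : Type} [Fintype P] (H : SimpleGraph P) (cap : ℕ → ℕ) (e : P → ℕ)

/-- Neighbouring a candidate with exponent `0` without having exponent `0`. -/
def Blocked (u : P) : Prop := e u ≠ 0 ∧ ∃ x, H.Adj u x ∧ e x = 0

/-- The seeds with which `u` contends. -/
def contSeeds (u : P) : Set (ℕ × ℕ) := {s | ¬ Blocked H e u ∧ e u ≤ s.1}

/-- The seeds with which `u` contends loudly. -/
def loudSeeds (u : P) : Set (ℕ × ℕ) := {s | (¬ Blocked H e u ∧ e u ≤ s.1) ∧ 3 ≤ s.2}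

/-- The exponents after one frame. -/
noncomputable def nextE (ξ : P → ℕ × ℕ) (u : P) : ℕ :=
  if ξ u ∈ contSeeds H e u then
    -- A loud contender beeps and gets no feedback, so two loud neighbours both obtain exponent `0`;
    -- a later frame in which only one of them is loud can separate them.
    if ξ u ∈ loudSeeds H e u ∨ ∀ x, H.Adj u x → ξ x ∉ loudSeeds H e x then 0 else cap (e u + 1)
  else if Blocked H e u ∨ ∃ x, H.Adj u x ∧ ξ x ∈ contSeeds H e x then cap (e u + 1)
  -- The floor `1` ensures that exponent `0` is reached only by contending.
  else max (e u - 1) 1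

/-- `u` has exponent `0` and no neighbour of `u` has. -/
def TrueMIS (u : P) : Prop := e u = 0 ∧ ∀ x, H.Adj u x → e x ≠ 0

/-- `u` or one of its neighbours is a true MIS node. -/
def Settled (u : P) : Prop := TrueMIS H e u ∨ ∃ x, H.Adj u x ∧ TrueMIS H e x

/-- The probability that `u` contends. -/
noncomputable def contWt (u : P) : ℝ := if Blocked H e u then 0 else wt (e u)

/-- The expected number of contending neighbours of `u`. -/
noncomputable def contSum (u : P) : ℝ := ∑ x with H.Adj u x, contWt H e x

/-- The unsettled neighbours. -/
noncomputable def unsettledNbrs (v : P) : Finset P :=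
  Finset.univ.filter fun u => H.Adj v u ∧ ¬ Settled H e u

/-- The total weight of the unsettled neighbours. -/
noncomputable def load (v : P) : ℝ := ∑ u ∈ unsettledNbrs H e v, wt (e u)

/-- What the analysis needs about the function that limits exponents. -/
structure CapSpec (θ : ℝ) : Prop where
  nonneg : 0 ≤ θ
  wt_le : ∀ k, wt (cap (k + 1)) ≤ wt k / 2 + θ
  le_self : ∀ k, cap k ≤ k
  one_le : ∀ k, 1 ≤ cap (k + 1)

/-- The law of the seeds of one process in the contention part of a frame. -/
noncomputable abbrev geoTwo : Measure (ℕ × ℕ) := geo.prod geo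

/-- The law of the contention seeds of all processes. -/
noncomputable abbrev seedPi (P : Type) [Fintype P] : Measure (P → ℕ × ℕ) :=
  Measure.pi fun _ : P => geoTwo

/-! ### Probabilities of the contention events. -/

variable {H cap e}

lemma contWt_nonneg (u : P) : 0 ≤ contWt H e u := by
  unfold contWt; split_ifs <;> simp [wt_nonneg]

lemma contWt_le (u : P) : contWt H e u ≤ wt (e u) := by
  unfold contWt; split_ifs <;> simp [wt_nonneg]

lemma contWt_le_one (u : P) : contWt H e u ≤ 1 := (contWt_le u).trans (wt_le_one _)

lemma contSum_nonneg (u : P) : 0 ≤ contSum H e u :=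
  Finset.sum_nonneg fun x _ => contWt_nonneg x

lemma load_nonneg (u : P) : 0 ≤ load H e u := Finset.sum_nonneg fun _ _ => wt_nonneg _

lemma geoTwo_contSeeds (u : P) : geoTwo.real (contSeeds H e u) = contWt H e u := by
  unfold contSeeds contWt
  by_cases h : Blocked H e u
  · simp [h]
  · have : {s : ℕ × ℕ | ¬ Blocked H e u ∧ e u ≤ s.1} = {n | e u ≤ n} ×ˢ Set.univ := by
      ext s; simp [h]
    rw [this, measureReal_prod_prod, geo_ge]; simp [h]

lemma geoTwo_loudSeeds (u : P) : geoTwo.real (loudSeeds H e u) = contWt H e u / 8 := by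
  unfold loudSeeds contWt
  by_cases h : Blocked H e u
  · simp [h]
  · have : {s : ℕ × ℕ | (¬ Blocked H e u ∧ e u ≤ s.1) ∧ 3 ≤ s.2} =
        {n | e u ≤ n} ×ˢ {n | 3 ≤ n} := by
      ext s; simp [h]
    rw [this, measureReal_prod_prod, geo_ge, geo_ge]; simp [h, wt]; ring

lemma loudSeeds_subset (u : P) : loudSeeds H e u ⊆ contSeeds H e u := fun _ h => h.1

lemma geoTwo_compl_loudSeeds (u : P) :
    geoTwo.real (loudSeeds H e u)ᶜ = 1 - contWt H e u / 8 := by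
  rw [probReal_compl_eq_one_sub MeasurableSet.of_discrete, geoTwo_loudSeeds]

lemma geoTwo_compl_contSeeds (u : P) :
    geoTwo.real (contSeeds H e u)ᶜ = 1 - contWt H e u := by
  rw [probReal_compl_eq_one_sub MeasurableSet.of_discrete, geoTwo_contSeeds]

lemma seedPi_loud (u : P) : (seedPi P).real {ξ | ξ u ∈ loudSeeds H e u} = contWt H e u / 8 := by
  rw [pi_real_eval, geoTwo_loudSeeds]

lemma seedPi_noCont (u : P) :
    (seedPi P).real {ξ | ∀ x, H.Adj u x → ξ x ∉ contSeeds H e x} ≤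
      Real.exp (-contSum H e u) := by
  have h := pi_real_rectangle geoTwo (Finset.univ.filter fun x => H.Adj u x)
    (fun x => (contSeeds H e x)ᶜ)
  simp only [Finset.mem_filter, Finset.mem_univ, true_and, Set.mem_compl_iff] at h
  rw [h]
  simp only [geoTwo_compl_contSeeds]
  exact prod_one_sub_le_exp _ _ fun x _ => contWt_le_one x

lemma seedPi_cont_noLoud (u : P) :
    (seedPi P).real {ξ | ξ u ∈ contSeeds H e u ∧ ∀ x, H.Adj u x → ξ x ∉ loudSeeds H e x} ≤
      contWt H e u * Real.exp (-(contSum H e u / 8)) := by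
  have h := pi_real_insert_rectangle geoTwo (u := u) (F := Finset.univ.filter fun x => H.Adj u x)
    (by simp) (contSeeds H e u) (fun x => (loudSeeds H e x)ᶜ)
  simp only [Finset.mem_filter, Finset.mem_univ, true_and, Set.mem_compl_iff] at h
  rw [h]
  simp only [geoTwo_compl_loudSeeds, geoTwo_contSeeds]
  refine mul_le_mul_of_nonneg_left ?_ (contWt_nonneg u)
  have := prod_one_sub_le_exp (Finset.univ.filter fun x => H.Adj u x)
    (fun x => contWt H e x / 8) (fun x _ => by linarith [contWt_le_one (H := H) (e := e) x])
  rwa [← Finset.sum_div] at this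

/-- The set `F` is free because it will exceed the neighbourhood of `u`, in order to make the events
for different `u` disjoint. -/
lemma seedPi_loud_alone (u : P) (F : Finset P) (hu : u ∉ F) :
    contWt H e u / 8 * Real.exp (-((∑ x ∈ F, contWt H e x) / 4)) ≤
    (seedPi P).real {ξ | ξ u ∈ loudSeeds H e u ∧ ∀ x ∈ F, ξ x ∈ (loudSeeds H e x)ᶜ} := by
  rw [pi_real_insert_rectangle geoTwo hu]
  simp only [geoTwo_compl_loudSeeds, geoTwo_loudSeeds]
  refine mul_le_mul_of_nonneg_left ?_ (by linarith [contWt_nonneg (H := H) (e := e) u])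
  have := exp_le_prod_one_sub F (fun x => contWt H e x / 8)
    (fun x _ => by linarith [contWt_nonneg (H := H) (e := e) x])
    (fun x _ => by linarith [contWt_le_one (H := H) (e := e) x])
  rw [← Finset.sum_div] at this
  rwa [show (∑ x ∈ F, contWt H e x) / 4 = 2 * ((∑ x ∈ F, contWt H e x) / 8) by ring]

/-! ### Expected weight after one frame, and persistence of settled nodes. -/

variable {θ : ℝ} (hc : CapSpec cap θ)
include hc

lemma nextE_blocked_wt {u : P} (h : Blocked H e u) (ξ : P → ℕ × ℕ) :
    wt (nextE H cap e ξ u) ≤ wt (e u) / 2 + θ := by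
  have : ξ u ∉ contSeeds H e u := fun h' => h'.1 h
  simp only [nextE, this, if_false, h, true_or, if_true]
  exact hc.wt_le _

/-- Normally the exponent rises and the weight halves up to `θ`. There are three exceptions: `u` is
loud, or it contends without a loud neighbour (the weight may become `1`), or no neighbour contends
(the weight at most doubles). -/
lemma nextE_wt_le (u : P) (ξ : P → ℕ × ℕ) :
    wt (nextE H cap e ξ u) ≤ wt (e u) / 2 + θ +
      ({ξ | ξ u ∈ loudSeeds H e u}.indicator 1 ξ +
      {ξ | ξ u ∈ contSeeds H e u ∧ ∀ x, H.Adj u x → ξ x ∉ loudSeeds H e x}.indicator 1 ξ +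
      2 * wt (e u) * {ξ | ∀ x, H.Adj u x → ξ x ∉ contSeeds H e x}.indicator 1 ξ) := by
  have hθ := hc.nonneg
  have hw := wt_nonneg (e u)
  simp only [Set.indicator_apply, Set.mem_ofPred_eq, Pi.one_apply]
  have i1 : (0:ℝ) ≤ if ξ u ∈ loudSeeds H e u then 1 else 0 := by split_ifs <;> norm_num
  have i2 : (0:ℝ) ≤ if ξ u ∈ contSeeds H e u ∧ ∀ x, H.Adj u x → ξ x ∉ loudSeeds H e x
    then 1 else 0 := by split_ifs <;> norm_num
  have i3 : (0:ℝ) ≤ if ∀ x, H.Adj u x → ξ x ∉ contSeeds H e x then 1 else 0 := by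
    split_ifs <;> norm_num
  have i3' := mul_nonneg (mul_nonneg (zero_le_two (α := ℝ)) hw) i3
  unfold nextE
  by_cases h1 : ξ u ∈ contSeeds H e u
  · rw [if_pos h1]
    by_cases h2 : ξ u ∈ loudSeeds H e u ∨ ∀ x, H.Adj u x → ξ x ∉ loudSeeds H e x
    · rw [if_pos h2, wt_zero]
      rcases h2 with h2 | h2
      · rw [if_pos h2] at i1 ⊢; linarith
      · rw [if_pos (⟨h1, h2⟩ : _ ∧ _)] at i2 ⊢; linarith
    · rw [if_neg h2]; linarith [hc.wt_le (e u)]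
  · rw [if_neg h1]
    by_cases h2 : Blocked H e u ∨ ∃ x, H.Adj u x ∧ ξ x ∈ contSeeds H e x
    · rw [if_pos h2]; linarith [hc.wt_le (e u)]
    · rw [if_neg h2]
      push Not at h2
      rw [if_pos h2.2] at i3 i3' ⊢
      have : wt (max (e u - 1) 1) ≤ 2 * wt (e u) := by
        rcases Nat.lt_or_ge (e u) 1 with h3 | h3
        -- An unblocked node with exponent `0` contends with every seed.
        · exact absurd (⟨h2.1, by omega⟩ : _ ∧ _) h1
        · obtain ⟨k, hk⟩ := Nat.exists_eq_add_of_le' h3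
          rw [hk, wt_succ]
          have := wt_anti (show k ≤ max (k + 1 - 1) 1 by omega)
          linarith
      linarith

lemma integral_nextE_wt_le (u : P) :
    ∫ ξ, wt (nextE H cap e ξ u) ∂(seedPi P) ≤ wt (e u) / 2 + θ +
      (wt (e u) / 8 + wt (e u) * Real.exp (-(contSum H e u / 8)) +
        2 * wt (e u) * Real.exp (-contSum H e u)) := by
  have hw := wt_nonneg (e u)
  have int : ∀ s : Set (P → ℕ × ℕ), Integrable (s.indicator (1 : (P → ℕ × ℕ) → ℝ)) (seedPi P) :=
    fun s => (integrable_const (1:ℝ)).indicator MeasurableSet.of_discrete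
  calc ∫ ξ, wt (nextE H cap e ξ u) ∂(seedPi P)
      ≤ _ := integral_mono (integrable_of_bdd 1 fun ξ => by
          rw [abs_of_nonneg (wt_nonneg _)]; exact wt_le_one _)
          ((integrable_const _).add (((int _).add (int _)).add ((int _).const_mul _)))
          (nextE_wt_le hc u)
    _ = wt (e u) / 2 + θ + ((seedPi P).real {ξ | ξ u ∈ loudSeeds H e u} +
      (seedPi P).real {ξ | ξ u ∈ contSeeds H e u ∧ ∀ x, H.Adj u x → ξ x ∉ loudSeeds H e x} +
      2 * wt (e u) * (seedPi P).real {ξ | ∀ x, H.Adj u x → ξ x ∉ contSeeds H e x}) := by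
        refine (integral_add (integrable_const _)
          (((int _).add (int _)).add ((int _).const_mul _))).trans ?_
        rw [integral_add' ((int _).add (int _)) ((int _).const_mul _),
          integral_add' (int _) (int _), integral_const_mul, integral_indicator_one .of_discrete,
          integral_indicator_one .of_discrete, integral_indicator_one .of_discrete]
        simp
    _ ≤ _ := by
        rw [seedPi_loud]
        have h1 := contWt_le (H := H) (e := e) u
        have h2 := seedPi_cont_noLoud (H := H) (e := e) u
        have h3 := seedPi_noCont (H := H) (e := e) u
        have h4 := mul_le_mul_of_nonneg_right h1 (Real.exp_pos (-(contSum H e u / 8))).le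
        have h5 := mul_le_mul_of_nonneg_left h3 (mul_nonneg zero_le_two hw)
        linarith

lemma integral_nextE_wt_le_four (u : P) :
    ∫ ξ, wt (nextE H cap e ξ u) ∂(seedPi P) ≤ 4 * wt (e u) + θ := by
  have hw := wt_nonneg (e u)
  have hs := contSum_nonneg (H := H) (e := e) u
  have h := integral_nextE_wt_le (H := H) (e := e) hc u
  have h1 : Real.exp (-(contSum H e u / 8)) ≤ 1 := Real.exp_le_one_iff.2 (by linarith)
  have h2 : Real.exp (-contSum H e u) ≤ 1 := Real.exp_le_one_iff.2 (by linarith)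
  nlinarith [mul_le_mul_of_nonneg_left h1 hw, mul_le_mul_of_nonneg_left h2 hw]

/-- A blocked node never contends, so its weight halves. With 32 expected contenders around, the
chances that none is loud and that none contends are both at most `exp (-4) ≤ 0.025`, and `0.5 +
0.125 + 0.025 + 2 * 0.025 = 0.7`. -/
lemma integral_nextE_wt_le_heavy (u : P) (hu : Blocked H e u ∨ 32 ≤ contSum H e u) :
    ∫ ξ, wt (nextE H cap e ξ u) ∂(seedPi P) ≤ 0.7 * wt (e u) + θ := by
  have hw := wt_nonneg (e u)
  rcases hu with hu | hu
  · calc ∫ ξ, wt (nextE H cap e ξ u) ∂(seedPi P) ≤ ∫ ξ, (wt (e u) / 2 + θ) ∂(seedPi P) :=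
        integral_mono (integrable_of_bdd 1 fun ξ => by
          rw [abs_of_nonneg (wt_nonneg _)]; exact wt_le_one _) (integrable_const _)
          (nextE_blocked_wt hc hu)
      _ ≤ _ := by simp; linarith
  · have h := integral_nextE_wt_le (H := H) (e := e) hc u
    have e4 : Real.exp (-4) ≤ 0.025 := by
      have h2 : (2.7182818283 : ℝ) ^ 4 ≤ Real.exp 1 ^ 4 :=
        pow_le_pow_left₀ (by norm_num) Real.exp_one_gt_d9.le 4
      rw [← Real.exp_nat_mul] at h2
      rw [Real.exp_neg]
      norm_num at h2 ⊢
      rw [inv_le_comm₀ (Real.exp_pos _) (by norm_num)]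
      linarith
    have h1 : Real.exp (-(contSum H e u / 8)) ≤ 0.025 :=
      (Real.exp_le_exp.2 (by linarith)).trans e4
    have h2 : Real.exp (-contSum H e u) ≤ 0.025 :=
      (Real.exp_le_exp.2 (by linarith)).trans e4
    nlinarith [mul_le_mul_of_nonneg_left h1 hw, mul_le_mul_of_nonneg_left h2 hw]

/-- A node that is loud while no neighbour is becomes a true MIS node. -/
lemma trueMIS_of_loud {u : P} {ξ : P → ℕ × ℕ} (h : ξ u ∈ loudSeeds H e u)
    (h' : ∀ x, H.Adj u x → ξ x ∉ loudSeeds H e x) : TrueMIS H (nextE H cap e ξ) u := by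
  refine ⟨by simp [nextE, loudSeeds_subset u h, h], fun x hx => ?_⟩
  have hex : ¬ ∀ y, H.Adj x y → ξ y ∉ loudSeeds H e y := fun hh => hh u hx.symm h
  have := hc.one_le (e x)
  simp only [nextE, h' x hx, hex, or_self, if_false]
  split_ifs <;> omega

/-- All neighbours are blocked and none contends, whereas the node itself contends for certain and
meets no loud neighbour. -/
lemma trueMIS_nextE {u : P} (h : TrueMIS H e u) (ξ : P → ℕ × ℕ) :
    TrueMIS H (nextE H cap e ξ) u := by
  have hb : ∀ x, H.Adj u x → Blocked H e x := fun x hx => ⟨h.2 x hx, u, hx.symm, h.1⟩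
  refine ⟨?_, fun x hx => ?_⟩
  · have h1 : ξ u ∈ contSeeds H e u := ⟨fun h' => h'.1 h.1, by rw [h.1]; omega⟩
    simp only [nextE, h1, if_true]
    rw [if_pos (Or.inr fun x hx h' => h'.1.1 (hb x hx))]
  · have h1 : ξ x ∉ contSeeds H e x := fun h' => h'.1 (hb x hx)
    have := hc.one_le (e x)
    simp only [nextE, h1, hb x hx, if_false, true_or, if_true]
    omega

lemma settled_nextE {u : P} (h : Settled H e u) (ξ : P → ℕ × ℕ) :
    Settled H (nextE H cap e ξ) u :=
  h.imp (fun h => trueMIS_nextE hc h ξ) fun ⟨x, hx, h⟩ => ⟨x, hx, trueMIS_nextE hc h ξ⟩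

lemma nextE_le (u : P) (ξ : P → ℕ × ℕ) : nextE H cap e ξ u ≤ e u + 1 := by
  unfold nextE
  have := hc.le_self (e u + 1)
  split_ifs <;> omega

/-- Settled nodes stay settled, so the set of unsettled neighbours can only shrink. -/
lemma load_nextE_le (v : P) (ξ : P → ℕ × ℕ) :
    load H (nextE H cap e ξ) v ≤ ∑ u ∈ unsettledNbrs H e v, wt (nextE H cap e ξ u) := by
  refine Finset.sum_le_sum_of_subset_of_nonneg (fun u hu => ?_) fun _ _ _ => wt_nonneg _
  simp only [unsettledNbrs, Finset.mem_filter, Finset.mem_univ, true_and] at hu ⊢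
  exact ⟨hu.1, fun h => hu.2 (settled_nextE hc h ξ)⟩

omit hc in
lemma integrable_load_nextE (v : P) :
    Integrable (fun ξ => load H (nextE H cap e ξ) v) (seedPi P) := by
  refine integrable_of_bdd (Fintype.card P) fun ξ => ?_
  rw [abs_of_nonneg (load_nonneg v)]
  refine (Finset.sum_le_card_nsmul _ _ 1 fun u _ => wt_le_one _).trans ?_
  simp only [nsmul_eq_mul, mul_one]
  exact_mod_cast Finset.card_le_univ _

lemma integral_load_le (v : P) : ∫ ξ, load H (nextE H cap e ξ) v ∂(seedPi P) ≤
    ∑ u ∈ unsettledNbrs H e v, ∫ ξ, wt (nextE H cap e ξ u) ∂(seedPi P) := by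
  have int : ∀ u, Integrable (fun ξ => wt (nextE H cap e ξ u)) (seedPi P) := fun u =>
    integrable_of_bdd 1 fun ξ => by rw [abs_of_nonneg (wt_nonneg _)]; exact wt_le_one _
  rw [← integral_finsetSum _ fun u _ => int u]
  exact integral_mono (integrable_load_nextE v) (integrable_finsetSum _ fun u _ => int u)
    (load_nextE_le hc v)

variable (H) in
omit hc in
lemma card_unsettledNbrs_le (v : P) :
    ((unsettledNbrs H e v).card : ℝ) ≤ (Finset.univ.filter fun u => H.Adj v u).card := by
  refine Nat.cast_le.2 (Finset.card_le_card fun u hu => ?_)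
  simp only [unsettledNbrs, Finset.mem_filter, Finset.mem_univ, true_and] at hu ⊢
  exact hu.1

end Contention

/-! ### Drift of the potential under contention -/

/-- The last item needed to reach `c` overshoots by at most `1`. This bounds the weight of the
competing light neighbours in `settle_of_light`. -/
lemma exists_subset_sum_le {ι : Type} (L : Finset ι) (w : ι → ℝ) (h1 : ∀ i, w i ≤ 1)
    {c : ℝ} (hc : 0 ≤ c) (h : c ≤ ∑ i ∈ L, w i) :
    ∃ U ⊆ L, c ≤ ∑ i ∈ U, w i ∧ ∑ i ∈ U, w i ≤ c + 1 := by
  classical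
  induction L using Finset.induction_on with
  | empty => exact ⟨∅, by simp, by simpa using h, by simp; linarith⟩
  | insert x L hx ih =>
    by_cases h2 : c ≤ ∑ i ∈ L, w i
    · obtain ⟨U, hU, h3⟩ := ih h2
      exact ⟨U, hU.trans (Finset.subset_insert _ _), h3⟩
    · refine ⟨_, le_rfl, h, ?_⟩
      rw [Finset.sum_insert hx]
      linarith [h1 x]

/-- The exponent of the load in the potential. -/
noncomputable def driftA : ℝ := Real.exp (-9) / 12800000

lemma driftA_pos : 0 < driftA := by unfold driftA; positivity

lemma driftA_le : driftA ≤ 1 / 12800000 := by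
  unfold driftA
  have : Real.exp (-9) ≤ 1 := Real.exp_le_one_iff.2 (by norm_num)
  linarith

section Contention

open scoped Classical

variable {P : Type} [Fintype P] {H : SimpleGraph P} {cap : ℕ → ℕ} {e : P → ℕ}

variable (H e) in
/-- The potential of a node: large while it and its neighbours are unlikely to settle soon. -/
noncomputable def pot (v : P) : ℝ :=
  if Settled H e v then 0 else (load H e v + 1 / 16) ^ driftA * (1 + driftA / 20) ^ e v

variable (H e) in
/-- The unsettled neighbours that contend against little competition. -/
noncomputable def lightNbrs (v : P) : Finset P :=
  (unsettledNbrs H e v).filter fun u => ¬ (Blocked H e u ∨ 32 ≤ contSum H e u)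

/-- If `x` were a true MIS node, `v` would be settled; and with exponent `0` it cannot be adjacent
to one. -/
lemma settled_of_unsettled_zero {x v : P} (hv : ¬ Settled H e v) (hx : H.Adj v x)
    (h0 : e x = 0) : ¬ Settled H e x := by
  rintro (h | ⟨w, hw, h⟩)
  · exact hv (Or.inr ⟨x, hx, h⟩)
  · exact h.2 x hw.symm h0

lemma one_le_load {x v : P} (hv : ¬ Settled H e v) (hx : H.Adj v x) (h0 : e x = 0) :
    1 ≤ load H e v := by
  have hm : x ∈ unsettledNbrs H e v := by
    simp [unsettledNbrs, hx, settled_of_unsettled_zero hv hx h0]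
  calc (1:ℝ) = wt (e x) := by rw [h0, wt_zero]
    _ ≤ _ := Finset.single_le_sum (f := fun u => wt (e u)) (fun _ _ => wt_nonneg _) hm

/-- A settled neighbour of an unsettled node is not itself a true MIS node, so it is blocked by one
and never contends. -/
lemma contSum_le_load {v : P} (hv : ¬ Settled H e v) : contSum H e v ≤ load H e v := by
  unfold contSum load
  rw [← Finset.sum_filter_add_sum_filter_not _ (fun u => ¬ Settled H e u)]
  have h2 : ∑ x ∈ Finset.univ.filter (fun x => H.Adj v x) with ¬¬ Settled H e x,
      contWt H e x = 0 := by
    refine Finset.sum_eq_zero fun x hx => ?_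
    simp only [Finset.mem_filter, Finset.mem_univ, true_and, not_not] at hx
    rcases hx.2 with h | ⟨w, hw, h⟩
    · exact absurd (Or.inr ⟨x, hx.1, h⟩) hv
    · simp [contWt, show Blocked H e x from ⟨h.2 x hw.symm, w, hw, h.1⟩]
  rw [h2, add_zero, Finset.filter_filter]
  exact Finset.sum_le_sum fun x _ => contWt_le x

variable {θ : ℝ} (hc : CapSpec cap θ)
include hc

lemma integral_load_le_four (v : P)
    (hθ : (Finset.univ.filter fun u => H.Adj v u).card * θ ≤ 1 / 16000) :
    ∫ ξ, load H (nextE H cap e ξ) v ∂(seedPi P) ≤ 4 * load H e v + 1 / 16000 := by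
  refine (integral_load_le hc v).trans ?_
  refine (Finset.sum_le_sum fun u _ => integral_nextE_wt_le_four hc u).trans ?_
  rw [Finset.sum_add_distrib, ← Finset.mul_sum, Finset.sum_const, nsmul_eq_mul]
  have := mul_le_mul_of_nonneg_right (card_unsettledNbrs_le H (e := e) v) hc.nonneg
  unfold load
  linarith

lemma integral_load_le_light (v : P)
    (hθ : (Finset.univ.filter fun u => H.Adj v u).card * θ ≤ 1 / 16000)
    (hl : ∑ u ∈ lightNbrs H e v, wt (e u) ≤ 1 / 16000) :
    ∫ ξ, load H (nextE H cap e ξ) v ∂(seedPi P) ≤ 0.7 * load H e v + 5 / 16000 := by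
  refine (integral_load_le hc v).trans ?_
  have h1 : ∀ u ∈ unsettledNbrs H e v, ∫ ξ, wt (nextE H cap e ξ u) ∂(seedPi P) ≤
      0.7 * wt (e u) + (if ¬ (Blocked H e u ∨ 32 ≤ contSum H e u) then 4 * wt (e u) else 0) + θ := by
    intro u _
    have hw := wt_nonneg (e u)
    split_ifs with h
    · linarith [integral_nextE_wt_le_heavy (H := H) (e := e) hc u h]
    · linarith [integral_nextE_wt_le_four (H := H) (e := e) hc u]
  refine (Finset.sum_le_sum h1).trans ?_
  rw [Finset.sum_add_distrib, Finset.sum_add_distrib, ← Finset.mul_sum, Finset.sum_const,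
    nsmul_eq_mul, ← Finset.sum_filter, ← Finset.mul_sum]
  have := mul_le_mul_of_nonneg_right (card_unsettledNbrs_le H (e := e) v) hc.nonneg
  unfold lightNbrs at hl
  unfold load
  linarith

/-- For `u` in a truncated set `U` of light neighbours, consider the event that `u` is the only loud
node in `U` and in its neighbourhood. These events are disjoint, and each makes `u` a true MIS node
next to `v`. At most 36 expected contenders have to avoid being loud, which costs a factor `exp (-36
/ 4)`. -/
lemma settle_of_light (v : P) (hl : 1 / 16000 ≤ ∑ u ∈ lightNbrs H e v, wt (e u)) :
    100 * driftA ≤ (seedPi P).real {ξ | Settled H (nextE H cap e ξ) v} := by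
  obtain ⟨U, hU, hU1, hU2⟩ := exists_subset_sum_le (lightNbrs H e v) (fun u => wt (e u))
    (fun u => wt_le_one _) (by norm_num) hl
  have hUl : ∀ u ∈ U, H.Adj v u ∧ ¬ Blocked H e u ∧ contSum H e u < 32 := by
    intro u hu
    have := hU hu
    simp only [lightNbrs, unsettledNbrs, Finset.mem_filter, Finset.mem_univ, true_and, not_or,
      not_le] at this
    exact ⟨this.1.1, this.2⟩
  set F : P → Finset P := fun u => ((Finset.univ.filter fun x => H.Adj u x) ∪ U).erase u with hF
  set S : P → Set (P → ℕ × ℕ) := fun u =>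
    {ξ | ξ u ∈ loudSeeds H e u ∧ ∀ x ∈ F u, ξ x ∈ (loudSeeds H e x)ᶜ} with hS
  have hd : (U : Set P).PairwiseDisjoint S := by
    intro u hu w hw huw
    rw [Function.onFun, Set.disjoint_left]
    intro ξ h1 h2
    exact h2.2 u (by simp [hF, huw]; exact Or.inr hu) h1.1
  have hsub : (⋃ u ∈ U, S u) ⊆ {ξ | Settled H (nextE H cap e ξ) v} := by
    intro ξ hξ
    simp only [Set.mem_iUnion] at hξ
    obtain ⟨u, hu, h1, h2⟩ := hξ
    refine Or.inr ⟨u, (hUl u hu).1, trueMIS_of_loud hc h1 fun x hx => ?_⟩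
    exact h2 x (by simp [hF, hx, hx.ne'])
  have hprob : ∀ u ∈ U, wt (e u) / 8 * Real.exp (-9) ≤ (seedPi P).real (S u) := by
    intro u hu
    refine le_trans ?_ (seedPi_loud_alone u (F u) (by simp [hF]))
    have h1 : contWt H e u = wt (e u) := by simp [contWt, (hUl u hu).2.1]
    have h2 : ∑ x ∈ F u, contWt H e x ≤ 36 := by
      calc ∑ x ∈ F u, contWt H e x
          ≤ ∑ x ∈ (Finset.univ.filter fun x => H.Adj u x) ∪ U, contWt H e x :=
            Finset.sum_le_sum_of_subset_of_nonneg (Finset.erase_subset _ _)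
              fun x _ _ => contWt_nonneg x
        _ ≤ contSum H e u + ∑ x ∈ U, contWt H e x := by
            rw [contSum, ← Finset.sum_union_inter]
            linarith [Finset.sum_nonneg (s := (Finset.univ.filter fun x => H.Adj u x) ∩ U)
              fun x _ => contWt_nonneg (H := H) (e := e) x]
        _ ≤ contSum H e u + ∑ x ∈ U, wt (e x) := by
            gcongr with x
            exact contWt_le x
        _ ≤ 36 := by linarith [(hUl u hu).2.2]
    rw [h1]
    refine mul_le_mul_of_nonneg_left (Real.exp_le_exp.2 (by linarith)) ?_
    linarith [wt_nonneg (e u)]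
  -- The value of `driftA` is chosen so that this is an equality.
  calc 100 * driftA = (1 / 16000) / 8 * Real.exp (-9) := by unfold driftA; ring
    _ ≤ (∑ u ∈ U, wt (e u)) / 8 * Real.exp (-9) := by gcongr
    _ = ∑ u ∈ U, wt (e u) / 8 * Real.exp (-9) := by rw [Finset.sum_div, Finset.sum_mul]
    _ ≤ ∑ u ∈ U, (seedPi P).real (S u) := Finset.sum_le_sum hprob
    _ = (seedPi P).real (⋃ u ∈ U, S u) :=
        (measureReal_biUnion_finset hd fun u _ => MeasurableSet.of_discrete).symm
    _ ≤ _ := measureReal_mono hsub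

/-- Here `v` itself is loud with probability `1/16`, and with probability at least `1 - 1/64` no
neighbour is. -/
lemma settle_of_one {v : P} (h1 : e v = 1) (hb : ¬ Blocked H e v)
    (hs : contSum H e v ≤ 1 / 16) :
    100 * driftA ≤ (seedPi P).real {ξ | Settled H (nextE H cap e ξ) v} := by
  have h2 := seedPi_loud_alone (H := H) (e := e) v (Finset.univ.filter fun x => H.Adj v x)
    (by simp)
  refine le_trans ?_ (h2.trans (measureReal_mono fun ξ hξ => Or.inl
    (trueMIS_of_loud hc hξ.1 fun x hx => hξ.2 x (by simpa using hx))))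
  have h3 : contWt H e v = 1 / 2 := by simp [contWt, hb, h1, wt]
  have h4 := Real.add_one_le_exp (-((∑ x with H.Adj v x, contWt H e x) / 4))
  have h5 : (∑ x with H.Adj v x, contWt H e x) ≤ 1 / 16 := hs
  have := driftA_le
  rw [h3]
  nlinarith

omit hc in
lemma seedPi_someCont (v : P) :
    (seedPi P).real {ξ | ∃ x, H.Adj v x ∧ ξ x ∈ contSeeds H e x} ≤ contSum H e v := by
  have : {ξ : P → ℕ × ℕ | ∃ x, H.Adj v x ∧ ξ x ∈ contSeeds H e x} =
      ⋃ x ∈ Finset.univ.filter (fun x => H.Adj v x), {ξ | ξ x ∈ contSeeds H e x} := by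
    ext ξ; simp
  rw [this]
  refine (measureReal_biUnion_finset_le _ _).trans (Finset.sum_le_sum fun x _ => ?_)
  rw [pi_real_eval, geoTwo_contSeeds]

omit hc in
lemma pot_nonneg (v : P) : 0 ≤ pot H e v := by
  have := load_nonneg (H := H) (e := e) v
  have := driftA_pos
  unfold pot
  split_ifs <;> positivity

/-- One step of the potential, relative to its present value. -/
lemma pot_nextE_le {v : P} (hv : ¬ Settled H e v) (ξ : P → ℕ × ℕ) :
    pot H (nextE H cap e ξ) v ≤ pot H e v *
      ({ξ | Settled H (nextE H cap e ξ) v}ᶜ.indicator 1 ξ *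
      (1 - driftA + driftA * ((load H (nextE H cap e ξ) v + 1 / 16) / (load H e v + 1 / 16))) *
      ((1 + driftA / 20) ^ nextE H cap e ξ v / (1 + driftA / 20) ^ e v)) := by
  have hl := load_nonneg (H := H) (e := e) v
  have hl' := load_nonneg (H := H) (e := nextE H cap e ξ) v
  have ha := driftA_pos
  have ha' := driftA_le
  by_cases h : Settled H (nextE H cap e ξ) v
  · simp [pot, h]
  rw [Set.indicator_of_mem (by simpa using h)]
  simp only [pot, h, hv, if_false, Pi.one_apply, one_mul]
  set X := (load H (nextE H cap e ξ) v + 1 / 16) / (load H e v + 1 / 16) with hX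
  have hX0 : 0 ≤ X := by positivity
  have h1 : load H (nextE H cap e ξ) v + 1 / 16 = (load H e v + 1 / 16) * X := by
    rw [hX]; field_simp
  -- Bernoulli's inequality replaces the concave power by its tangent at `1`, so only the expected
  -- load ratio is needed later.
  have h2 : X ^ driftA ≤ 1 - driftA + driftA * X := by
    have := rpow_one_add_le_one_add_mul_self (s := X - 1) (by linarith) ha.le (by linarith)
    rw [show 1 + (X - 1) = X by ring] at this
    linarith
  rw [h1, Real.mul_rpow (by positivity) hX0]
  have hB : (0:ℝ) < (1 + driftA / 20) ^ e v := by positivity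
  calc (load H e v + 1 / 16) ^ driftA * X ^ driftA * (1 + driftA / 20) ^ nextE H cap e ξ v
      ≤ (load H e v + 1 / 16) ^ driftA * (1 - driftA + driftA * X) *
        (1 + driftA / 20) ^ nextE H cap e ξ v := by gcongr
    _ = _ := by field_simp

omit hc in
lemma integrable_ratio (v : P) : Integrable
    (fun ξ => (load H (nextE H cap e ξ) v + 1 / 16) / (load H e v + 1 / 16)) (seedPi P) :=
  ((integrable_load_nextE v).add (integrable_const _)).div_const _

omit hc in
lemma integral_ratio (v : P) :
    ∫ ξ, (load H (nextE H cap e ξ) v + 1 / 16) / (load H e v + 1 / 16) ∂(seedPi P) =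
      (∫ ξ, load H (nextE H cap e ξ) v ∂(seedPi P) + 1 / 16) / (load H e v + 1 / 16) := by
  rw [integral_div, integral_add (integrable_load_nextE v) (integrable_const _)]
  simp

lemma step_ratio_le (v : P) (ξ : P → ℕ × ℕ) :
    (1 + driftA / 20) ^ nextE H cap e ξ v / (1 + driftA / 20) ^ e v ≤ 1 + driftA / 20 := by
  have ha := driftA_pos
  rw [div_le_iff₀ (by positivity), ← pow_succ']
  exact pow_le_pow_right₀ (by linarith) (nextE_le hc v ξ)

/-- Without contending neighbours the exponent falls by at least one, and `1 / (1 + a/20) ≤ 1 -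
a/21`. Otherwise it rises by at most one, which the summand `a/10` covers. -/
lemma step_ratio_le' {v : P} (hb : ¬ Blocked H e v) (h2 : 2 ≤ e v) (ξ : P → ℕ × ℕ) :
    (1 + driftA / 20) ^ nextE H cap e ξ v / (1 + driftA / 20) ^ e v ≤ 1 - driftA / 21 +
      driftA / 10 * {ξ | ∃ x, H.Adj v x ∧ ξ x ∈ contSeeds H e x}.indicator 1 ξ := by
  have ha := driftA_pos
  have ha' := driftA_le
  by_cases h : ∃ x, H.Adj v x ∧ ξ x ∈ contSeeds H e x
  · rw [Set.indicator_of_mem (by exact h), Pi.one_apply]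
    linarith [step_ratio_le (H := H) (e := e) hc v ξ]
  · rw [Set.indicator_of_notMem (by exact h), mul_zero, add_zero]
    have h3 : nextE H cap e ξ v + 1 ≤ e v := by
      push Not at h
      unfold nextE
      by_cases h4 : ξ v ∈ contSeeds H e v
      · rw [if_pos h4, if_pos (Or.inr fun x hx h' => h x hx (loudSeeds_subset x h'))]
        omega
      · rw [if_neg h4, if_neg (by push Not; exact ⟨hb, h⟩)]
        omega
    have h4 : (1 + driftA / 20) ^ (nextE H cap e ξ v + 1) ≤ (1 + driftA / 20) ^ e v :=
      pow_le_pow_right₀ (by linarith) h3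
    rw [div_le_iff₀ (by positivity)]
    rw [pow_succ] at h4
    have h5 : 1 ≤ (1 - driftA / 21) * (1 + driftA / 20) := by nlinarith
    have h6 : 0 ≤ 1 - driftA / 21 := by linarith
    have h7 : (0:ℝ) ≤ (1 + driftA / 20) ^ nextE H cap e ξ v := by positivity
    nlinarith [mul_le_mul_of_nonneg_left h4 h6]

/-- Settling annihilates the potential. The gain `100 * a` exceeds the cost `5 * a` of an at most
fivefold expected load ratio and the cost `a/20` of a larger exponent. -/
lemma integral_pot_of_settle {v : P} (hv : ¬ Settled H e v)
    (hθ : (Finset.univ.filter fun u => H.Adj v u).card * θ ≤ 1 / 16000)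
    (hs : 100 * driftA ≤ (seedPi P).real {ξ | Settled H (nextE H cap e ξ) v}) :
    ∫ ξ, pot H (nextE H cap e ξ) v ∂(seedPi P) ≤ (1 - driftA / 100) * pot H e v := by
  have ha := driftA_pos
  have ha' := driftA_le
  have hl := load_nonneg (H := H) (e := e) v
  set X : (P → ℕ × ℕ) → ℝ :=
    fun ξ => (load H (nextE H cap e ξ) v + 1 / 16) / (load H e v + 1 / 16) with hX
  have hX0 : ∀ ξ, 0 ≤ X ξ := fun ξ => by
    have := load_nonneg (H := H) (e := nextE H cap e ξ) v
    simp only [hX]; positivity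
  have hXi : Integrable X (seedPi P) := integrable_ratio v
  have hXE : ∫ ξ, X ξ ∂(seedPi P) ≤ 5 := by
    rw [hX, integral_ratio, div_le_iff₀ (by positivity)]
    linarith [integral_load_le_four (e := e) hc v hθ]
  have int : ∀ s : Set (P → ℕ × ℕ), Integrable (s.indicator (1 : (P → ℕ × ℕ) → ℝ)) (seedPi P) :=
    fun s => (integrable_const (1:ℝ)).indicator MeasurableSet.of_discrete
  set S := {ξ | Settled H (nextE H cap e ξ) v} with hS
  have hpt : ∀ ξ, pot H (nextE H cap e ξ) v ≤
      pot H e v * (1 + driftA / 20) * (Sᶜ.indicator 1 ξ + driftA * X ξ) := by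
    intro ξ
    refine (pot_nextE_le hc hv ξ).trans ?_
    rw [mul_assoc (pot H e v)]
    refine mul_le_mul_of_nonneg_left ?_ (pot_nonneg v)
    have h1 := step_ratio_le (H := H) (e := e) hc v ξ
    have h2 : 0 ≤ 1 - driftA + driftA * X ξ := by nlinarith [hX0 ξ]
    have h3 : 0 ≤ Sᶜ.indicator (1 : (P → ℕ × ℕ) → ℝ) ξ :=
      Set.indicator_nonneg (fun _ _ => zero_le_one) _
    have h4 : Sᶜ.indicator (1 : (P → ℕ × ℕ) → ℝ) ξ ≤ 1 :=
      Set.indicator_le_self' (fun _ _ => zero_le_one) _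
    calc _ ≤ Sᶜ.indicator 1 ξ * (1 - driftA + driftA * X ξ) * (1 + driftA / 20) :=
          mul_le_mul_of_nonneg_left h1 (mul_nonneg h3 h2)
      _ = (1 + driftA / 20) * (Sᶜ.indicator 1 ξ * (1 - driftA + driftA * X ξ)) := by ring
      _ ≤ _ := by
          refine mul_le_mul_of_nonneg_left ?_ (by linarith)
          have := mul_nonneg ha.le (hX0 ξ)
          nlinarith
  calc ∫ ξ, pot H (nextE H cap e ξ) v ∂(seedPi P)
      ≤ ∫ ξ, pot H e v * (1 + driftA / 20) * (Sᶜ.indicator 1 ξ + driftA * X ξ) ∂(seedPi P) :=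
        integral_mono_of_nonneg (ae_of_all _ fun ξ => pot_nonneg v)
          (((int _).add (hXi.const_mul _)).const_mul _) (ae_of_all _ hpt)
    _ = pot H e v * (1 + driftA / 20) *
        ((seedPi P).real Sᶜ + driftA * ∫ ξ, X ξ ∂(seedPi P)) := by
        rw [integral_const_mul, integral_add (int _) (hXi.const_mul _), integral_const_mul,
          integral_indicator_one .of_discrete]
    _ ≤ pot H e v * (1 + driftA / 20) * ((1 - 100 * driftA) + driftA * 5) := by
        rw [probReal_compl_eq_one_sub .of_discrete]
        have := pot_nonneg (H := H) (e := e) v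
        gcongr
    _ = pot H e v * ((1 + driftA / 20) * ((1 - 100 * driftA) + driftA * 5)) := by ring
    _ ≤ pot H e v * (1 - driftA / 100) :=
        mul_le_mul_of_nonneg_left (by nlinarith) (pot_nonneg v)
    _ = _ := mul_comm _ _

/-- The expected load ratio is at most `0.9`, a gain of `a/10`, and the exponent factor costs only
`a/20`. -/
lemma integral_pot_of_heavy {v : P} (hv : ¬ Settled H e v)
    (hθ : (Finset.univ.filter fun u => H.Adj v u).card * θ ≤ 1 / 16000)
    (hl : ∑ u ∈ lightNbrs H e v, wt (e u) ≤ 1 / 16000) (hload : 1 / 16 ≤ load H e v) :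
    ∫ ξ, pot H (nextE H cap e ξ) v ∂(seedPi P) ≤ (1 - driftA / 100) * pot H e v := by
  have ha := driftA_pos
  have ha' := driftA_le
  set X : (P → ℕ × ℕ) → ℝ :=
    fun ξ => (load H (nextE H cap e ξ) v + 1 / 16) / (load H e v + 1 / 16) with hX
  have hX0 : ∀ ξ, 0 ≤ X ξ := fun ξ => by
    have := load_nonneg (H := H) (e := nextE H cap e ξ) v
    simp only [hX]; positivity
  have hXi : Integrable X (seedPi P) := integrable_ratio v
  have hXE : ∫ ξ, X ξ ∂(seedPi P) ≤ 0.9 := by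
    rw [hX, integral_ratio, div_le_iff₀ (by positivity)]
    linarith [integral_load_le_light (e := e) hc v hθ hl]
  have hpt : ∀ ξ, pot H (nextE H cap e ξ) v ≤
      pot H e v * (1 + driftA / 20) * (1 - driftA + driftA * X ξ) := by
    intro ξ
    refine (pot_nextE_le hc hv ξ).trans ?_
    rw [mul_assoc (pot H e v)]
    refine mul_le_mul_of_nonneg_left ?_ (pot_nonneg v)
    have h1 := step_ratio_le (H := H) (e := e) hc v ξ
    have h2 : 0 ≤ 1 - driftA + driftA * X ξ := by nlinarith [hX0 ξ]
    have h3 : 0 ≤ {ξ | Settled H (nextE H cap e ξ) v}ᶜ.indicator (1 : (P → ℕ × ℕ) → ℝ) ξ :=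
      Set.indicator_nonneg (fun _ _ => zero_le_one) _
    have h4 : {ξ | Settled H (nextE H cap e ξ) v}ᶜ.indicator (1 : (P → ℕ × ℕ) → ℝ) ξ ≤ 1 :=
      Set.indicator_le_self' (fun _ _ => zero_le_one) _
    calc _ ≤ {ξ | Settled H (nextE H cap e ξ) v}ᶜ.indicator 1 ξ *
          (1 - driftA + driftA * X ξ) * (1 + driftA / 20) :=
          mul_le_mul_of_nonneg_left h1 (mul_nonneg h3 h2)
      _ ≤ 1 * (1 - driftA + driftA * X ξ) * (1 + driftA / 20) := by gcongr
      _ = _ := by ring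
  calc ∫ ξ, pot H (nextE H cap e ξ) v ∂(seedPi P)
      ≤ ∫ ξ, pot H e v * (1 + driftA / 20) * (1 - driftA + driftA * X ξ) ∂(seedPi P) :=
        integral_mono_of_nonneg (ae_of_all _ fun ξ => pot_nonneg v)
          (((integrable_const _).add (hXi.const_mul _)).const_mul _) (ae_of_all _ hpt)
    _ = pot H e v * (1 + driftA / 20) * (1 - driftA + driftA * ∫ ξ, X ξ ∂(seedPi P)) := by
        rw [integral_const_mul, integral_add (integrable_const _) (hXi.const_mul _),
          integral_const_mul]
        simp
    _ ≤ pot H e v * (1 + driftA / 20) * (1 - driftA + driftA * 0.9) := by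
        have := pot_nonneg (H := H) (e := e) v
        gcongr
    _ = pot H e v * ((1 + driftA / 20) * (1 - driftA + driftA * 0.9)) := by ring
    _ ≤ pot H e v * (1 - driftA / 100) :=
        mul_le_mul_of_nonneg_left (by nlinarith) (pot_nonneg v)
    _ = _ := mul_comm _ _

/-- The gain now comes from the exponent of `v`, which falls with probability at least `15/16`. To
first order the change is `-a/21 + a/160` from the exponent and at most `0.005 * a` from the load.
-/
lemma integral_pot_of_decrease {v : P} (hv : ¬ Settled H e v) (hb : ¬ Blocked H e v)
    (hθ : (Finset.univ.filter fun u => H.Adj v u).card * θ ≤ 1 / 16000)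
    (hl : ∑ u ∈ lightNbrs H e v, wt (e u) ≤ 1 / 16000) (hload : load H e v ≤ 1 / 16)
    (h2 : 2 ≤ e v) :
    ∫ ξ, pot H (nextE H cap e ξ) v ∂(seedPi P) ≤ (1 - driftA / 100) * pot H e v := by
  have ha := driftA_pos
  have ha' := driftA_le
  have hl0 := load_nonneg (H := H) (e := e) v
  set X : (P → ℕ × ℕ) → ℝ :=
    fun ξ => (load H (nextE H cap e ξ) v + 1 / 16) / (load H e v + 1 / 16) with hX
  have hX0 : ∀ ξ, 0 ≤ X ξ := fun ξ => by
    have := load_nonneg (H := H) (e := nextE H cap e ξ) v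
    simp only [hX]; positivity
  have hXi : Integrable X (seedPi P) := integrable_ratio v
  have hXE : ∫ ξ, X ξ ∂(seedPi P) ≤ 1.005 := by
    rw [hX, integral_ratio, div_le_iff₀ (by positivity)]
    linarith [integral_load_le_light (e := e) hc v hθ hl]
  have int : ∀ s : Set (P → ℕ × ℕ), Integrable (s.indicator (1 : (P → ℕ × ℕ) → ℝ)) (seedPi P) :=
    fun s => (integrable_const (1:ℝ)).indicator MeasurableSet.of_discrete
  set N := {ξ : P → ℕ × ℕ | ∃ x, H.Adj v x ∧ ξ x ∈ contSeeds H e x} with hN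
  have hNp : (seedPi P).real N ≤ 1 / 16 :=
    (seedPi_someCont v).trans ((contSum_le_load hv).trans hload)
  have hpt : ∀ ξ, pot H (nextE H cap e ξ) v ≤ pot H e v *
      ((1 - driftA / 21 - driftA + driftA ^ 2 / 10) + (driftA + driftA ^ 2 / 10) * X ξ +
        driftA / 10 * N.indicator 1 ξ) := by
    intro ξ
    refine (pot_nextE_le hc hv ξ).trans (mul_le_mul_of_nonneg_left ?_ (pot_nonneg v))
    have h1 := step_ratio_le' (H := H) (e := e) hc hb h2 ξ
    have h2 : 0 ≤ 1 - driftA + driftA * X ξ := by nlinarith [hX0 ξ]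
    have h3 : 0 ≤ {ξ | Settled H (nextE H cap e ξ) v}ᶜ.indicator (1 : (P → ℕ × ℕ) → ℝ) ξ :=
      Set.indicator_nonneg (fun _ _ => zero_le_one) _
    have h4 : {ξ | Settled H (nextE H cap e ξ) v}ᶜ.indicator (1 : (P → ℕ × ℕ) → ℝ) ξ ≤ 1 :=
      Set.indicator_le_self' (fun _ _ => zero_le_one) _
    have h5 : 0 ≤ N.indicator (1 : (P → ℕ × ℕ) → ℝ) ξ :=
      Set.indicator_nonneg (fun _ _ => zero_le_one) _
    have h6 : N.indicator (1 : (P → ℕ × ℕ) → ℝ) ξ ≤ 1 :=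
      Set.indicator_le_self' (fun _ _ => zero_le_one) _
    set Y := 1 - driftA / 21 + driftA / 10 * N.indicator (1 : (P → ℕ × ℕ) → ℝ) ξ with hY
    have hY0 : 0 ≤ Y := by have := mul_nonneg (by linarith : 0 ≤ driftA / 10) h5; linarith
    calc _ ≤ {ξ | Settled H (nextE H cap e ξ) v}ᶜ.indicator 1 ξ *
          (1 - driftA + driftA * X ξ) * Y :=
          mul_le_mul_of_nonneg_left h1 (mul_nonneg h3 h2)
      _ ≤ 1 * (1 - driftA + driftA * X ξ) * Y := by gcongr
      -- Both factors are perturbations of `1`; the cross term is of order `a ^ 2`, up to a factor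
      -- linear in `X`, which has bounded expectation.
      _ = Y + driftA * (X ξ - 1) + driftA * ((X ξ - 1) * (Y - 1)) := by ring
      _ ≤ Y + driftA * (X ξ - 1) + driftA * ((X ξ + 1) * (driftA / 10)) := by
          gcongr Y + driftA * (X ξ - 1) + driftA * ?_
          have hx := hX0 ξ
          have y1 : Y - 1 ≤ driftA / 10 := by nlinarith
          have y2 : -(driftA / 10) ≤ Y - 1 := by nlinarith
          nlinarith
      _ = _ := by rw [hY]; ring
  calc ∫ ξ, pot H (nextE H cap e ξ) v ∂(seedPi P)
      ≤ ∫ ξ, pot H e v *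
        ((1 - driftA / 21 - driftA + driftA ^ 2 / 10) + (driftA + driftA ^ 2 / 10) * X ξ +
        driftA / 10 * N.indicator 1 ξ) ∂(seedPi P) :=
        integral_mono_of_nonneg (ae_of_all _ fun ξ => pot_nonneg v)
          ((((integrable_const _).add (hXi.const_mul _)).add ((int _).const_mul _)).const_mul _)
          (ae_of_all _ hpt)
    _ = pot H e v * ((1 - driftA / 21 - driftA + driftA ^ 2 / 10) +
        (driftA + driftA ^ 2 / 10) * ∫ ξ, X ξ ∂(seedPi P) +
        driftA / 10 * (seedPi P).real N) := by
        rw [integral_const_mul]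
        congr 1
        refine (integral_add ((integrable_const _).add (hXi.const_mul _))
          ((int _).const_mul _)).trans ?_
        rw [integral_add' (integrable_const _) (hXi.const_mul _),
          integral_const_mul, integral_const_mul, integral_indicator_one .of_discrete]
        simp
    _ ≤ pot H e v * ((1 - driftA / 21 - driftA + driftA ^ 2 / 10) +
        (driftA + driftA ^ 2 / 10) * 1.005 + driftA / 10 * (1 / 16)) := by
        have := pot_nonneg (H := H) (e := e) v
        gcongr
    _ ≤ pot H e v * (1 - driftA / 100) :=
        mul_le_mul_of_nonneg_left (by nlinarith) (pot_nonneg v)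
    _ = _ := mul_comm _ _

/-- The potential shrinks by a constant factor in expectation. -/
theorem integral_pot_nextE_le (v : P)
    (hθ : (Finset.univ.filter fun u => H.Adj v u).card * θ ≤ 1 / 16000) :
    ∫ ξ, pot H (nextE H cap e ξ) v ∂(seedPi P) ≤ (1 - driftA / 100) * pot H e v := by
  by_cases hv : Settled H e v
  · simp [pot, hv, settled_nextE hc hv]
  by_cases hl : 1 / 16000 ≤ ∑ u ∈ lightNbrs H e v, wt (e u)
  · exact integral_pot_of_settle hc hv hθ (settle_of_light hc v hl)
  have hl := (not_le.1 hl).le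
  by_cases hload : 1 / 16 ≤ load H e v
  · exact integral_pot_of_heavy hc hv hθ hl hload
  have hload := not_le.1 hload
  -- A neighbour with exponent `0` would alone contribute load `1`; so under a small load `v` is not
  -- blocked, and its own exponent is not `0`, since otherwise it would be a true MIS node.
  have hb : ¬ Blocked H e v := fun ⟨_, x, hx, h0⟩ => by linarith [one_le_load hv hx h0]
  have he : e v ≠ 0 := fun h => hv (Or.inl ⟨h, fun x hx h0 => by linarith [one_le_load hv hx h0]⟩)
  by_cases h2 : 2 ≤ e v
  · exact integral_pot_of_decrease hc hv hb hθ hl hload.le h2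
  · exact integral_pot_of_settle hc hv hθ (settle_of_one hc (by omega) hb
      ((contSum_le_load hv).trans hload.le))

end Contention

/-! ### The lottery that cuts large exponents, and the chain of frames -/

/-- The seed of a process in a frame: lottery, contention, loudness. -/
abbrev FrameSeed : Type := ℕ × ℕ × ℕ

/-- The law of the seed of a process in a frame. -/
noncomputable abbrev frameLaw : Measure FrameSeed := geo.prod geoTwo

section Lottery

open scoped Classical

variable {P : Type} [Fintype P] (H : SimpleGraph P) (cap : ℕ → ℕ) (lv : P → Option ℕ) (e : P → ℕ)

/-- `u` draws a winning ticket. -/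
def Lot (y : P → ℕ) (u : P) : Prop := ∃ L, lv u = some L ∧ 3 * L < e u ∧ 2 * L ≤ y u

/-- `u` or a neighbour draws a winning ticket. -/
def Compl (y : P → ℕ) (u : P) : Prop := Lot lv e y u ∨ ∃ x, H.Adj u x ∧ Lot lv e y x

/-- The exponents after large ones have been cut. -/
noncomputable def clipE (y : P → ℕ) (u : P) : ℕ :=
  match lv u with
  -- The veto reaches two hops, so a ticket drawn by one neighbour of `v` protects the exponents of
  -- all neighbours of `v`.
  | some L => if 3 * L < e u ∧ ¬ Compl H lv e y u ∧ ∀ x, H.Adj u x → ¬ Compl H lv e y x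
      then 3 * L else e u
  | none => e u

/-- The exponents after a frame. -/
noncomputable def frameE (s : P → FrameSeed) : P → ℕ :=
  nextE H cap (clipE H lv e fun u => (s u).1) fun u => (s u).2

/-- The neighbours that take part in the lottery. -/
noncomputable def activeNbrs (v : P) : Finset P :=
  Finset.univ.filter fun x => H.Adj v x ∧ ∃ L, lv x = some L ∧ 3 * L < e x

variable {H cap lv e}

lemma clipE_le (y : P → ℕ) (u : P) : clipE H lv e y u ≤ e u := by
  unfold clipE
  split
  · split_ifs with h
    · exact h.1.le
    · exact le_rfl
  · exact le_rfl

lemma clipE_eq_or (y : P → ℕ) (u : P) : clipE H lv e y u = e u ∨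
    ∃ L, lv u = some L ∧ 3 * L < e u ∧ clipE H lv e y u = 3 * L ∧
      ∀ x, H.Adj u x → ¬ Compl H lv e y x := by
  unfold clipE
  split
  case h_1 L hL =>
    split_ifs with h
    · exact Or.inr ⟨L, hL, h.1, rfl, h.2.2⟩
    · exact Or.inl rfl
  case h_2 => exact Or.inl rfl

section

variable (hlv : ∀ u L, lv u = some L → 14 ≤ L)
include hlv

lemma clipE_eq_zero (y : P → ℕ) (u : P) : clipE H lv e y u = 0 ↔ e u = 0 := by
  rcases clipE_eq_or (H := H) (lv := lv) (e := e) y u with h | ⟨L, h1, h2, h3, _⟩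
  · rw [h]
  · have := hlv u L h1
    omega

lemma trueMIS_clipE (y : P → ℕ) (u : P) : TrueMIS H (clipE H lv e y) u ↔ TrueMIS H e u := by
  simp only [TrueMIS, ne_eq, clipE_eq_zero hlv]

lemma settled_clipE (y : P → ℕ) (u : P) : Settled H (clipE H lv e y) u ↔ Settled H e u := by
  simp only [Settled, trueMIS_clipE hlv]

/-- If an active neighbour draws a ticket, `v` complains and none of its neighbours is cut.
Otherwise a cut neighbour obtains weight `wt (3 * L) = wt L * wt (2 * L)`, where `wt L ≤ 1 / 16384`
because `14 ≤ L`. -/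
lemma load_clipE_le (y : P → ℕ) (v : P) : load H (clipE H lv e y) v ≤ load H e v +
    {y | ∀ x ∈ activeNbrs H lv e v, ¬ Lot lv e y x}.indicator 1 y *
      ((1 / 16384) * ∑ x ∈ activeNbrs H lv e v, wt (2 * (lv x).getD 0)) := by
  have hU : unsettledNbrs H (clipE H lv e y) v = unsettledNbrs H e v := by
    simp only [unsettledNbrs, settled_clipE hlv]
  unfold load
  rw [hU]
  have hS : 0 ≤ ∑ x ∈ activeNbrs H lv e v, wt (2 * (lv x).getD 0) :=
    Finset.sum_nonneg fun _ _ => wt_nonneg _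
  by_cases hy : ∀ x ∈ activeNbrs H lv e v, ¬ Lot lv e y x
  · rw [Set.indicator_of_mem (by exact hy), Pi.one_apply, one_mul]
    calc ∑ u ∈ unsettledNbrs H e v, wt (clipE H lv e y u)
        ≤ ∑ u ∈ unsettledNbrs H e v, (wt (e u) +
          if u ∈ activeNbrs H lv e v then 1 / 16384 * wt (2 * (lv u).getD 0) else 0) := by
          refine Finset.sum_le_sum fun u hu => ?_
          have hw := wt_nonneg (e u)
          have hw2 := wt_nonneg (2 * (lv u).getD 0)
          rcases clipE_eq_or (H := H) (lv := lv) (e := e) y u with h | ⟨L, h1, h2, h3, _⟩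
          · rw [h]; split_ifs <;> linarith
          · have hu' : u ∈ activeNbrs H lv e v := by
              simp only [unsettledNbrs, Finset.mem_filter, Finset.mem_univ, true_and] at hu
              simp only [activeNbrs, Finset.mem_filter, Finset.mem_univ, true_and]
              exact ⟨hu.1, L, h1, h2⟩
            rw [if_pos hu', h3, h1, Option.getD_some]
            have : wt (3 * L) ≤ 1 / 16384 * wt (2 * L) := by
              have h14 := wt_anti (hlv u L h1)
              rw [show 3 * L = L + 2 * L by ring, wt, pow_add]
              have : wt 14 = 1 / 16384 := by unfold wt; norm_num
              rw [this] at h14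
              exact mul_le_mul_of_nonneg_right h14 (wt_nonneg _)
            linarith
      _ ≤ _ := by
          rw [Finset.sum_add_distrib, ← Finset.sum_filter, ← Finset.mul_sum]
          gcongr
          · exact fun u _ _ => wt_nonneg _
          · exact fun u hu => (Finset.mem_filter.1 hu).2
  · rw [Set.indicator_of_notMem (by exact hy), zero_mul, add_zero]
    refine Finset.sum_le_sum fun u hu => ?_
    simp only [unsettledNbrs, Finset.mem_filter, Finset.mem_univ, true_and] at hu
    rcases clipE_eq_or (H := H) (lv := lv) (e := e) y u with h | ⟨L, _, _, _, h4⟩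
    · rw [h]
    · push Not at hy
      obtain ⟨x, hx, hxl⟩ := hy
      simp only [activeNbrs, Finset.mem_filter, Finset.mem_univ, true_and] at hx
      exact absurd (Or.inr ⟨x, hx.1, hxl⟩) (h4 v hu.1.symm)

omit hlv in
lemma noLot_prob (v : P) : (Measure.pi fun _ : P => geo).real
    {y | ∀ x ∈ activeNbrs H lv e v, ¬ Lot lv e y x} ≤
      Real.exp (-∑ x ∈ activeNbrs H lv e v, wt (2 * (lv x).getD 0)) := by
  have : {y | ∀ x ∈ activeNbrs H lv e v, ¬ Lot lv e y x} =
      {y : P → ℕ | ∀ x ∈ activeNbrs H lv e v, y x ∈ {n | 2 * (lv x).getD 0 ≤ n}ᶜ} := by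
    ext y
    refine forall₂_congr fun x hx => not_congr ?_
    simp only [activeNbrs, Finset.mem_filter, Finset.mem_univ, true_and] at hx
    obtain ⟨_, L, hL, hLe⟩ := hx
    simp [Lot, hL, hLe]
  rw [this, pi_real_rectangle]
  simp only [probReal_compl_eq_one_sub (MeasurableSet.of_discrete), geo_ge]
  exact prod_one_sub_le_exp _ _ fun x _ => wt_le_one _

/-- If `Q` tickets are expected among the active neighbours, the load rises by at most `Q / 16384`,
and only with probability at most `exp (-Q)`. As `Q * exp (-Q) ≤ 1`, the expected relative increase
is at most `16 / 16384`. The exponent of `v` never rises here, and the levels need not agree. -/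
lemma integral_pot_clipE_le (v : P) : ∫ y, pot H (clipE H lv e y) v ∂(Measure.pi fun _ : P => geo) ≤
    (1 + driftA / 1000) * pot H e v := by
  have ha := driftA_pos
  have ha' := driftA_le
  by_cases hv : Settled H e v
  · simp [pot, hv, settled_clipE hlv]
  have hl := load_nonneg (H := H) (e := e) v
  set Q := ∑ x ∈ activeNbrs H lv e v, wt (2 * (lv x).getD 0) with hQ
  have hQ0 : 0 ≤ Q := Finset.sum_nonneg fun _ _ => wt_nonneg _
  set N := {y : P → ℕ | ∀ x ∈ activeNbrs H lv e v, ¬ Lot lv e y x} with hN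
  have hpt : ∀ y, pot H (clipE H lv e y) v ≤
      pot H e v * (1 + driftA * (16 * (N.indicator 1 y * (1 / 16384 * Q)))) := by
    intro y
    have hl' := load_nonneg (H := H) (e := clipE H lv e y) v
    simp only [pot, hv, settled_clipE hlv, if_false]
    set X := (load H (clipE H lv e y) v + 1 / 16) / (load H e v + 1 / 16) with hX
    have hX0 : 0 ≤ X := by positivity
    have h1 : load H (clipE H lv e y) v + 1 / 16 = (load H e v + 1 / 16) * X := by
      rw [hX]; field_simp
    have h2 : X ^ driftA ≤ 1 - driftA + driftA * X := by
      have := rpow_one_add_le_one_add_mul_self (s := X - 1) (by linarith) ha.le (by linarith)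
      rw [show 1 + (X - 1) = X by ring] at this
      linarith
    have h3 : X ≤ 1 + 16 * (N.indicator 1 y * (1 / 16384 * Q)) := by
      have h4 : 0 ≤ N.indicator (1 : (P → ℕ) → ℝ) y * (1 / 16384 * Q) :=
        mul_nonneg (Set.indicator_nonneg (fun _ _ => zero_le_one) _) (by positivity)
      rw [hX, div_le_iff₀ (by positivity)]
      have := load_clipE_le (H := H) (e := e) hlv y v
      nlinarith
    rw [h1, Real.mul_rpow (by positivity) hX0]
    calc (load H e v + 1 / 16) ^ driftA * X ^ driftA * (1 + driftA / 20) ^ clipE H lv e y v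
        ≤ (load H e v + 1 / 16) ^ driftA *
          (1 + driftA * (16 * (N.indicator 1 y * (1 / 16384 * Q)))) *
          (1 + driftA / 20) ^ e v := by
          have h5 : X ^ driftA ≤ 1 + driftA * (16 * (N.indicator 1 y * (1 / 16384 * Q))) :=
            h2.trans (by nlinarith)
          have h6 : (0:ℝ) ≤ (load H e v + 1 / 16) ^ driftA := by positivity
          refine mul_le_mul (mul_le_mul_of_nonneg_left h5 h6)
            (pow_le_pow_right₀ (by linarith) (clipE_le y v)) (by positivity) (mul_nonneg h6 ?_)
          exact (Real.rpow_nonneg hX0 _).trans h5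
      _ = _ := by ring
  have int : Integrable (N.indicator (1 : (P → ℕ) → ℝ)) (Measure.pi fun _ : P => geo) :=
    (integrable_const (1:ℝ)).indicator MeasurableSet.of_discrete
  have hQe : Real.exp (-Q) * Q ≤ 1 := by
    rw [Real.exp_neg, inv_mul_le_iff₀ (Real.exp_pos _)]
    linarith [Real.add_one_le_exp Q]
  calc ∫ y, pot H (clipE H lv e y) v ∂(Measure.pi fun _ : P => geo)
      ≤ ∫ y, pot H e v * (1 + driftA * (16 * (N.indicator 1 y * (1 / 16384 * Q))))
        ∂(Measure.pi fun _ : P => geo) :=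
        integral_mono_of_nonneg (ae_of_all _ fun ξ => pot_nonneg v)
          (((integrable_const _).add (((int.mul_const _).const_mul _).const_mul _)).const_mul _)
          (ae_of_all _ hpt)
    _ = pot H e v * (1 + driftA * (16 * ((Measure.pi fun _ : P => geo).real N *
        (1 / 16384 * Q)))) := by
        rw [integral_const_mul, integral_add (integrable_const _)
          (((int.mul_const _).const_mul _).const_mul _), integral_const_mul, integral_const_mul,
          integral_mul_const, integral_indicator_one .of_discrete]
        simp
    _ ≤ pot H e v * (1 + driftA / 1000) := by
        refine mul_le_mul_of_nonneg_left ?_ (pot_nonneg v)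
        have := mul_le_mul_of_nonneg_right (noLot_prob (H := H) (lv := lv) (e := e) v) hQ0
        rw [← hQ, ← hN] at this
        nlinarith
    _ = _ := mul_comm _ _

end

lemma pot_le (v : P) : pot H e v ≤ (Fintype.card P + 1) * (1 + driftA / 20) ^ e v := by
  have ha := driftA_pos
  have ha' := driftA_le
  have hl := load_nonneg (H := H) (e := e) v
  unfold pot
  split_ifs
  · positivity
  · gcongr
    have h1 : load H e v ≤ Fintype.card P := by
      refine (Finset.sum_le_card_nsmul _ _ 1 fun u _ => wt_le_one _).trans ?_
      simp only [nsmul_eq_mul, mul_one]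
      exact_mod_cast Finset.card_le_univ _
    calc (load H e v + 1 / 16) ^ driftA ≤ ((Fintype.card P : ℝ) + 1) ^ driftA :=
          Real.rpow_le_rpow (by positivity) (by linarith) ha.le
      _ ≤ ((Fintype.card P : ℝ) + 1) ^ (1:ℝ) :=
          Real.rpow_le_rpow_of_exponent_le (by linarith [(Nat.cast_nonneg (Fintype.card P) :
            (0:ℝ) ≤ _)]) (by linarith)
      _ = _ := Real.rpow_one _

lemma le_pot {v : P} (hv : ¬ Settled H e v) : 1 / 16 ≤ pot H e v := by
  have ha := driftA_pos
  have ha' := driftA_le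
  have hl := load_nonneg (H := H) (e := e) v
  simp only [pot, hv, if_false]
  have h1 : (1 / 16 : ℝ) ≤ (load H e v + 1 / 16) ^ driftA := by
    calc (1 / 16 : ℝ) = (1 / 16) ^ (1 : ℝ) := (Real.rpow_one _).symm
      _ ≤ (1 / 16) ^ driftA :=
        Real.rpow_le_rpow_of_exponent_ge (by norm_num) (by norm_num) (by linarith)
      _ ≤ _ := Real.rpow_le_rpow (by norm_num) (by linarith) ha.le
  have h2 : 1 ≤ (1 + driftA / 20) ^ e v := one_le_pow₀ (by linarith)
  nlinarith

/-- The potential shrinks by a constant factor per frame. -/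
theorem lintegral_pot_frameE_le {θ : ℝ} (hc : CapSpec cap θ)
    (hlv : ∀ u L, lv u = some L → 14 ≤ L) (v : P)
    (hθ : (Finset.univ.filter fun u => H.Adj v u).card * θ ≤ 1 / 16000) :
    ∫⁻ s, ENNReal.ofReal (pot H (frameE H cap lv e s) v) ∂(Measure.pi fun _ : P => frameLaw) ≤
      ENNReal.ofReal ((1 - driftA / 200) * pot H e v) := by
  have ha := driftA_pos
  have ha' := driftA_le
  have hbd : ∀ (e' : P → ℕ) (k : ℕ), e' v ≤ k →
      |pot H e' v| ≤ (Fintype.card P + 1) * (1 + driftA / 20) ^ k := fun e' k h => by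
    rw [abs_of_nonneg (pot_nonneg v)]
    refine (pot_le v).trans ?_
    gcongr
    linarith
  -- Lottery tickets are independent of contention seeds, so the expectation can be taken over the
  -- contention first, for fixed cut exponents.
  have hmp := measurePreserving_arrowProdEquivProdArrow ℕ (ℕ × ℕ) P
    (fun _ => geo) (fun _ => geoTwo)
  have h1 : ∫⁻ s, ENNReal.ofReal (pot H (frameE H cap lv e s) v)
      ∂(Measure.pi fun _ : P => frameLaw) =
      ∫⁻ z, ENNReal.ofReal (pot H (nextE H cap (clipE H lv e z.1) z.2) v)
        ∂((Measure.pi fun _ : P => geo).prod (seedPi P)) := by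
    rw [← hmp.lintegral_comp_emb (MeasurableEquiv.measurableEmbedding _)]
    rfl
  rw [h1, lintegral_prod _ Measurable.of_discrete.aemeasurable]
  calc ∫⁻ y, ∫⁻ ξ, ENNReal.ofReal (pot H (nextE H cap (clipE H lv e y) ξ) v) ∂(seedPi P)
        ∂(Measure.pi fun _ : P => geo)
      ≤ ∫⁻ y, ENNReal.ofReal ((1 - driftA / 100) * pot H (clipE H lv e y) v)
        ∂(Measure.pi fun _ : P => geo) := by
        refine lintegral_mono fun y => ?_
        rw [← ofReal_integral_eq_lintegral_ofReal (integrable_of_bdd _ fun ξ =>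
          hbd (nextE H cap (clipE H lv e y) ξ) _ (nextE_le hc v ξ)) (ae_of_all _ fun ξ => pot_nonneg v)]
        exact ENNReal.ofReal_le_ofReal (integral_pot_nextE_le hc v hθ)
    _ = ENNReal.ofReal (∫ y, (1 - driftA / 100) * pot H (clipE H lv e y) v
        ∂(Measure.pi fun _ : P => geo)) := by
        rw [ofReal_integral_eq_lintegral_ofReal]
        · exact (integrable_of_bdd _ fun y => hbd (clipE H lv e y) _ (clipE_le y v)).const_mul _
        · exact ae_of_all _ fun y => mul_nonneg (by linarith) (pot_nonneg v)
    _ ≤ _ := by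
        refine ENNReal.ofReal_le_ofReal ?_
        rw [integral_const_mul]
        have h2 := integral_pot_clipE_le (H := H) (e := e) hlv v
        have h3 := pot_nonneg (H := H) (e := e) v
        calc _ ≤ (1 - driftA / 100) * ((1 + driftA / 1000) * pot H e v) :=
              mul_le_mul_of_nonneg_left h2 (by linarith)
          _ = ((1 - driftA / 100) * (1 + driftA / 1000)) * pot H e v := by ring
          _ ≤ _ := mul_le_mul_of_nonneg_right (by nlinarith) h3

/-- In a frame in which all large exponents may be cut, they are cut unless somebody draws an
unlikely ticket. -/
theorem frameE_large_prob {θ : ℝ} (hc : CapSpec cap θ) {R Λ : ℕ}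
    (h : (∀ u, e u ≤ R) ∨ ((∀ u L, lv u = some L → Λ ≤ L) ∧
      ∀ u, e u ≤ R ∨ ∃ L, lv u = some L ∧ 3 * L ≤ R)) :
    (Measure.pi fun _ : P => frameLaw) {s | ∃ u, R + 1 < frameE H cap lv e s u} ≤
      ENNReal.ofReal (Fintype.card P * wt (2 * Λ)) := by
  have hlot : {s | ∃ u, R + 1 < frameE H cap lv e s u} ⊆
      ⋃ u ∈ (Finset.univ : Finset P), {s : P → FrameSeed | s u ∈ {n | 2 * Λ ≤ n} ×ˢ Set.univ} := by
    rintro s ⟨u, hu⟩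
    -- Contention adds at most one to an exponent, hence the bound `R + 1`.
    have hu' := nextE_le (H := H) (e := clipE H lv e fun u => (s u).1) hc u fun u => (s u).2
    have hu2 : R < clipE H lv e (fun u => (s u).1) u := by unfold frameE at hu; omega
    have hu3 := hu2.trans_le (clipE_le _ _)
    rcases h with h | ⟨h1, h2⟩
    · exact absurd (h u) (by omega)
    obtain ⟨L, hL, hLR⟩ := (h2 u).resolve_left (by omega)
    have : ∃ x, Lot lv e (fun u => (s u).1) x := by
      by_contra hno
      push Not at hno
      have : clipE H lv e (fun u => (s u).1) u = 3 * L := by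
        unfold clipE
        rw [hL]
        dsimp only
        rw [if_pos ⟨by omega, by simp [Compl, hno], by simp [Compl, hno]⟩]
      omega
    obtain ⟨x, L', hL', _, h4⟩ := this
    have := h1 x L' hL'
    simp only [Set.mem_iUnion]
    dsimp only at h4
    exact ⟨x, Finset.mem_univ _, by simp; omega⟩
  refine (measure_mono hlot).trans ?_
  rw [← ofReal_measureReal (measure_ne_top _ _)]
  refine ENNReal.ofReal_le_ofReal ((measureReal_biUnion_finset_le _ _).trans ?_)
  simp only [pi_real_eval, measureReal_prod_prod, geo_ge]
  simp

end Lottery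

/-! ### Iterating the drift over many frames. -/

section Chain

open scoped Classical

variable {P : Type} [Fintype P] {S : Type}

/-- The expectation of `g` after one step from `s`. -/
noncomputable def stepOp (step : S → (P → FrameSeed) → S) (g : S → ENNReal) (s : S) : ENNReal :=
  ∫⁻ ξ, g (step s ξ) ∂(Measure.pi fun _ : P => frameLaw)

variable {H : SimpleGraph P} {cap : ℕ → ℕ} {θ : ℝ} (hc : CapSpec cap θ)
  (hθ : ∀ v, (Finset.univ.filter fun u => H.Adj v u).card * θ ≤ 1 / 16000)
  {step : S → (P → FrameSeed) → S} {lv : S → P → Option ℕ} {e : S → P → ℕ}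
  (hstep : ∀ s ξ, e (step s ξ) = frameE H cap (lv s) (e s) ξ)
  (hlv : ∀ s u L, lv s u = some L → 14 ≤ L)

lemma stepOp_mono {g g' : S → ENNReal} (h : ∀ s, g s ≤ g' s) (s : S) :
    stepOp step g s ≤ stepOp step g' s := lintegral_mono fun _ => h _

lemma stepOp_iterate_le_one {g : S → ENNReal} (h : ∀ s, g s ≤ 1) (F : ℕ) (s : S) :
    (stepOp step)^[F] g s ≤ 1 := by
  induction F generalizing s with
  | zero => exact h s
  | succ F ih =>
    rw [Function.iterate_succ_apply']
    refine (stepOp_mono ih s).trans ?_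
    simp [stepOp]

include hc hθ hstep hlv in
/-- The probability that `v` is not settled after `F` frames. -/
theorem stepOp_iterate_unsettled_le (v : P) (F : ℕ) (s : S) :
    (stepOp step)^[F] (fun s => if Settled H (e s) v then 0 else 1) s ≤
      ENNReal.ofReal (16 * (1 - driftA / 200) ^ F * pot H (e s) v) := by
  have ha := driftA_pos
  have ha' := driftA_le
  induction F generalizing s with
  | zero =>
    simp only [Function.iterate_zero, id_eq, pow_zero, mul_one]
    split_ifs with h
    · exact zero_le
    -- The factor `16` is the inverse of the least potential `1/16` of an unsettled node.
    · rw [ENNReal.one_le_ofReal]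
      linarith [le_pot h]
  | succ F ih =>
    rw [Function.iterate_succ_apply']
    have h0 : 0 ≤ 16 * (1 - driftA / 200) ^ F := by
      have : 0 ≤ 1 - driftA / 200 := by linarith
      positivity
    calc _ ≤ ∫⁻ ξ, ENNReal.ofReal (16 * (1 - driftA / 200) ^ F * pot H (e (step s ξ)) v)
          ∂(Measure.pi fun _ : P => frameLaw) := stepOp_mono ih s
      _ = ENNReal.ofReal (16 * (1 - driftA / 200) ^ F) *
          ∫⁻ ξ, ENNReal.ofReal (pot H (frameE H cap (lv s) (e s) ξ) v)
          ∂(Measure.pi fun _ : P => frameLaw) := by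
          rw [← lintegral_const_mul _ Measurable.of_discrete]
          refine lintegral_congr fun ξ => ?_
          rw [ENNReal.ofReal_mul h0, hstep]
      _ ≤ ENNReal.ofReal (16 * (1 - driftA / 200) ^ F) *
          ENNReal.ofReal ((1 - driftA / 200) * pot H (e s) v) :=
          mul_le_mul_right (lintegral_pot_frameE_le hc (hlv s) v (hθ v)) _
      _ = _ := by rw [← ENNReal.ofReal_mul h0]; congr 1; ring

end Chain

/-! ### The algorithm

Time is divided into frames of 18 rounds. In round `0` of a frame every running process beeps, in
round `2 i + 1` it beeps if it has something to say on topic `i`, in all other rounds it is silent.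
Since everybody beeps in the rounds `0` and `1` and nowhere else two beeps in a row occur, a
listening process can recognize the beginning of a frame. -/

/-- A device by which the processes agree on the number of the current frame. -/
structure Clock where
  St : Type
  countable_St : Countable St
  fresh : St
  root : St
  out : St → ℕ → Bool
  next : St → Bool → Bool → St
  lev : St → Option ℕ

/-- The part of the state of a running process that is kept from frame to frame. -/
structure Core (K : Type) where
  e : ℕ
  dom : Bool
  clk : K

/-- The states of a process. -/
inductive Proc (K : Type) where
  | listen (n : ℕ) (b : Bool)
  | wait (p : ℕ)
  | run (p : ℕ) (c : Core K) (x : FrameSeed) (h : Finset ℕ)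

instance (K : Type) [Countable K] : Countable (Core K) :=
  Function.Injective.countable (f := fun c : Core K => (c.e, c.dom, c.clk)) fun c c' h => by
    cases c; cases c'; simp_all

instance (K : Type) [Countable K] : Countable (Proc K) :=
  Function.Injective.countable
    (f := fun s : Proc K => match s with
      | .listen n b => (Sum.inl (n, b) : (ℕ × Bool) ⊕ (ℕ ⊕ (ℕ × Core K × FrameSeed × Finset ℕ)))
      | .wait p => Sum.inr (Sum.inl p)
      | .run p c x h => Sum.inr (Sum.inr (p, c, x, h)))
    fun s s' h => by cases s <;> cases s' <;> simp_all

namespace Clock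

open scoped Classical

variable (C : Clock) (cap : ℕ → ℕ)

instance : Countable C.St := C.countable_St

/-- Drawing a winning ticket. -/
def lot (c : Core C.St) (x : FrameSeed) : Prop :=
  ∃ L, C.lev c.clk = some L ∧ 3 * L < c.e ∧ 2 * L ≤ x.1

/-- The exponent after it has possibly been cut; `h` is the set of topics heard about. -/
noncomputable def eff (c : Core C.St) (x : FrameSeed) (h : Finset ℕ) : ℕ :=
  match C.lev c.clk with
  | some L => if 3 * L < c.e ∧ ¬ (C.lot c x ∨ 3 ∈ h) ∧ 4 ∉ h then 3 * L else c.e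
  | none => c.e

/-- The decision to contend. -/
def cont (c : Core C.St) (x : FrameSeed) (h : Finset ℕ) : Prop := 5 ∉ h ∧ C.eff c x h ≤ x.2.1

/-- What a running process has to say on each topic. -/
def sends (c : Core C.St) (x : FrameSeed) (h : Finset ℕ) : ℕ → Prop
  | 0 => True
  | 1 => C.out c.clk 1 = true
  | 2 => C.out c.clk 2 = true
  | 3 => C.lot c x
  | 4 => C.lot c x ∨ 3 ∈ h
  | 5 => c.e = 0
  | 6 => C.cont c x h ∧ 3 ≤ x.2.2
  | 7 => C.cont c x h
  | _ => False

/-- The update at the end of a frame. -/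
noncomputable def upd (c : Core C.St) (x : FrameSeed) (h : Finset ℕ) : Core C.St where
  e := if C.cont c x h then (if 6 ∈ h then cap (C.eff c x h + 1) else 0)
    else if 5 ∈ h ∨ 7 ∈ h then cap (C.eff c x h + 1) else max (C.eff c x h - 1) 1
  dom := decide (5 ∈ h)
  clk := C.next c.clk (C.out c.clk 1 || decide (1 ∈ h)) (C.out c.clk 2 || decide (2 ∈ h))

/-- Whether a process beeps. -/
def beepsIn : Proc C.St → Prop
  | .run p c x h => p = 0 ∨ p % 2 = 1 ∧ C.sends c x h (p / 2)
  | _ => False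

/-- The state after a round; `f` tells whether a beep has been heard. -/
noncomputable def trans (s : Proc C.St) (seed : FrameSeed) (f : Prop) : Proc C.St :=
  match s with
  | .listen n b =>
    -- Two consecutive beeps identify rounds `0` and `1` of a frame, so round `2` comes next.
    if f then (if b then .wait 2 else .listen (n + 1) true)
    -- Such long silence is met only by processes woken in round `0`. They found the frame structure
    -- and start together in frame `3 = 54 / 18`.
    else if n + 1 = 54 then .run 0 ⟨1, true, C.root⟩ 0 ∅ else .listen (n + 1) false
  -- The flag `true` lets a newcomer appear inactive during its first frame, so joining does not
  -- disturb a stable neighbour.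
  | .wait p => if p = 17 then .run 0 ⟨1, true, C.fresh⟩ 0 ∅ else .wait (p + 1)
  | .run p c x h =>
    if p = 17 then .run 0 (C.upd cap c x h) 0 ∅
    else .run (p + 1) c (if p = 0 then seed else x)
      (if f ∧ p % 2 = 1 then insert (p / 2) h else h)

/-- The status shown by a process. -/
noncomputable def statusOf : Proc C.St → Status
  | .run _ c _ h => if c.e = 0 then (if 6 ∈ h then .competing else .mis)
    else if c.dom then .inactive else .competing
  | _ => .inactive

/-- The algorithm with a given clock and a given limit for the exponents. -/
noncomputable def alg : Algorithm where
  State := Proc C.St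
  countable_state := inferInstance
  Seed := FrameSeed
  law := frameLaw
  init := .listen 0 false
  beeps s _ := decide (C.beepsIn s)
  next s x f := C.trans cap s x (f = Feedback.beep)
  status := C.statusOf
  measurable_beeps _ := MeasurableSet.const _
  measurable_next _ _ _ := MeasurableSet.of_discrete

/-- The correctness of a clock: `ok f f₀ c` says that `c` is admissible in frame `f` for a process
that began in frame `f₀`; such a process knows the clock `delay f₀` frames later. -/
structure Spec where
  tru : ℕ → C.St
  ok : ℕ → ℕ → C.St → Prop
  delay : ℕ → ℕ
  root_eq : C.root = tru 3
  next_tru : ∀ f, C.next (tru f) (C.out (tru f) 1) (C.out (tru f) 2) = tru (f + 1)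
  ok_fresh : ∀ f, ok f f C.fresh
  ok_next : ∀ f f₀ c, ok f f₀ c → ok (f + 1) f₀ (C.next c (C.out (tru f) 1) (C.out (tru f) 2))
  out_le : ∀ f f₀ c i, ok f f₀ c → C.out c i = true → C.out (tru f) i = true
  known : ∀ f f₀ c, ok f f₀ c → f₀ + delay f₀ ≤ f → c = tru f

end Clock

/-- The frame in which a process woken up in round `w` starts running. -/
def startFrame (w : ℕ) : ℕ := if w = 0 then 3 else (w + 17) / 18 + 1

lemma startFrame_zero : startFrame 0 = 3 := rfl

lemma startFrame_pos {w : ℕ} (h : 0 < w) : w + 18 ≤ 18 * startFrame w ∧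
    18 * startFrame w < w + 36 := by
  unfold startFrame
  rw [if_neg (by omega)]
  omega

lemma startFrame_le (w : ℕ) : w + 18 ≤ 18 * startFrame w ∧ 18 * startFrame w ≤ w + 54 := by
  rcases Nat.eq_zero_or_pos w with rfl | h
  · rw [startFrame_zero]; omega
  · have := startFrame_pos h; omega

namespace Execution

variable {V : Type} {E : Execution V}

lemma Participates.wake {v : V} {r : ℕ} (h : E.Participates v r) :
    ∃ w : ℕ, E.wake v = w ∧ w ≤ r := by
  have h1 : E.wake v ≠ ⊤ := ne_top_of_le_ne_top (ENat.natCast_ne_top r) h.1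
  obtain ⟨w, hw⟩ := ENat.ne_top_iff_exists.1 h1
  refine ⟨w, hw.symm, ?_⟩
  have := h.1
  rw [← hw] at this
  exact_mod_cast this

lemma Participates.of_le {v : V} {r s w : ℕ} (h : E.Participates v r) (hw : E.wake v = w)
    (h1 : w ≤ s) (h2 : s ≤ r) : E.Participates v s :=
  ⟨by rw [hw]; exact_mod_cast h1, lt_of_le_of_lt (by exact_mod_cast h2) h.2⟩

end Execution

/-! ### Synchronization with the frames and learning of the clock. -/

section Dynamics

open scoped Classical

variable {V : Type} {G : SimpleGraph V} {E : Execution V} {C : Clock} {cap : ℕ → ℕ}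

lemma alg_beeps_iff (ω : (C.alg cap).Seeds V) (r : ℕ) (σ : V → Proc C.St) (v : V) :
    (C.alg cap).Beeps E ω r σ v ↔ E.Participates v r ∧ C.beepsIn (σ v) := by
  simp [Algorithm.Beeps, Clock.alg]

lemma feedback_eq_beep_iff {A : Algorithm} (ω : A.Seeds V) (r : ℕ) (σ : V → A.State) (v : V) :
    A.feedback G E ω r σ v = Feedback.beep ↔
      ¬ A.Beeps E ω r σ v ∧ ∃ u, G.Adj v u ∧ A.Beeps E ω r σ u := by
  unfold Algorithm.feedback
  split_ifs <;> simp_all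

variable (G E C cap) in
/-- Node `v` hears a beep in round `r`. -/
def Hears (ω : (C.alg cap).Seeds V) (r : ℕ) (v : V) : Prop :=
  ¬ C.beepsIn ((C.alg cap).state G E ω r v) ∧ ∃ u, G.Adj v u ∧ E.Participates u r ∧
    C.beepsIn ((C.alg cap).state G E ω r u)

lemma state_succ (ω : (C.alg cap).Seeds V) {r : ℕ} {v : V} (h : E.Participates v r) :
    (C.alg cap).state G E ω (r + 1) v =
      C.trans cap ((C.alg cap).state G E ω r v) (ω (v, r)) (Hears G E C cap ω r v) := by
  have h1 : ((C.alg cap).feedback G E ω r ((C.alg cap).state G E ω r) v = Feedback.beep) =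
      Hears G E C cap ω r v := by
    have hb : ∀ u, (C.alg cap).Beeps E ω r ((C.alg cap).state G E ω r) u ↔
        E.Participates u r ∧ C.beepsIn ((C.alg cap).state G E ω r u) :=
      fun u => alg_beeps_iff ω r _ u
    rw [feedback_eq_beep_iff]
    simp only [hb, Hears, h, true_and]
  rw [← h1]
  exact if_pos h

lemma state_succ_of_not (ω : (C.alg cap).Seeds V) {r : ℕ} {v : V} (h : ¬ E.Participates v r) :
    (C.alg cap).state G E ω (r + 1) v = (C.alg cap).state G E ω r v := if_neg h

lemma state_before_wake (ω : (C.alg cap).Seeds V) {r w : ℕ} {v : V} (hw : E.wake v = w)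
    (h : r ≤ w) : (C.alg cap).state G E ω r v = Proc.listen 0 false := by
  induction r with
  | zero => rfl
  | succ r ih =>
    rw [state_succ_of_not, ih (by omega)]
    intro h'
    have := h'.1
    rw [hw] at this
    have : w ≤ r := by exact_mod_cast this
    omega

lemma mem_hear {f : Prop} {p i : ℕ} {h : Finset ℕ} :
    i ∈ (if f ∧ p % 2 = 1 then insert (p / 2) h else h) ↔
      i ∈ h ∨ f ∧ p % 2 = 1 ∧ i = p / 2 := by
  split_ifs with h1
  · simp [h1, or_comm]
  · rw [← and_assoc]
    simp [h1]

variable (S : C.Spec)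

/-- What is known about a running process in round `r` that has been woken up in round `w`. -/
structure RunInv (cap : ℕ → ℕ) (r w : ℕ) (c : Core C.St) (h : Finset ℕ) : Prop where
  start : 18 * startFrame w ≤ r
  clk : w = 0 ∧ c.clk = S.tru (r / 18) ∨ w ≠ 0 ∧ S.ok (r / 18) (startFrame w) c.clk
  heard : ∀ i, i = 1 ∨ i = 2 → i ∈ h → C.out (S.tru (r / 18)) i = true
  bits : ∀ i, i = 1 ∨ i = 2 → 2 * i + 1 < r % 18 →
    (C.out c.clk i = true ∨ i ∈ h ↔ C.out (S.tru (r / 18)) i = true)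
  e_le : c.e + startFrame w ≤ 1 + r / 18
  e_cap : ∀ κ, 1 ≤ κ → (∀ k, cap k ≤ κ) → c.e ≤ κ
  zero : c.e = 0 → 5 ∉ h
  fresh : r % 18 = 0 → h = ∅

/-- The possible states in round `r` of a process woken up in round `w`. -/
inductive Phase (cap : ℕ → ℕ) (r w : ℕ) : Proc C.St → Prop
  | early : w = 0 → r < 54 → Phase cap r w (.listen r false)
  -- A beep just heard came from an odd round other than `17`; the present round is then silent and
  -- cannot be mistaken for the second beep of a frame start.
  | listen (b : Bool) : 0 < w → r + 18 ≤ 18 * startFrame w → (b = true → r % 2 = 0 ∧ r % 18 ≠ 0) →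
      Phase cap r w (.listen (r - w) b)
  | sync : 0 < w → r + 17 = 18 * startFrame w → Phase cap r w (.listen (r - w) true)
  | wait : 0 < w → 18 * startFrame w ≤ r + 16 → r < 18 * startFrame w →
      Phase cap r w (.wait (r + 18 - 18 * startFrame w))
  | run (c : Core C.St) (x : FrameSeed) (h : Finset ℕ) : RunInv S cap r w c h →
      Phase cap r w (.run (r % 18) c x h)

variable (G E cap) in
/-- All participating processes are in one of the possible states. -/
def PhaseInv (ω : (C.alg cap).Seeds V) (r : ℕ) : Prop :=
  ∀ v w, E.wake v = (w : ℕ) → E.Participates v r →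
    Phase S cap r w ((C.alg cap).state G E ω r v)

/-- The ages that suffice for a given clock. -/
structure AgeSpec (δ : ℕ → ℕ) : Prop where
  mono : Monotone δ
  ge : ∀ s k, 18 * k ≤ s + 54 → 72 + 18 * S.delay k ≤ δ s

variable {S} {δ : ℕ → ℕ}

lemma Phase.beepsIn {r w : ℕ} {s : Proc C.St} (h : Phase S cap r w s) (hb : C.beepsIn s) :
    ∃ c x h, s = .run (r % 18) c x h ∧ RunInv S cap r w c h ∧
      (r % 18 = 0 ∨ r % 2 = 1 ∧ C.sends c x h (r % 18 / 2)) := by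
  cases h with
  | early => exact hb.elim
  | listen => exact hb.elim
  | sync => exact hb.elim
  | wait => exact hb.elim
  | run c x h hr =>
    refine ⟨c, x, h, rfl, hr, ?_⟩
    simp only [Clock.beepsIn] at hb
    exact hb.imp id fun h => ⟨by omega, h.2⟩

lemma Phase.isRun {r w : ℕ} {s : Proc C.St} (h : Phase S cap r w s)
    (hr : 18 * startFrame w ≤ r) :
    ∃ c x h, s = .run (r % 18) c x h ∧ RunInv S cap r w c h := by
  have := startFrame_zero
  cases h with
  | early h1 => subst h1; omega
  | listen => omega
  | sync => omega
  | wait => omega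
  | run c x h hr => exact ⟨c, x, h, rfl, hr⟩

variable (hE : SimpleWakeUp G E δ) (hδ : AgeSpec S δ)
include hE hδ

/-- A process that is not old has a neighbour that knows the clock. -/
lemma exists_helper {ω : (C.alg cap).Seeds V} {r w : ℕ} (ih : PhaseInv G E cap S ω r) {v : V}
    (hw : E.wake v = w) (h0 : 0 < w) (hv : E.Participates v r) (hr : r < w + δ w) :
    ∃ u c x h, G.Adj v u ∧ E.Participates u r ∧
      (C.alg cap).state G E ω r u = .run (r % 18) c x h ∧ c.clk = S.tru (r / 18) := by
  have hwr : w ≤ r := by have := hv.1; rw [hw] at this; exact_mod_cast this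
  obtain ⟨u, huv, hu, hold⟩ := hE.wakeUp v w h0 hw
  obtain ⟨w', hw', hww⟩ := hu.wake
  have hold' : w' + δ w ≤ w := by
    unfold Execution.Old at hold
    rw [hw'] at hold
    exact_mod_cast hold
  -- The helper cannot crash meanwhile, since that would require its neighbour `v` to be old.
  have hpart : ∀ s, w ≤ s → s ≤ r → E.Participates u s := by
    intro s h1
    induction s, h1 using Nat.le_induction with
    | base => exact fun _ => hu
    | succ s hs ihs =>
      intro hsr
      by_contra hcon
      have h2 := hE.crash u s (ihs (by omega)) hcon v huv.symm (hv.of_le hw hs (by omega))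
      unfold Execution.Old at h2
      rw [hw] at h2
      have h3 : w + δ (s + 1) ≤ s + 1 := by exact_mod_cast h2
      have := hδ.mono (show w ≤ s + 1 by omega)
      omega
  have hur := hpart r hwr le_rfl
  have hsf := startFrame_le w'
  have h4 := hδ.ge w (startFrame w') (by omega)
  obtain ⟨c, x, h, hs, hri⟩ := (ih u w' hw' hur).isRun (by omega)
  refine ⟨u, c, x, h, huv, hur, hs, ?_⟩
  rcases hri.clk with ⟨_, h⟩ | ⟨_, h⟩
  · exact h
  · exact S.known _ _ _ h (by omega)

omit hE hδ in
lemma upd_e_le {κ : ℕ} (c : Core C.St) (x : FrameSeed) (h : Finset ℕ) (h1 : 1 ≤ κ)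
    (hκ : ∀ k, k ≤ c.e + 1 → cap k ≤ κ) (he : c.e ≤ κ) : (C.upd cap c x h).e ≤ κ := by
  have heff : C.eff c x h ≤ c.e := by
    unfold Clock.eff
    split
    · split_ifs with h
      · exact h.1.le
      · exact le_rfl
    · exact le_rfl
  have := hκ (C.eff c x h + 1) (by omega)
  simp only [Clock.upd]
  split_ifs <;> omega

/-- All processes are always in one of the possible states. -/
theorem phaseInv (hcap : ∀ k, cap k ≤ k) (ω : (C.alg cap).Seeds V) (r : ℕ) :
    PhaseInv G E cap S ω r := by
  induction r with
  | zero =>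
    intro v w hw hv
    have : w = 0 := by have := hv.1; rw [hw] at this; exact_mod_cast Nat.le_zero.1 (by exact_mod_cast this)
    exact .early this (by omega)
  | succ r ih =>
    intro v w hw hv
    have hwr : w ≤ r + 1 := by have := hv.1; rw [hw] at this; exact_mod_cast this
    have hδ0 : ∀ s, 72 ≤ δ s := fun s => by have := hδ.ge s 0 (by omega); omega
    rcases Nat.lt_or_ge r w with hlt | hge
    · rw [state_before_wake ω hw (by omega)]
      have := startFrame_pos (w := w) (by omega)
      have h := Phase.listen (S := S) (cap := cap) (r := r + 1) (w := w) false (by omega)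
        (by omega) (by simp)
      rwa [show r + 1 - w = 0 by omega] at h
    have hvr := hv.of_le hw hge (Nat.le_succ r)
    rw [state_succ ω hvr]
    have hphase := ih v w hw hvr
    -- There is no topic `8`, so round `17` is silent; a beep there, followed by the one in round
    -- `0`, would imitate a frame start.
    have hbeep : Hears G E C cap ω r v → r % 18 = 0 ∨ r % 2 = 1 ∧ r % 18 ≠ 17 := by
      rintro ⟨_, u, _, hu, hb⟩
      obtain ⟨w', hw', _⟩ := hu.wake
      obtain ⟨c, x, h, _, _, h3⟩ := (ih u w' hw' hu).beepsIn hb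
      refine h3.imp id fun h => ⟨h.1, fun h17 => ?_⟩
      have := h.2
      rw [h17] at this
      simp [Clock.sends] at this
    have hsync : 0 < w → r < 18 * startFrame w → r % 18 ≤ 1 → Hears G E C cap ω r v := by
      intro h0 h1 h2
      have := startFrame_pos h0
      have := hδ0 w
      obtain ⟨u, c, x, h, h3, h4, h5, _⟩ := exists_helper hE hδ ih hw h0 hvr (by omega)
      refine ⟨?_, u, h3, h4, ?_⟩
      · intro hb
        obtain ⟨c, x, h, _, h6, _⟩ := hphase.beepsIn hb
        have := h6.start
        omega
      · rw [h5]
        simp only [Clock.beepsIn]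
        rcases (show r % 18 = 0 ∨ r % 18 = 1 by omega) with h | h <;> simp [h, Clock.sends]
    generalize hst : (C.alg cap).state G E ω r v = s at hphase
    cases hphase with
    | early h1 h2 =>
      subst h1
      -- Before round 54 nobody runs: the processes woken in round `0` still listen, and any other
      -- needs a neighbour of age at least 72 when it wakes up.
      have hno : ¬ Hears G E C cap ω r v := by
        rintro ⟨_, u, _, hu, hb⟩
        obtain ⟨w', hw', _⟩ := hu.wake
        obtain ⟨c, x, h, _, h3, _⟩ := (ih u w' hw' hu).beepsIn hb
        have := h3.start
        have := startFrame_le w'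
        rcases Nat.eq_zero_or_pos w' with rfl | h0
        · rw [startFrame_zero] at *; omega
        obtain ⟨y, _, hy, hold⟩ := hE.wakeUp u w' h0 hw'
        obtain ⟨w2, hw2, _⟩ := hy.wake
        unfold Execution.Old at hold
        rw [hw2] at hold
        have : w2 + δ w' ≤ w' := by exact_mod_cast hold
        have := hδ0 w'
        omega
      simp only [Clock.trans, hno, if_false]
      split_ifs with h3
      · rw [h3, show (0:ℕ) = 54 % 18 from rfl]
        refine .run _ _ _ ⟨by rw [startFrame_zero], Or.inl ⟨rfl, S.root_eq⟩, by simp,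
          ?_, ?_, ?_, ?_, fun _ => rfl⟩
        · intro i _ h; omega
        · change 1 + 3 ≤ 1 + 54 / 18; omega
        · intro κ h _; exact h
        · simp
      · exact .early rfl (by omega)
    | listen b h1 h2 h3 =>
      have hsf := startFrame_pos h1
      by_cases hh : Hears G E C cap ω r v
      · have h4 := hbeep hh
        have hb : b = false := by
          by_contra hb
          have := h3 (by simpa using hb)
          omega
        subst hb
        simp only [Clock.trans, hh, if_true]
        rw [show r - w + 1 = r + 1 - w by omega]
        rcases (show r + 18 = 18 * startFrame w ∨ r + 19 ≤ 18 * startFrame w by omega) with h | h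
        · exact .sync h1 (by omega)
        · exact .listen _ h1 (by omega) fun _ => by omega
      · have h4 : r + 18 ≠ 18 * startFrame w := fun h => hh (hsync h1 (by omega) (by omega))
        simp only [Clock.trans, hh, if_false]
        rw [if_neg (by omega), show r - w + 1 = r + 1 - w by omega]
        exact .listen _ h1 (by omega) (by simp)
    | sync h1 h2 =>
      have hh := hsync h1 (by omega) (by omega)
      simp only [Clock.trans, hh, if_true]
      have h := Phase.wait (S := S) (cap := cap) (r := r + 1) (w := w) h1 (by omega) (by omega)
      rwa [show r + 1 + 18 - 18 * startFrame w = 2 by omega] at h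
    | wait h1 h2 h3 =>
      simp only [Clock.trans]
      split_ifs with h4
      · have h5 : r + 1 = 18 * startFrame w := by omega
        have h6 := Phase.run (S := S) (cap := cap) (r := r + 1) (w := w)
          ⟨1, true, C.fresh⟩ 0 ∅ ⟨by omega, Or.inr ⟨by omega, ?_⟩, by simp,
            ?_, ?_, ?_, ?_, fun _ => rfl⟩
        · rwa [show (r + 1) % 18 = 0 by omega] at h6
        · rw [show (r + 1) / 18 = startFrame w by omega]
          exact S.ok_fresh _
        · intro i _ h; omega
        · change 1 + _ ≤ _; omega
        · intro κ h _; exact h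
        · simp
      · rw [show r + 18 - 18 * startFrame w + 1 = r + 1 + 18 - 18 * startFrame w by omega]
        exact .wait h1 (by omega) (by omega)
    | run c x h hr =>
      simp only [Clock.trans]
      have hstart := hr.start
      -- No process sends a false bit, by `out_le`. A process that may not know the clock is still
      -- young, so a neighbour that knows it supplies the bits the process does not send itself.
      have hbits : ∀ i, i = 1 ∨ i = 2 → r % 18 = 2 * i + 1 →
          (C.out c.clk i = true ∨ Hears G E C cap ω r v ↔ C.out (S.tru (r / 18)) i = true) := by
        intro i hi hri
        have hsends : ∀ (c : Core C.St) x h, C.sends c x h i ↔ C.out c.clk i = true := by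
          intro c x h
          rcases hi with rfl | rfl <;> rfl
        have hout : ∀ {w c h}, RunInv S cap r w c h → C.out c.clk i = true →
            C.out (S.tru (r / 18)) i = true := by
          intro w c h hri ho
          rcases hri.clk with ⟨_, h1⟩ | ⟨_, h1⟩
          · rwa [← h1]
          · exact S.out_le _ _ _ _ h1 ho
        constructor
        · rintro (h1 | ⟨_, u, _, hu, hb⟩)
          · exact hout hr h1
          · obtain ⟨w', hw', _⟩ := hu.wake
            obtain ⟨c', x', h', _, h2, h3⟩ := (ih u w' hw' hu).beepsIn hb
            refine hout h2 ((hsends _ x' h').1 ?_)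
            have := (h3.resolve_left (by omega)).2
            rwa [show r % 18 / 2 = i by omega] at this
        · intro htru
          by_cases hown : C.out c.clk i = true
          · exact Or.inl hown
          right
          rcases hr.clk with ⟨_, h1⟩ | ⟨h0, h1⟩
          · rw [h1] at hown; exact absurd htru hown
          have hnk : ¬ startFrame w + S.delay (startFrame w) ≤ r / 18 := fun hk => by
            rw [S.known _ _ _ h1 hk] at hown; exact hown htru
          have hsf := startFrame_pos (Nat.pos_of_ne_zero h0)
          have := hδ.ge w (startFrame w) (by omega)
          obtain ⟨u, c', x', h', h3, h4, h5, h6⟩ :=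
            exists_helper hE hδ ih hw (Nat.pos_of_ne_zero h0) hvr (by omega)
          refine ⟨?_, u, h3, h4, ?_⟩
          · rw [hst]
            simp only [Clock.beepsIn, show r % 18 / 2 = i by omega, hsends]
            rintro (h | h)
            · omega
            · exact hown h.2
          · rw [h5]
            simp only [Clock.beepsIn, show r % 18 / 2 = i by omega, hsends]
            exact Or.inr ⟨by omega, by rw [h6]; exact htru⟩
      by_cases h17 : r % 18 = 17
      · rw [if_pos h17]
        have hdiv : (r + 1) / 18 = r / 18 + 1 := by omega
        have b1 : (C.out c.clk 1 || decide (1 ∈ h)) = C.out (S.tru (r / 18)) 1 := by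
          rw [Bool.eq_iff_iff]
          simpa using hr.bits 1 (Or.inl rfl) (by omega)
        have b2 : (C.out c.clk 2 || decide (2 ∈ h)) = C.out (S.tru (r / 18)) 2 := by
          rw [Bool.eq_iff_iff]
          simpa using hr.bits 2 (Or.inr rfl) (by omega)
        have h6 := Phase.run (S := S) (cap := cap) (r := r + 1) (w := w)
          (C.upd cap c x h) 0 ∅ ⟨by omega, ?_, by simp, ?_, ?_, ?_, by simp, fun _ => rfl⟩
        · rwa [show (r + 1) % 18 = 0 by omega] at h6
        · simp only [Clock.upd, b1, b2, hdiv]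
          rcases hr.clk with ⟨h0, h1⟩ | ⟨h0, h1⟩
          · exact Or.inl ⟨h0, by rw [h1]; exact S.next_tru _⟩
          · exact Or.inr ⟨h0, S.ok_next _ _ _ h1⟩
        · intro i _ h; omega
        · have := hr.e_le
          have := upd_e_le (cap := cap) (κ := c.e + 1) c x h (by omega)
            (fun k hk => (hcap k).trans hk) (by omega)
          omega
        · exact fun κ h1 h2 => upd_e_le c x h h1 (fun k _ => h2 k) (hr.e_cap κ h1 h2)
      · rw [if_neg h17]
        have hmod : (r + 1) % 18 = r % 18 + 1 := by omega
        have hdiv : (r + 1) / 18 = r / 18 := by omega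
        rw [← hmod]
        refine .run _ _ _ ⟨by omega, by rw [hdiv]; exact hr.clk, ?_, ?_, by rw [hdiv]; exact hr.e_le,
          hr.e_cap, ?_, by omega⟩
        · intro i hi hm
          rw [hdiv]
          rw [mem_hear] at hm
          rcases hm with hm | ⟨h1, h2, h3⟩
          · exact hr.heard i hi hm
          · exact (hbits i hi (by omega)).1 (Or.inr h1)
        · intro i hi hlt
          rw [hdiv, mem_hear]
          rcases (show r % 18 = 2 * i + 1 ∨ 2 * i + 1 < r % 18 by omega) with h1 | h1
          · constructor
            · rintro (h2 | h2 | h2)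
              · exact (hbits i hi h1).1 (Or.inl h2)
              · exact hr.heard i hi h2
              · exact (hbits i hi h1).1 (Or.inr h2.1)
            · intro h2
              exact ((hbits i hi h1).2 h2).imp id fun h3 => Or.inr ⟨h3, by omega, by omega⟩
          · rw [← hr.bits i hi h1]
            have hi' : i ≠ r % 18 / 2 := by omega
            simp [hi']
        · intro he h5
          rw [mem_hear] at h5
          rcases h5 with h5 | ⟨h5, h6, h7⟩
          · exact hr.zero he h5
          -- A process with exponent `0` beeps on topic `5` itself and so cannot hear it.
          · apply h5.1
            rw [hst]
            exact Or.inr ⟨h6, by rw [← h7]; exact he⟩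

end Dynamics

/-! ### Stability persists -/

section Persistence

open scoped Classical

variable {V : Type} {G : SimpleGraph V} {E : Execution V} {C : Clock} {cap : ℕ → ℕ}
  {S : C.Spec} {ω : (C.alg cap).Seeds V}

lemma Phase.mod_eq {r w p : ℕ} {c : Core C.St} {x : FrameSeed} {h : Finset ℕ}
    (hp : Phase S cap r w (.run p c x h)) : p = r % 18 ∧ RunInv S cap r w c h := by
  cases hp with
  | run c x h hr => exact ⟨rfl, hr⟩

lemma run_pred {r : ℕ} (inv : ∀ r, PhaseInv G E cap S ω r) {v : V} {p : ℕ} {c : Core C.St}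
    {x : FrameSeed} {h : Finset ℕ} (hv : E.Participates v (r + 1))
    (hs : (C.alg cap).state G E ω (r + 1) v = .run p c x h) (h0 : (r + 1) % 18 ≠ 0) :
    E.Participates v r ∧ ∃ x' h', (C.alg cap).state G E ω r v = .run (r % 18) c x' h' ∧
      h = if Hears G E C cap ω r v ∧ r % 18 % 2 = 1 then insert (r % 18 / 2) h' else h' := by
  obtain ⟨w, hw, _⟩ := hv.wake
  have h1 := inv (r + 1) v w hw hv
  rw [hs] at h1
  have h2 := h1.mod_eq.2.start
  have h3 := startFrame_le w
  have hvr : E.Participates v r := hv.of_le hw (by omega) (by omega)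
  obtain ⟨c', x', h', h4, _⟩ := (inv r v w hw hvr).isRun (by omega)
  have h5 := state_succ ω hvr (G := G)
  rw [hs, h4] at h5
  simp only [Clock.trans, if_neg (show ¬ r % 18 = 17 by omega)] at h5
  obtain ⟨_, rfl, _, h6⟩ := Proc.run.inj h5
  exact ⟨hvr, x', h', h4, h6⟩

/-- Neighbours of a candidate with exponent `0` know about it. -/
lemma five_mem (inv : ∀ r, PhaseInv G E cap S ω r) {r : ℕ} {z u : V} (hzu : G.Adj z u)
    (hz : E.Participates z r) (hu : E.Participates u r) {p p' : ℕ} {c c' : Core C.St}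
    {x x' : FrameSeed} {h h' : Finset ℕ}
    (hsz : (C.alg cap).state G E ω r z = .run p c x h)
    (hsu : (C.alg cap).state G E ω r u = .run p' c' x' h')
    (h0 : c.e = 0) (h0' : c'.e ≠ 0) (hr : 11 < r % 18) : 5 ∈ h' := by
  induction r generalizing p p' x x' h h' with
  | zero => omega
  | succ r ih =>
    obtain ⟨hz', y, g, hz1, _⟩ := run_pred inv hz hsz (by omega)
    obtain ⟨hu', y', g', hu1, rfl⟩ := run_pred inv hu hsu (by omega)
    rw [mem_hear]
    -- Topic `5` has round `2 * 5 + 1 = 11`: the candidate beeps, and its neighbour with nonzero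
    -- exponent listens.
    rcases (show r % 18 = 11 ∨ 11 < r % 18 by omega) with h | h
    · right
      refine ⟨⟨?_, z, hzu.symm, hz', ?_⟩, by omega, by omega⟩
      · rw [hu1, h]
        simp [Clock.beepsIn, Clock.sends, h0']
      · rw [hz1, h]
        simp [Clock.beepsIn, Clock.sends, h0]
    · exact Or.inl (ih hz' hu' hz1 hu1 h)

lemma statusOf_eq_mis {s : Proc C.St} : C.statusOf s = Status.mis ↔
    ∃ p c x h, s = .run p c x h ∧ c.e = 0 ∧ 6 ∉ h := by
  cases s with
  | listen => simp [Clock.statusOf]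
  | wait => simp [Clock.statusOf]
  | run p c x h =>
    simp only [Clock.statusOf, Proc.run.injEq]
    constructor
    · intro hs
      refine ⟨p, c, x, h, ⟨rfl, rfl, rfl, rfl⟩, ?_⟩
      split_ifs at hs with h1 h2 h3
      exact ⟨h1, h2⟩
    · rintro ⟨_, _, _, _, ⟨rfl, rfl, rfl, rfl⟩, h1, h2⟩
      simp [h1, h2]

lemma statusOf_run_inactive {p : ℕ} {c : Core C.St} {x : FrameSeed} {h : Finset ℕ} :
    C.statusOf (.run p c x h) = Status.inactive ↔ c.e ≠ 0 ∧ c.dom = true := by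
  simp only [Clock.statusOf]
  split_ifs <;> simp_all

lemma upd_of_five_mem (hcap : ∀ k, 1 ≤ cap (k + 1)) {c : Core C.St} {x : FrameSeed} {h : Finset ℕ}
    (h5 : 5 ∈ h) : (C.upd cap c x h).e ≠ 0 ∧ (C.upd cap c x h).dom = true := by
  have := hcap (C.eff c x h)
  simp only [Clock.upd, Clock.cont, h5, not_true_eq_false, false_and, if_false, true_or, if_true]
  exact ⟨by omega, by simp⟩

lemma upd_of_winner {c : Core C.St} {x : FrameSeed} {h : Finset ℕ} (h0 : c.e = 0)
    (h5 : 5 ∉ h) (h6 : 6 ∉ h) : (C.upd cap c x h).e = 0 := by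
  have h1 : C.eff c x h = 0 := by
    unfold Clock.eff
    split <;> simp [h0]
  simp [Clock.upd, Clock.cont, h5, h6, h1]

/-- A stable MIS node that does not crash remains one. -/
theorem stableMIS_succ (hcap : ∀ k, 1 ≤ cap (k + 1)) (inv : ∀ r, PhaseInv G E cap S ω r)
    {r : ℕ} {z : V} (hz : (C.alg cap).StableMIS G E ω r z) (hz' : E.Participates z (r + 1)) :
    (C.alg cap).StableMIS G E ω (r + 1) z := by
  obtain ⟨⟨hzr, hmis⟩, hnbr⟩ := hz
  obtain ⟨p, c, x, h, hsz, h0, h6⟩ := statusOf_eq_mis.1 hmis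
  obtain ⟨w, hw, _⟩ := hzr.wake
  have hph := inv r z w hw hzr
  rw [hsz] at hph
  obtain ⟨rfl, hri⟩ := hph.mod_eq
  have h5 := hri.zero h0
  have hnbr' : ∀ u, G.Adj z u → E.Participates u r →
      (∃ c' x' h', (C.alg cap).state G E ω r u = .run (r % 18) c' x' h' ∧ c'.e ≠ 0 ∧
        c'.dom = true ∧ (11 < r % 18 → 5 ∈ h')) ∨
      (∀ p c x h, (C.alg cap).state G E ω r u ≠ .run p c x h) := by
    intro u hzu hu
    by_cases hrun : ∃ p c x h, (C.alg cap).state G E ω r u = .run p c x h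
    · obtain ⟨p', c', x', h', hsu⟩ := hrun
      obtain ⟨w', hw', _⟩ := hu.wake
      have hph' := inv r u w' hw' hu
      rw [hsu] at hph'
      obtain ⟨rfl, _⟩ := hph'.mod_eq
      have h1 : C.statusOf ((C.alg cap).state G E ω r u) = Status.inactive := hnbr u hzu hu
      rw [hsu, statusOf_run_inactive] at h1
      exact Or.inl ⟨c', x', h', hsu, h1.1, h1.2, fun hr =>
        five_mem inv hzu hzr hu hsz hsu h0 h1.1 hr⟩
    · push Not at hrun
      exact Or.inr hrun
  refine ⟨⟨hz', ?_⟩, fun u hzu hu => ?_⟩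
  · change C.statusOf _ = _
    rw [state_succ ω hzr, hsz, statusOf_eq_mis]
    simp only [Clock.trans]
    by_cases h17 : r % 18 = 17
    · rw [if_pos h17]
      exact ⟨_, _, _, _, rfl, upd_of_winner h0 h5 h6, by simp⟩
    · rw [if_neg h17]
      refine ⟨_, _, _, _, rfl, h0, ?_⟩
      rw [mem_hear]
      rintro (h7 | ⟨⟨_, u, hzu, hu, hb⟩, _, h7⟩)
      · exact h6 h7
      · rcases hnbr' u hzu hu with ⟨c', x', h', hsu, _, _, h8⟩ | hno
        · rw [hsu] at hb
          simp only [Clock.beepsIn, ← h7, Clock.sends, Clock.cont] at hb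
          -- Topic `6` comes in round `13`, after round `11`; this neighbour has already heard topic
          -- `5` and hence does not contend.
          have := h8 (by omega)
          rcases hb with hb | hb
          · omega
          · exact hb.2.1.1 this
        · generalize (C.alg cap).state G E ω r u = s at *
          cases s with
          | listen => exact hb
          | wait => exact hb
          | run p c x h => exact hno _ _ _ _ rfl
  · change C.statusOf _ = _
    by_cases hur : E.Participates u r
    · rw [state_succ ω hur]
      rcases hnbr' u hzu hur with ⟨c', x', h', hsu, h1, h2, h8⟩ | hno
      · rw [hsu]
        simp only [Clock.trans]
        split_ifs with h17
        · rw [statusOf_run_inactive]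
          exact upd_of_five_mem hcap (h8 (by omega))
        · rw [statusOf_run_inactive]
          exact ⟨h1, h2⟩
        · rw [statusOf_run_inactive]
          exact ⟨h1, h2⟩
      · generalize (C.alg cap).state G E ω r u = s at *
        cases s with
        | listen n b =>
          simp only [Clock.trans]
          split_ifs <;> simp [Clock.statusOf]
        | wait n =>
          simp only [Clock.trans]
          split_ifs <;> simp [Clock.statusOf]
        | run p c x h => exact absurd rfl (hno _ _ _ _)
    · obtain ⟨w', hw', hle⟩ := hu.wake
      have : r < w' := by
        by_contra hcon
        exact hur (hu.of_le hw' (by omega) (by omega))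
      rw [state_before_wake ω hw' (by omega)]
      rfl

/-- A stable node that does not crash remains stable as long as no MIS node crashes. -/
theorem stable_succ (hcap : ∀ k, 1 ≤ cap (k + 1)) (inv : ∀ r, PhaseInv G E cap S ω r) {r : ℕ}
    (hcr : ∀ u, (C.alg cap).InMIS G E ω r u → E.Participates u (r + 1)) {v : V}
    (hv : E.Participates v (r + 1)) (h : (C.alg cap).Stable G E ω r v) :
    (C.alg cap).Stable G E ω (r + 1) v :=
  ⟨hv, h.2.imp (fun h => stableMIS_succ hcap inv h (hcr _ h.1)) fun ⟨u, hu, h⟩ =>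
    ⟨u, hu, stableMIS_succ hcap inv h (hcr _ h.1)⟩⟩

/-- In quiet times stability of all nodes persists. -/
lemma allStable_of_le (hcap : ∀ k, 1 ≤ cap (k + 1)) (inv : ∀ r, PhaseInv G E cap S ω r)
    {r r' : ℕ} (hr : r ≤ r')
    (hq : ∀ s, r ≤ s → s ≤ r' → ∀ v, E.Participates v s ↔ E.Participates v r)
    (h : (C.alg cap).AllStable G E ω r) : (C.alg cap).AllStable G E ω r' := by
  induction r', hr using Nat.le_induction with
  | base => exact h
  | succ s hs ih =>
    have ih' := ih fun s' h1 h2 => hq s' h1 (by omega)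
    have h1 : ∀ v, E.Participates v (s + 1) ↔ E.Participates v s := fun v => by
      rw [hq (s + 1) (by omega) le_rfl, hq s hs (by omega)]
    intro v hv
    exact stable_succ hcap inv (fun u hu => (h1 u).2 hu.1) hv (ih' v ((h1 v).1 hv))

end Persistence

/-! ### Quiet frames -/

section QuietFrames

open scoped Classical

variable {P : Type} [Fintype P] (H : SimpleGraph P) (C : Clock) (cap : ℕ → ℕ) (s : P → Core C.St)
  (ξ : P → FrameSeed)

/-- The exponents. -/
def expo (u : P) : ℕ := (s u).e

/-- The lottery levels. -/
def level (u : P) : Option ℕ := C.lev (s u).clk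

/-- The cut exponents. -/
noncomputable def cutE : P → ℕ := clipE H (level C s) (expo C s) fun u => (ξ u).1

/-- Whether `u` sends on a topic. -/
noncomputable def topic : ℕ → P → Prop
  | 0, _ => True
  | 1, u => C.out (s u).clk 1 = true
  | 2, u => C.out (s u).clk 2 = true
  | 3, u => Lot (level C s) (expo C s) (fun u => (ξ u).1) u
  | 4, u => Compl H (level C s) (expo C s) (fun u => (ξ u).1) u
  | 5, u => expo C s u = 0
  | 6, u => (ξ u).2 ∈ loudSeeds H (cutE H C s ξ) u
  | 7, u => (ξ u).2 ∈ contSeeds H (cutE H C s ξ) u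
  | _, _ => False

/-- The topics `u` hears about. -/
noncomputable def heardTopics (u : P) : Finset ℕ :=
  (Finset.range 8).filter fun i => ¬ topic H C s ξ i u ∧ ∃ x, H.Adj u x ∧ topic H C s ξ i x

/-- A quiet frame. -/
noncomputable def stepCore (u : P) : Core C.St := C.upd cap (s u) (ξ u) (heardTopics H C s ξ u)

variable {H C cap s ξ}

lemma mem_heardTopics {i : ℕ} {u : P} (hi : i < 8) : i ∈ heardTopics H C s ξ u ↔
    ¬ topic H C s ξ i u ∧ ∃ x, H.Adj u x ∧ topic H C s ξ i x := by
  simp [heardTopics, hi]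

variable (hlev : ∀ c L, C.lev c = some L → 14 ≤ L)
include hlev

/-- Topics `3` and `4` each carry the veto one hop further. A complaining process cannot hear topic
`4`, but it is not cut anyway. -/
lemma eff_eq_cutE (u : P) {h : Finset ℕ}
    (hh : ∀ i < 5, i ∈ h ↔ i ∈ heardTopics H C s ξ u) : C.eff (s u) (ξ u) h = cutE H C s ξ u := by
  have m3 := (hh 3 (by norm_num)).trans (mem_heardTopics (by norm_num))
  have m4 := (hh 4 (by norm_num)).trans (mem_heardTopics (by norm_num))
  unfold Clock.eff cutE clipE
  rw [show C.lev (s u).clk = level C s u from rfl]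
  cases level C s u with
  | none => rfl
  | some L =>
    refine if_congr ?_ rfl rfl
    change _ ∧ ¬ (Lot (level C s) (expo C s) (fun u => (ξ u).1) u ∨ _) ∧ _ ↔ _
    rw [m3, m4]
    simp only [topic, Compl]
    refine and_congr_right fun _ => ?_
    by_cases h1 : Lot (level C s) (expo C s) (fun u => (ξ u).1) u
    · simp [h1]
    by_cases h2 : ∃ x, H.Adj u x ∧ Lot (level C s) (expo C s) (fun u => (ξ u).1) x
    · simp [h1, h2]
    · simp only [h1, h2, not_false_eq_true, and_false, or_false, true_and, not_exists, not_and,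
        not_or]

lemma cutE_eq_zero (u : P) : cutE H C s ξ u = 0 ↔ (s u).e = 0 := by
  unfold cutE
  rw [clipE_eq_zero (lv := level C s) fun u L h => hlev _ L h]
  rfl

lemma cont_iff (u : P) {h : Finset ℕ}
    (hh : ∀ i < 6, i ∈ h ↔ i ∈ heardTopics H C s ξ u) :
    C.cont (s u) (ξ u) h ↔ (ξ u).2 ∈ contSeeds H (cutE H C s ξ) u := by
  unfold Clock.cont contSeeds Blocked
  rw [eff_eq_cutE hlev u fun i hi => hh i (by omega), hh 5 (by norm_num),
    mem_heardTopics (by norm_num)]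
  simp only [topic, expo, Set.mem_ofPred_eq, ne_eq, cutE_eq_zero hlev]

/-- What is sent on a topic depends only on what was heard on earlier topics; this drives the
induction over the rounds of a frame. -/
lemma sends_iff (u : P) {i : ℕ} (hi : i < 8) {h : Finset ℕ}
    (hh : ∀ j < i, j ∈ h ↔ j ∈ heardTopics H C s ξ u) :
    C.sends (s u) (ξ u) h i ↔ topic H C s ξ i u := by
  interval_cases i
  · exact Iff.rfl
  · exact Iff.rfl
  · exact Iff.rfl
  · exact Iff.rfl
  · change Lot (level C s) (expo C s) (fun u => (ξ u).1) u ∨ _ ↔ _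
    rw [hh 3 (by norm_num), mem_heardTopics (by norm_num)]
    simp only [topic, Compl]
    tauto
  · exact Iff.rfl
  · change C.cont (s u) (ξ u) h ∧ _ ↔ _
    rw [cont_iff hlev u hh]
    rfl
  · exact cont_iff hlev u fun i hi => hh i (by omega)

/-- A contender hears topic `6` exactly if it is not loud but has a loud neighbour, the case in
which `nextE` denies it exponent `0`. -/
lemma stepCore_e :
    expo C (stepCore H C cap s ξ) = frameE H cap (level C s) (expo C s) ξ := by
  funext u
  have hc := cont_iff hlev (H := H) (s := s) (ξ := ξ) u (h := heardTopics H C s ξ u)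
    fun _ _ => Iff.rfl
  have he := eff_eq_cutE hlev (H := H) (s := s) (ξ := ξ) u (h := heardTopics H C s ξ u)
    fun _ _ => Iff.rfl
  change (C.upd cap (s u) (ξ u) (heardTopics H C s ξ u)).e = nextE H cap (cutE H C s ξ) _ u
  simp only [Clock.upd, nextE, he]
  by_cases h1 : (ξ u).2 ∈ contSeeds H (cutE H C s ξ) u
  · rw [if_pos (hc.2 h1), if_pos h1]
    have m6 := mem_heardTopics (H := H) (C := C) (s := s) (ξ := ξ) (u := u) (i := 6) (by norm_num)
    by_cases h2 : (ξ u).2 ∈ loudSeeds H (cutE H C s ξ) u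
    · rw [if_neg (fun h => (m6.1 h).1 h2), if_pos (Or.inl h2)]
    by_cases h3 : ∃ x, H.Adj u x ∧ (ξ x).2 ∈ loudSeeds H (cutE H C s ξ) x
    · rw [if_pos (m6.2 ⟨h2, h3⟩), if_neg]
      push Not
      exact ⟨h2, h3⟩
    · rw [if_neg fun h => h3 (m6.1 h).2, if_pos]
      push Not at h3
      exact Or.inr h3
  · rw [if_neg (hc.not.2 h1), if_neg h1]
    refine if_congr ?_ rfl rfl
    rw [mem_heardTopics (by norm_num), mem_heardTopics (by norm_num)]
    simp only [topic, h1, not_false_eq_true, true_and, Blocked, ne_eq, cutE_eq_zero hlev]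
    rfl

lemma stepCore_dom (u : P) : (stepCore H C cap s ξ u).dom = true ↔ Blocked H (expo C s) u := by
  simp only [stepCore, Clock.upd, decide_eq_true_eq, mem_heardTopics (show 5 < 8 by norm_num)]
  rfl

end QuietFrames

/-! ### Quiet frames of the algorithm -/

section Quiet

open scoped Classical

variable {V : Type} {G : SimpleGraph V} {E : Execution V} {C : Clock} {cap : ℕ → ℕ}
  {S : C.Spec}

/-- The core of a running process. -/
def coreOf : Proc C.St → Core C.St
  | .run _ c _ _ => c
  | _ => ⟨1, true, C.root⟩

variable (E) in
/-- The nodes participating in round `t`. -/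
abbrev Members (t : ℕ) : Type := {v // E.Participates v t}

variable (G E) in
/-- The graph induced by the participating nodes. -/
abbrev memberGraph (t : ℕ) : SimpleGraph (Members E t) := G.comap Subtype.val

variable (G E C cap) in
/-- The cores of the participating processes at the beginning of a frame. -/
noncomputable def cfg (t k : ℕ) (ω : (C.alg cap).Seeds V) (u : Members E t) : Core C.St :=
  coreOf ((C.alg cap).state G E ω (18 * k) u)

variable (E C cap) in
/-- The seeds that the participating processes use in a frame. -/
def frameSeeds (t k : ℕ) (ω : (C.alg cap).Seeds V) (u : Members E t) : FrameSeed := ω (u.1, 18 * k)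

variable {t b : ℕ} (hq : ∀ r, t ≤ r → r ≤ b → ∀ v, E.Participates v r ↔ E.Participates v t)
  {ω : (C.alg cap).Seeds V} (inv : ∀ r, PhaseInv G E cap S ω r)

include hq inv

/-- The offset `54` is the longest possible time from waking up to running. -/
lemma state_frame_start {k : ℕ} (hk : t + 54 ≤ 18 * k) (hb : 18 * k ≤ b) (u : Members E t) :
    ∃ x w, w ≤ t ∧ E.wake u.1 = (w : ℕ) ∧
      (C.alg cap).state G E ω (18 * k) u = .run 0 (cfg G E C cap t k ω u) x ∅ ∧
      RunInv S cap (18 * k) w (cfg G E C cap t k ω u) ∅ := by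
  obtain ⟨w, hw, hwt⟩ := u.2.wake
  have hu := (hq (18 * k) (by omega) hb u.1).2 u.2
  have h1 := startFrame_le w
  obtain ⟨c, x, h, hs, hr⟩ := (inv _ u.1 w hw hu).isRun (by omega)
  have h2 := hr.fresh (by omega)
  subst h2
  rw [show 18 * k % 18 = 0 by omega] at hs
  have hc : cfg G E C cap t k ω u = c := by simp only [cfg, hs]; rfl
  rw [hc]
  exact ⟨x, w, hwt, hw, hs, hr⟩

variable [Fintype (Members E t)] (hlev : ∀ c L, C.lev c = some L → 14 ≤ L)
include hlev

/-- The case `p = 0` is exempt because the seed of the frame is only drawn in that round; until then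
the stored seed is an irrelevant leftover. -/
lemma state_in_frame {k : ℕ} (hk : t + 54 ≤ 18 * k) {p : ℕ} (hp : p ≤ 17) (hb : 18 * k + p ≤ b)
    (u : Members E t) :
    ∃ x, (p = 0 ∨ x = frameSeeds E C cap t k ω u) ∧
      (C.alg cap).state G E ω (18 * k + p) u = .run p (cfg G E C cap t k ω u) x
        ((heardTopics (memberGraph G E t) C (cfg G E C cap t k ω) (frameSeeds E C cap t k ω)
          u).filter fun i => 2 * i + 1 < p) := by
  induction p generalizing u with
  | zero =>
    obtain ⟨x, _, _, _, hx, _⟩ := state_frame_start hq inv hk hb u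
    exact ⟨x, Or.inl rfl, by simpa using hx⟩
  | succ p ih =>
    have ih := ih (by omega) (by omega)
    have hpart : ∀ v, E.Participates v (18 * k + p) ↔ E.Participates v t :=
      hq _ (by omega) (by omega)
    have hst := state_succ ω ((hpart u.1).2 u.2) (G := G)
    obtain ⟨x, hx, hs⟩ := ih u
    rw [hs] at hst
    simp only [Clock.trans, if_neg (show ¬ p = 17 by omega)] at hst
    refine ⟨if p = 0 then ω (u.1, 18 * k + p) else x, Or.inr ?_, hst.trans ?_⟩
    · by_cases h0 : p = 0
      · subst h0; rfl
      · exact (if_neg h0).trans (hx.resolve_left h0)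
    congr 1
    ext i
    rw [mem_hear, Finset.mem_filter, Finset.mem_filter]
    have hsend : p % 2 = 1 → ∀ y : Members E t,
        C.beepsIn ((C.alg cap).state G E ω (18 * k + p) y) ↔
          topic (memberGraph G E t) C (cfg G E C cap t k ω) (frameSeeds E C cap t k ω) (p / 2) y := by
      intro hodd y
      obtain ⟨x, hx, hs⟩ := ih y
      rw [hs]
      have hx' := hx.resolve_left (by omega)
      subst hx'
      rw [← sends_iff hlev y (show p / 2 < 8 by omega) (h := (heardTopics (memberGraph G E t) C
        (cfg G E C cap t k ω) (frameSeeds E C cap t k ω) y).filter fun i => 2 * i + 1 < p)]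
      · simp only [Clock.beepsIn, hodd, true_and]
        exact or_iff_right (by omega)
      · intro j hj
        rw [Finset.mem_filter]
        exact and_iff_left (by omega)
    have hhear : p % 2 = 1 → (Hears G E C cap ω (18 * k + p) u ↔ p / 2 ∈ heardTopics
        (memberGraph G E t) C (cfg G E C cap t k ω) (frameSeeds E C cap t k ω) u) := by
      intro hodd
      rw [mem_heardTopics (by omega), ← hsend hodd]
      unfold Hears
      refine and_congr_right fun _ => ⟨?_, ?_⟩
      · rintro ⟨y, hy1, hy2, hy3⟩
        exact ⟨⟨y, (hpart y).1 hy2⟩, hy1, (hsend hodd _).1 hy3⟩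
      · rintro ⟨y, hy1, hy2⟩
        exact ⟨y.1, hy1, (hpart y.1).2 y.2, (hsend hodd _).2 hy2⟩
    constructor
    · rintro (⟨h1, h2⟩ | ⟨h1, h2, h3⟩)
      · exact ⟨h1, by omega⟩
      · subst h3
        exact ⟨(hhear h2).1 h1, by omega⟩
    · rintro ⟨h1, h2⟩
      rcases (show 2 * i + 1 < p ∨ p = 2 * i + 1 by omega) with h | h
      · exact Or.inl ⟨h1, h⟩
      · have h3 : i = p / 2 := by omega
        have h4 : p % 2 = 1 := by omega
        subst h3
        exact Or.inr ⟨(hhear h4).2 h1, h4, rfl⟩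

/-- In a quiet frame the configuration changes as described by `stepCore`. -/
theorem cfg_succ {k : ℕ} (hk : t + 54 ≤ 18 * k) (hb : 18 * k + 17 ≤ b) :
    cfg G E C cap t (k + 1) ω =
      stepCore (memberGraph G E t) C cap (cfg G E C cap t k ω) (frameSeeds E C cap t k ω) := by
  funext u
  obtain ⟨x, hx, hs⟩ := state_in_frame hq inv hlev hk le_rfl hb u
  have hx := hx.resolve_left (by omega)
  subst hx
  have hst := state_succ ω ((hq _ (by omega) hb u.1).2 u.2) (G := G)
  rw [hs] at hst
  change coreOf ((C.alg cap).state G E ω (18 * (k + 1)) u) = _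
  rw [show 18 * (k + 1) = 18 * k + 17 + 1 by ring, hst]
  simp only [Clock.trans, if_true]
  change C.upd cap _ _ _ = C.upd cap _ _ _
  rw [Finset.filter_true_of_mem]
  intro i hi
  simp only [heardTopics, Finset.mem_filter, Finset.mem_range] at hi
  omega

/-- One frame after all nodes are settled, all nodes are stable. -/
theorem allStable_of_settled {θ : ℝ} (hc : CapSpec cap θ) {k : ℕ} (hk : t + 54 ≤ 18 * k)
    (hb : 18 * (k + 1) ≤ b)
    (hset : ∀ u, Settled (memberGraph G E t) (expo C (cfg G E C cap t k ω)) u) :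
    (C.alg cap).AllStable G E ω (18 * (k + 1)) := by
  have hpart : ∀ v, E.Participates v (18 * (k + 1)) ↔ E.Participates v t :=
    hq _ (by omega) (by omega)
  have hmis : ∀ u : Members E t, TrueMIS (memberGraph G E t) (expo C (cfg G E C cap t k ω)) u →
      (C.alg cap).StableMIS G E ω (18 * (k + 1)) u := by
    intro u hu
    have hcs := cfg_succ hq inv hlev hk (by omega)
    have hlv : ∀ u L, level C (cfg G E C cap t k ω) u = some L → 14 ≤ L :=
      fun u L h => hlev _ L h
    have hu' : TrueMIS (memberGraph G E t) (expo C (cfg G E C cap t (k + 1) ω)) u := by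
      rw [hcs, stepCore_e hlev]
      exact trueMIS_nextE hc ((trueMIS_clipE hlv _ _).2 hu) _
    refine ⟨⟨(hpart u.1).2 u.2, ?_⟩, fun v huv hv => ?_⟩
    · obtain ⟨x, _, _, _, hs, _⟩ := state_frame_start hq inv (show t + 54 ≤ 18 * (k + 1) by omega)
        (by omega) u
      exact statusOf_eq_mis.2 ⟨_, _, _, _, hs, hu'.1, by simp⟩
    · set y : Members E t := ⟨v, (hpart v).1 hv⟩
      obtain ⟨x, _, _, _, hs, _⟩ := state_frame_start hq inv (show t + 54 ≤ 18 * (k + 1) by omega)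
        (by omega) y
      change C.statusOf ((C.alg cap).state G E ω (18 * (k + 1)) y) = _
      rw [hs, statusOf_run_inactive]
      refine ⟨hu'.2 y huv, ?_⟩
      -- The flag refers to the exponents one frame earlier, which is why stability lags one frame
      -- behind settling.
      rw [hcs, stepCore_dom hlev]
      exact ⟨hu.2 y huv, u, huv.symm, hu.1⟩
  intro v hv
  refine ⟨hv, ?_⟩
  rcases hset ⟨v, (hpart v).1 hv⟩ with h | ⟨y, hy, h⟩
  · exact Or.inl (hmis _ h)
  · exact Or.inr ⟨y.1, hy, hmis y h⟩

end Quiet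

/-! ### The chain of configurations -/

section OneStep

open scoped Classical

/-- The states in round `R` depend only on the seeds of earlier rounds. -/
lemma state_congr {V : Type} {A : Algorithm} {G : SimpleGraph V} {E : Execution V}
    {ω ω' : A.Seeds V} {R : ℕ} (h : ∀ v r, r < R → ω (v, r) = ω' (v, r)) :
    A.state G E ω R = A.state G E ω' R := by
  induction R with
  | zero => rfl
  | succ R ih =>
    have ih := ih fun v r hr => h v r (by omega)
    have hb : ∀ v, A.Beeps E ω R (A.state G E ω R) v ↔ A.Beeps E ω' R (A.state G E ω' R) v := by
      intro v
      simp only [Algorithm.Beeps, ih, h v R (by omega)]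
    have hf : A.feedback G E ω R (A.state G E ω R) = A.feedback G E ω' R (A.state G E ω' R) := by
      funext v
      simp only [Algorithm.feedback, hb]
    funext v
    simp only [Algorithm.state]
    rw [hf, ih, h v R (by omega)]

instance (A : Algorithm) (V : Type) : IsProbabilityMeasure (A.prob V) := by
  unfold Algorithm.prob
  infer_instance

variable {V : Type} [Fintype V] {G : SimpleGraph V} {E : Execution V} {C : Clock} {cap : ℕ → ℕ}
  {S : C.Spec}

variable (V) in
/-- The indices of the seeds drawn before a frame. -/
def seedsBefore (k : ℕ) : Finset (V × ℕ) := Finset.univ ×ˢ Finset.range (18 * k)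

/-- Factoring through finitely many earlier seeds yields both measurability of the configuration and
its independence of the seeds of frame `k`. -/
lemma exists_cfg_factor (t k : ℕ) :
    ∃ φ : (seedsBefore V k → FrameSeed) → (Members E t → Core C.St),
      (φ ∘ fun (ω : V × ℕ → FrameSeed) (i : seedsBefore V k) => ω i) = cfg G E C cap t k := by
  refine ⟨fun η => cfg G E C cap t k fun i =>
    if h : i ∈ seedsBefore V k then η ⟨i, h⟩ else (0 : FrameSeed), ?_⟩
  funext ω u
  refine congrArg (fun σ : V → Proc C.St => coreOf (σ u.1)) (state_congr (A := C.alg cap)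
    fun v r hr => ?_)
  exact dif_pos (by simp [seedsBefore, hr])

lemma measurableSet_cfg (t k : ℕ) (p : (Members E t → Core C.St) → Prop) :
    MeasurableSet {ω : (C.alg cap).Seeds V | p (cfg G E C cap t k ω)} := by
  obtain ⟨φ, hφ⟩ := exists_cfg_factor (V := V) (G := G) (E := E) (C := C) (cap := cap) t k
  rw [← hφ]
  exact (measurable_pi_lambda (fun (ω : V × ℕ → FrameSeed) (i : seedsBefore V k) => ω i)
    fun i => measurable_pi_apply _) (MeasurableSet.of_discrete (s := {η | p (φ η)}))

/-- The configuration at the beginning of a frame and the seeds of that frame are independent, and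
the latter have the product distribution. -/
lemma lintegral_cfg_frameSeeds (t k : ℕ) (g : (Members E t → Core C.St) →
    (Members E t → FrameSeed) → ENNReal) :
    ∫⁻ ω, g (cfg G E C cap t k ω) (frameSeeds E C cap t k ω) ∂((C.alg cap).prob V) =
      ∫⁻ ω, ∫⁻ ξ, g (cfg G E C cap t k ω) ξ ∂(Measure.pi fun _ : Members E t => frameLaw)
        ∂((C.alg cap).prob V) := by
  let F₂ : Finset (V × ℕ) := Finset.univ ×ˢ {18 * k}
  have hind := ProbabilityTheory.iIndepFun_infinitePi (P := fun _ : V × ℕ => frameLaw)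
    (X := fun _ s => s) fun _ => measurable_id
  have hdis : Disjoint (seedsBefore V k) F₂ := by
    rw [Finset.disjoint_left]
    rintro ⟨v, r⟩ h1 h2
    simp only [seedsBefore, F₂, Finset.mem_product, Finset.mem_univ, Finset.mem_range, true_and,
      Finset.mem_singleton] at h1 h2
    omega
  have hI := hind.indepFun_finset (seedsBefore V k) F₂ hdis fun i => measurable_pi_apply i
  let _ : MeasurableSpace (Members E t → Core C.St) := ⊤
  obtain ⟨φ, hφ⟩ := exists_cfg_factor (V := V) (G := G) (E := E) (C := C) (cap := cap) t k
  let ψ : (F₂ → FrameSeed) → (Members E t → FrameSeed) := fun η u =>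
    η ⟨(u.1, 18 * k), by simp [F₂]⟩
  have hXY : ProbabilityTheory.IndepFun (cfg G E C cap t k) (frameSeeds E C cap t k)
      ((C.alg cap).prob V) := by
    have := hI.comp (φ := φ) (ψ := ψ) Measurable.of_discrete Measurable.of_discrete
    rw [hφ] at this
    exact this
  have hX : Measurable (cfg (V := V) G E C cap t k) := by
    have := (Measurable.of_discrete (f := φ)).comp (measurable_pi_lambda
      (fun (ω : V × ℕ → FrameSeed) (i : (seedsBefore V k)) => ω i) fun i => measurable_pi_apply _)
    rw [hφ] at this
    exact this
  have hY : Measurable (frameSeeds (V := V) E C cap t k) :=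
    measurable_pi_lambda _ fun u => measurable_pi_apply _
  have hYlaw : ((C.alg cap).prob V).map (frameSeeds E C cap t k) =
      Measure.pi fun _ : Members E t => frameLaw := by
    have hinj : Function.Injective fun u : Members E t => (u.1, 18 * k) := fun u v h =>
      Subtype.ext (congrArg Prod.fst h)
    have h1 := hind.precomp hinj
    rw [ProbabilityTheory.iIndepFun_iff_map_fun_eq_pi_map
      fun u => (measurable_pi_apply _).aemeasurable] at h1
    refine h1.trans ?_
    congr 1
    funext u
    exact Measure.infinitePi_map_eval _ _
  have hmap := (ProbabilityTheory.indepFun_iff_map_prod_eq_prod_map_map hX.aemeasurable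
    hY.aemeasurable).1 hXY
  have hg : Measurable (Function.uncurry g) := Measurable.of_discrete
  calc ∫⁻ ω, g (cfg G E C cap t k ω) (frameSeeds E C cap t k ω) ∂((C.alg cap).prob V)
      = ∫⁻ z, Function.uncurry g z ∂(((C.alg cap).prob V).map
          fun ω => (cfg G E C cap t k ω, frameSeeds E C cap t k ω)) := by
        rw [lintegral_map hg (hX.prodMk hY)]
        rfl
    _ = ∫⁻ s, ∫⁻ ξ, g s ξ ∂(Measure.pi fun _ : Members E t => frameLaw)
          ∂(((C.alg cap).prob V).map (cfg G E C cap t k)) := by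
        rw [hmap, hYlaw, lintegral_prod _ hg.aemeasurable]
        rfl
    _ = _ := lintegral_map Measurable.of_discrete hX

variable {t b : ℕ} (hq : ∀ r, t ≤ r → r ≤ b → ∀ v, E.Participates v r ↔ E.Participates v t)
  (inv : ∀ (ω : (C.alg cap).Seeds V) r, PhaseInv G E cap S ω r)
  (hlev : ∀ c L, C.lev c = some L → 14 ≤ L)
include hq inv hlev

lemma lintegral_cfg_succ {k : ℕ} (hk : t + 54 ≤ 18 * k) (hb : 18 * k + 17 ≤ b)
    (g : (Members E t → Core C.St) → ENNReal) :
    ∫⁻ ω, g (cfg G E C cap t (k + 1) ω) ∂((C.alg cap).prob V) =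
      ∫⁻ ω, stepOp (stepCore (memberGraph G E t) C cap) g (cfg G E C cap t k ω)
        ∂((C.alg cap).prob V) := by
  refine (lintegral_congr fun ω => ?_).trans
    (lintegral_cfg_frameSeeds t k fun s ξ => g (stepCore (memberGraph G E t) C cap s ξ))
  rw [cfg_succ hq (inv ω) hlev hk hb]

lemma lintegral_cfg_add {k : ℕ} (hk : t + 54 ≤ 18 * k) (F : ℕ) (hb : 18 * (k + F) ≤ b)
    (g : (Members E t → Core C.St) → ENNReal) :
    ∫⁻ ω, g (cfg G E C cap t (k + F) ω) ∂((C.alg cap).prob V) =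
      ∫⁻ ω, (stepOp (stepCore (memberGraph G E t) C cap))^[F] g (cfg G E C cap t k ω)
        ∂((C.alg cap).prob V) := by
  induction F generalizing g with
  | zero => rfl
  | succ F ih =>
    rw [← add_assoc, lintegral_cfg_succ hq inv hlev (by omega) (by omega), ih (by omega),
      Function.iterate_succ_apply]

end OneStep

/-! ### The probability of stability -/

section Main

open scoped Classical

variable {V : Type} [Fintype V] {G : SimpleGraph V} {E : Execution V} {C : Clock} {cap : ℕ → ℕ}
  (S : C.Spec)

variable (cap) in
/-- The cores possible in frame `g` for a process that began in frame `f₀`. -/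
structure Admissible (g f₀ : ℕ) (c : Core C.St) : Prop where
  clk : c.clk = S.tru g ∨ S.ok g f₀ c.clk
  e_le : c.e + f₀ ≤ 1 + g
  e_cap : ∀ κ, 1 ≤ κ → (∀ k, cap k ≤ κ) → c.e ≤ κ

variable (cap) in
/-- A frame after which all exponents are small with high probability. -/
def GoodFrame (R Λ g : ℕ) : Prop :=
  (∀ f₀ c, Admissible cap S g f₀ c → c.e ≤ R) ∨
  ∀ f₀ c, Admissible cap S g f₀ c → (∀ L, C.lev c.clk = some L → Λ ≤ L) ∧
    (c.e ≤ R ∨ ∃ L, C.lev c.clk = some L ∧ 3 * L ≤ R)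

variable {S}

lemma RunInv.admissible {r w : ℕ} {c : Core C.St} {h : Finset ℕ} (hr : RunInv S cap r w c h) :
    Admissible cap S (r / 18) (startFrame w) c :=
  ⟨hr.clk.imp (·.2) (·.2), hr.e_le, hr.e_cap⟩

variable {t b : ℕ} (hq : ∀ r, t ≤ r → r ≤ b → ∀ v, E.Participates v r ↔ E.Participates v t)
  (inv : ∀ (ω : (C.alg cap).Seeds V) r, PhaseInv G E cap S ω r)
  (hlev : ∀ c L, C.lev c = some L → 14 ≤ L) {θ : ℝ} (hc : CapSpec cap θ)
  (hdeg : ∀ v, (Finset.univ.filter fun u => G.Adj v u).card * θ ≤ 1 / 16000)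

include hq inv hc in
lemma large_exponent_prob {R Λ k : ℕ} (hk : t + 54 ≤ 18 * k) (hb : 18 * k + 17 ≤ b)
    (hgood : GoodFrame cap S R Λ k) (ω : (C.alg cap).Seeds V) :
    (Measure.pi fun _ : Members E t => frameLaw) {ξ | ∃ u, R + 1 < frameE (memberGraph G E t) cap
      (level C (cfg G E C cap t k ω)) (expo C (cfg G E C cap t k ω)) ξ u} ≤
      ENNReal.ofReal (Fintype.card V * wt (2 * Λ)) := by
  have hadm : ∀ u, ∃ f₀, Admissible cap S k f₀ (cfg G E C cap t k ω u) := by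
    intro u
    obtain ⟨_, w, _, _, _, hr⟩ := state_frame_start hq (inv ω) hk (by omega) u
    have := hr.admissible
    rw [show 18 * k / 18 = k by omega] at this
    exact ⟨_, this⟩
  refine (frameE_large_prob hc (R := R) (Λ := Λ) ?_).trans ?_
  · rcases hgood with h | h
    · left
      intro u
      obtain ⟨f₀, hf⟩ := hadm u
      exact h f₀ _ hf
    · right
      refine ⟨fun u L hL => ?_, fun u => ?_⟩
      · obtain ⟨f₀, hf⟩ := hadm u
        exact (h f₀ _ hf).1 L hL
      · obtain ⟨f₀, hf⟩ := hadm u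
        exact (h f₀ _ hf).2
  · refine ENNReal.ofReal_le_ofReal (mul_le_mul_of_nonneg_right ?_ (wt_nonneg _))
    exact_mod_cast Fintype.card_subtype_le _

include hq inv hlev hc hdeg in
/-- The probability that a given process is not settled `F` frames after a good frame. -/
lemma unsettled_prob {R Λ k F : ℕ} (hk : t + 54 ≤ 18 * k) (hb : 18 * (k + 1 + F) ≤ b)
    (hgood : GoodFrame cap S R Λ k) (v : Members E t) :
    ((C.alg cap).prob V) {ω | ¬ Settled (memberGraph G E t)
        (expo C (cfg G E C cap t (k + 1 + F) ω)) v} ≤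
      ENNReal.ofReal (Fintype.card V * wt (2 * Λ) + 16 * (1 - driftA / 200) ^ F *
        ((Fintype.card V + 1) * (1 + driftA / 20) ^ (R + 1))) := by
  have ha := driftA_pos
  have ha' := driftA_le
  have hcard : (Fintype.card (Members E t) : ℝ) ≤ Fintype.card V := by
    exact_mod_cast Fintype.card_subtype_le _
  have hwt := wt_nonneg (2 * Λ)
  have hθ : ∀ v, (Finset.univ.filter fun u => (memberGraph G E t).Adj v u).card * θ ≤
      1 / 16000 := by
    intro v
    refine le_trans (mul_le_mul_of_nonneg_right ?_ hc.nonneg) (hdeg v.1)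
    refine Nat.cast_le.2 (Finset.card_le_card_of_injOn Subtype.val ?_ Subtype.val_injective.injOn)
    intro u hu
    simpa using hu
  set g : (Members E t → Core C.St) → ENNReal :=
    fun s => if Settled (memberGraph G E t) (expo C s) v then 0 else 1 with hg
  set step := stepCore (memberGraph G E t) C cap with hstep
  set D := 16 * (1 - driftA / 200) ^ F *
        ((Fintype.card V + 1) * (1 + driftA / 20) ^ (R + 1)) with hD
  have h0 : 0 ≤ 16 * (1 - driftA / 200) ^ F := by
    have : 0 ≤ 1 - driftA / 200 := by linarith
    positivity
  have hD0 : 0 ≤ D := mul_nonneg h0 (by positivity)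
  set B : Set (Members E t → Core C.St) := {s | ∃ u, R + 1 < expo C s u} with hB
  -- Configurations with an exponent above `R + 1` are charged the trivial bound `1`; to all others
  -- the drift applies.
  have hpt : ∀ s, (stepOp step)^[F] g s ≤ B.indicator 1 s + ENNReal.ofReal D := by
    intro s
    by_cases hs : s ∈ B
    · rw [Set.indicator_of_mem hs]
      refine (stepOp_iterate_le_one (fun s => ?_) F s).trans le_self_add
      simp only [hg]
      split_ifs <;> simp
    · rw [Set.indicator_of_notMem hs, zero_add]
      refine (stepOp_iterate_unsettled_le (e := expo C) (lv := level C) hc hθ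
        (fun s ξ => stepCore_e hlev) (fun s u L h => hlev _ L h) v F s).trans ?_
      refine ENNReal.ofReal_le_ofReal (mul_le_mul_of_nonneg_left ?_ h0)
      have he : expo C s v ≤ R + 1 := by
        by_contra hcon
        exact hs ⟨v, not_le.1 hcon⟩
      refine (pot_le v).trans ?_
      gcongr
      linarith
  have hbad : ∀ ω, stepOp step (B.indicator 1) (cfg G E C cap t k ω) ≤
      ENNReal.ofReal (Fintype.card V * wt (2 * Λ)) := by
    intro ω
    refine le_trans (le_of_eq ?_) (large_exponent_prob hq inv hc hk (by omega) hgood ω)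
    rw [← lintegral_indicator_one MeasurableSet.of_discrete]
    refine lintegral_congr fun ξ => ?_
    simp only [Set.indicator_apply, hB, Set.mem_ofPred_eq, hstep, stepCore_e hlev, Pi.one_apply]
  calc ((C.alg cap).prob V) {ω | ¬ Settled (memberGraph G E t)
        (expo C (cfg G E C cap t (k + 1 + F) ω)) v}
      = ∫⁻ ω, g (cfg G E C cap t (k + 1 + F) ω) ∂((C.alg cap).prob V) := by
        rw [← lintegral_indicator_one (measurableSet_cfg t (k + 1 + F)
          fun s => ¬ Settled (memberGraph G E t) (expo C s) v)]
        refine lintegral_congr fun ω => ?_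
        simp only [Set.indicator_apply, Set.mem_ofPred_eq, hg, ite_not, Pi.one_apply]
    _ = ∫⁻ ω, (stepOp step)^[F] g (cfg G E C cap t (k + 1) ω) ∂((C.alg cap).prob V) :=
        lintegral_cfg_add hq inv hlev (by omega) F hb g
    _ ≤ ∫⁻ ω, (B.indicator 1 (cfg G E C cap t (k + 1) ω) + ENNReal.ofReal D)
          ∂((C.alg cap).prob V) := lintegral_mono fun ω => hpt _
    _ = ∫⁻ ω, stepOp step (B.indicator 1) (cfg G E C cap t k ω) ∂((C.alg cap).prob V) +
          ENNReal.ofReal D := by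
        rw [lintegral_add_right _ measurable_const, lintegral_cfg_succ hq inv hlev hk (by omega),
          lintegral_const, measure_univ, mul_one]
    _ ≤ ENNReal.ofReal (Fintype.card V * wt (2 * Λ)) + ENNReal.ofReal D := by
        gcongr
        refine (lintegral_mono hbad).trans ?_
        simp
    _ = _ := (ENNReal.ofReal_add (by positivity) hD0).symm

include hq inv hlev hc hdeg in
/-- After a good frame and `F` further frames, it is unlikely that some process is unstable. -/
theorem allStable_prob {R Λ k F : ℕ} (hk : t + 54 ≤ 18 * k) (hb : 18 * (k + F + 2) ≤ b)
    (hgood : GoodFrame cap S R Λ k) :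
    ((C.alg cap).prob V).real {ω | ¬ (C.alg cap).AllStable G E ω b} ≤
      Fintype.card V * (Fintype.card V * wt (2 * Λ) + 16 * (1 - driftA / 200) ^ F *
        ((Fintype.card V + 1) * (1 + driftA / 20) ^ (R + 1))) := by
  have ha := driftA_pos
  have ha' := driftA_le
  set D := Fintype.card V * wt (2 * Λ) + 16 * (1 - driftA / 200) ^ F *
        ((Fintype.card V + 1) * (1 + driftA / 20) ^ (R + 1)) with hD
  have hD0 : 0 ≤ D := by
    have := wt_nonneg (2 * Λ)
    have : 0 ≤ 1 - driftA / 200 := by linarith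
    positivity
  set U : Members E t → Set ((C.alg cap).Seeds V) := fun v => {ω | ¬ Settled (memberGraph G E t)
        (expo C (cfg G E C cap t (k + 1 + F) ω)) v} with hU
  have hsub : {ω | ¬ (C.alg cap).AllStable G E ω b} ⊆
      ⋃ v ∈ (Finset.univ : Finset (Members E t)), U v := by
    intro ω hω
    by_contra hcon
    simp only [hU, Set.mem_iUnion, Finset.mem_univ, exists_true_left, Set.mem_ofPred_eq, not_exists,
      not_not] at hcon
    refine hω ?_
    have h1 := allStable_of_settled hq (inv ω) hlev hc (by omega) (by omega) hcon
    refine allStable_of_le hc.one_le (inv ω) (by omega) (fun s h2 h3 v => ?_) h1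
    exact (hq s (by omega) h3 v).trans (hq _ (by omega) (by omega) v).symm
  refine (measureReal_mono hsub (measure_ne_top _ _)).trans ?_
  refine (measureReal_biUnion_finset_le _ _).trans ?_
  calc ∑ v : Members E t, ((C.alg cap).prob V).real (U v) ≤ ∑ v : Members E t, D := by
        refine Finset.sum_le_sum fun v _ => ?_
        rw [measureReal_def]
        exact ENNReal.toReal_le_of_le_ofReal hD0
          (unsettled_prob hq inv hlev hc hdeg hk (by omega) hgood v)
    _ ≤ _ := by
        rw [Finset.sum_const, nsmul_eq_mul]
        refine mul_le_mul_of_nonneg_right ?_ hD0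
        exact_mod_cast Fintype.card_subtype_le _

end Main

/-! ### Time bounds -/

/-- The first term is the risk of a ticket in the good frame. In the second, `10 * (R + 1)` frames
offset the initial factor `(1 + a/20) ^ (R + 1)`, and the other `q' * m` frames give `exp (-(c + 8)
* m)`, of which `6 * m` absorbs the constant `64` and `2 * m` the factor `N ^ 2`. -/
lemma failure_bound {n N m q q' R : ℕ} {c : ℝ} (hc : 1 ≤ c) (hn : n ≤ N) (hN : 2 ≤ N)
    (hm : N ≤ 2 ^ m) (hq : c + 3 ≤ q) (hq' : 200 * (c + 8) / driftA ≤ q') :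
    (n : ℝ) * (n * wt (2 * (q * m)) + 16 * (1 - driftA / 200) ^ (10 * (R + 1) + q' * m) *
      ((n + 1) * (1 + driftA / 20) ^ (R + 1))) ≤ (N : ℝ) ^ (-c) := by
  have ha := driftA_pos
  have ha' := driftA_le
  have hN' : (2 : ℝ) ≤ N := by exact_mod_cast hN
  have hn' : (n : ℝ) ≤ N := by exact_mod_cast hn
  have hN0 : (0 : ℝ) < N := by linarith
  set l := Real.log N with hl
  have hNe : (N : ℝ) = Real.exp l := (Real.exp_log hN0).symm
  have hl0 : 0 ≤ l := Real.log_nonneg (by linarith)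
  have hlm2 : l ≤ m * Real.log 2 := by
    rw [hl, ← Real.log_pow]
    exact Real.log_le_log hN0 (by exact_mod_cast hm)
  have hlog2 : Real.log 2 ≤ 1 := by linarith [Real.log_two_lt_d9]
  have hm0 : (0 : ℝ) ≤ m := Nat.cast_nonneg m
  have hlm : l ≤ m := hlm2.trans (by nlinarith)
  have hm1 : (1 : ℝ) ≤ m := by
    have : m ≠ 0 := by rintro rfl; simp at hm; omega
    exact_mod_cast Nat.one_le_iff_ne_zero.2 this
  have hrhs : (N : ℝ) ^ (-c) = Real.exp (-(c * l)) := by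
    rw [Real.rpow_def_of_pos hN0, ← hl]; ring_nf
  have h1 : (n : ℝ) * (n * wt (2 * (q * m))) ≤ Real.exp (-(c * l)) / 2 := by
    have hw : wt (2 * (q * m)) ≤ Real.exp (-(2 * q * l)) := by
      have : wt (2 * (q * m)) = Real.exp (-(2 * q * (m * Real.log 2))) := by
        unfold wt
        rw [one_div, inv_pow, Real.exp_neg, ← Real.exp_log (show (0:ℝ) < 2 by norm_num),
          ← Real.exp_nat_mul, Real.exp_log (by norm_num)]
        push_cast
        ring_nf
      rw [this]
      refine Real.exp_le_exp.2 (neg_le_neg (mul_le_mul_of_nonneg_left hlm2 (by positivity)))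
    calc (n : ℝ) * (n * wt (2 * (q * m))) ≤ N * (N * Real.exp (-(2 * q * l))) := by
          have := wt_nonneg (2 * (q * m))
          gcongr
      _ = Real.exp (l + (l + -(2 * q * l))) := by rw [Real.exp_add, Real.exp_add, ← hNe]
      _ ≤ Real.exp (-(c * l) - l) := Real.exp_le_exp.2 (by nlinarith)
      _ = Real.exp (-(c * l)) / N := by rw [Real.exp_sub, ← hNe]
      _ ≤ _ := by gcongr
  have h2 : (n : ℝ) * (16 * (1 - driftA / 200) ^ (10 * (R + 1) + q' * m) *
      ((n + 1) * (1 + driftA / 20) ^ (R + 1))) ≤ Real.exp (-(c * l)) / 2 := by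
    have e1 : (1 - driftA / 200) ^ (10 * (R + 1) + q' * m) ≤
        Real.exp (-(driftA / 20 * (R + 1)) - (c + 8) * m) := by
      calc (1 - driftA / 200) ^ (10 * (R + 1) + q' * m)
          ≤ Real.exp (-(driftA / 200)) ^ (10 * (R + 1) + q' * m) :=
            pow_le_pow_left₀ (by linarith) (by linarith [Real.add_one_le_exp (-(driftA / 200))]) _
        _ = Real.exp (-(driftA / 20 * (R + 1)) - driftA * q' / 200 * m) := by
            rw [← Real.exp_nat_mul]; push_cast; ring_nf
        _ ≤ _ := by
            refine Real.exp_le_exp.2 (sub_le_sub_left (mul_le_mul_of_nonneg_right ?_ hm0) _)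
            rw [div_le_iff₀ ha] at hq'
            linarith
    have e2 : (1 + driftA / 20) ^ (R + 1) ≤ Real.exp (driftA / 20 * (R + 1)) := by
      calc (1 + driftA / 20) ^ (R + 1) ≤ Real.exp (driftA / 20) ^ (R + 1) :=
            pow_le_pow_left₀ (by linarith) (by linarith [Real.add_one_le_exp (driftA / 20)]) _
        _ = _ := by rw [← Real.exp_nat_mul]; push_cast; ring_nf
    have e3 : (64 : ℝ) ≤ Real.exp (6 * m) := by
      have : (2 : ℝ) ≤ Real.exp 1 := by linarith [Real.add_one_le_exp (1 : ℝ)]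
      calc (64 : ℝ) = 2 ^ 6 := by norm_num
        _ ≤ Real.exp 1 ^ 6 := pow_le_pow_left₀ (by norm_num) this 6
        _ = Real.exp (6 * 1) := by rw [← Real.exp_nat_mul]; norm_num
        _ ≤ _ := Real.exp_le_exp.2 (by linarith)
    calc (n : ℝ) * (16 * (1 - driftA / 200) ^ (10 * (R + 1) + q' * m) *
        ((n + 1) * (1 + driftA / 20) ^ (R + 1)))
        ≤ N * (16 * Real.exp (-(driftA / 20 * (R + 1)) - (c + 8) * m) *
          ((N + N) * Real.exp (driftA / 20 * (R + 1)))) := by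
          have : 0 ≤ 1 - driftA / 200 := by linarith
          gcongr
          linarith
      _ = 64 * (N * N * (Real.exp (-(driftA / 20 * (R + 1)) - (c + 8) * m) *
          Real.exp (driftA / 20 * (R + 1)))) / 2 := by ring
      _ ≤ Real.exp (6 * m) * (N * N * (Real.exp (-(driftA / 20 * (R + 1)) - (c + 8) * m) *
          Real.exp (driftA / 20 * (R + 1)))) / 2 := by gcongr
      _ = Real.exp (6 * m + (l + l + (-(driftA / 20 * (R + 1)) - (c + 8) * m +
          driftA / 20 * (R + 1)))) / 2 := by
          rw [Real.exp_add (6 * m), Real.exp_add (l + l), Real.exp_add l, ← hNe, Real.exp_add]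
      _ ≤ _ := by
          gcongr
          nlinarith
  rw [hrhs]
  linarith

section Time

open scoped Classical

/-- Good frames are frequent. -/
def GoodOften {C : Clock} (S : C.Spec) (cap : ℕ → ℕ) (A : ℕ) (ℓ : ℕ → ℕ) : Prop :=
  ∀ Λ k, 1 ≤ Λ → ∃ g, k ≤ g ∧ g ≤ k + A * (Λ ^ 2 + ℓ k) ∧
    GoodFrame cap S (A * (Λ ^ 2 + ℓ k)) Λ g

/-- The number of the first frame in which all processes awake in round `t` are running. -/
def firstFrame (t : ℕ) : ℕ := (t + 71) / 18

/-- The number `N` may exceed the number of nodes: equality gives the time bound, `N → ∞` the Las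
Vegas property. As `K` depends only on `A` and `c`, it is uniform in `Δ`. -/
theorem exists_time_constant (A : ℕ) {c : ℝ} (hc : 1 ≤ c) : ∃ K : ℕ,
    ∀ (V : Type) [Fintype V] (G : SimpleGraph V) (E : Execution V) (C : Clock) (S : C.Spec)
      (cap : ℕ → ℕ) (δ : ℕ → ℕ) (θ : ℝ) (ℓ : ℕ → ℕ),
      SimpleWakeUp G E δ → AgeSpec S δ → (∀ c L, C.lev c = some L → 14 ≤ L) →
      CapSpec cap θ → (∀ v, (Finset.univ.filter fun u => G.Adj v u).card * θ ≤ 1 / 16000) →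
      GoodOften S cap A ℓ →
      ∀ N t b : ℕ, Fintype.card V ≤ N → 2 ≤ N →
        t + K * (N.size ^ 2 + ℓ (firstFrame t)) ≤ b →
        (∀ r, t ≤ r → r ≤ b → ∀ v, E.Participates v r ↔ E.Participates v t) →
        ((C.alg cap).prob V).real {ω | ¬ (C.alg cap).AllStable G E ω b} ≤ (N : ℝ) ^ (-c) := by
  obtain ⟨q, hq⟩ := exists_nat_ge (c + 3)
  obtain ⟨q', hq'⟩ := exists_nat_ge (200 * (c + 8) / driftA)
  have hq1 : 1 ≤ q := by
    have : (1 : ℝ) ≤ q := by linarith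
    exact_mod_cast this
  -- The summand `71` covers rounding up to the first frame. Then come at most `R` frames up to the
  -- good one, `10 * (R + 1) + q' * N.size` frames of drift and two more frames.
  refine ⟨71 + 18 * (11 * A * q ^ 2 + 11 * A + 12 + q'), ?_⟩
  intro V _ G E C S cap δ θ ℓ hE hδ hlev hcap hdeg hgood N t b hn hN hb hquiet
  have hm1 : 1 ≤ N.size := Nat.size_pos.2 (by omega)
  obtain ⟨g, hg1, hg2, hg3⟩ := hgood (q * N.size) (firstFrame t) (Nat.mul_pos hq1 hm1)
  set R := A * ((q * N.size) ^ 2 + ℓ (firstFrame t)) with hR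
  have inv : ∀ (ω : (C.alg cap).Seeds V) r, PhaseInv G E cap S ω r :=
    phaseInv hE hδ hcap.le_self
  refine (allStable_prob hquiet inv hlev hcap hdeg (F := 10 * (R + 1) + q' * N.size) ?_ ?_
    hg3).trans (failure_bound hc hn hN (Nat.lt_size_self N).le hq hq')
  · unfold firstFrame at hg1; omega
  · have h1 : 18 * firstFrame t ≤ t + 71 := by unfold firstFrame; omega
    have h2 : N.size ≤ N.size ^ 2 := by nlinarith
    have h3 : R ≤ (A * q ^ 2 + A) * (N.size ^ 2 + ℓ (firstFrame t)) := by
      rw [hR]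
      have : A * q ^ 2 * ℓ (firstFrame t) + A * N.size ^ 2 ≥ 0 := Nat.zero_le _
      nlinarith
    have h4 : 1 ≤ N.size ^ 2 + ℓ (firstFrame t) := by omega
    have h5 : q' * N.size ≤ q' * (N.size ^ 2 + ℓ (firstFrame t)) :=
      Nat.mul_le_mul_left _ (by omega)
    nlinarith

lemma one_sub_le_prob {A : Algorithm} {V : Type} {s : Set (A.Seeds V)} {x : ℝ}
    (h : (A.prob V).real sᶜ ≤ x) : 1 - x ≤ (A.prob V).real s := by
  have h1 := measureReal_union_le (μ := A.prob V) s sᶜ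
  rw [Set.union_compl_self, probReal_univ] at h1
  linarith

/-- The Las Vegas guarantee. -/
theorem lasVegas {V : Type} [Fintype V] {G : SimpleGraph V} {E : Execution V} {C : Clock}
    {S : C.Spec} {cap δ ℓ : ℕ → ℕ} {θ : ℝ} {A : ℕ} (hE : SimpleWakeUp G E δ) (hδ : AgeSpec S δ)
    (hlev : ∀ c L, C.lev c = some L → 14 ≤ L) (hcap : CapSpec cap θ)
    (hdeg : ∀ v, (Finset.univ.filter fun u => G.Adj v u).card * θ ≤ 1 / 16000)
    (hgood : GoodOften S cap A ℓ) : (C.alg cap).LasVegas G E := by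
  have inv : ∀ (ω : (C.alg cap).Seeds V) r, PhaseInv G E cap S ω r :=
    phaseInv hE hδ hcap.le_self
  refine ⟨?_, ae_of_all _ fun ω r h1 v hv hs => stable_succ hcap.one_le (inv ω) h1 hv hs⟩
  -- A finite graph has only finitely many wake-ups and crashes.
  have hev : ∃ t, ∀ r, t ≤ r → ∀ v, E.Participates v r ↔ E.Participates v t := by
    have h1 : ∀ x : ℕ∞, ∃ t : ℕ, ∀ r, t ≤ r → (x ≤ (r : ℕ∞) ↔ x ≤ (t : ℕ∞)) := by
      intro x
      cases x with
      | top => exact ⟨0, fun r _ => by simp⟩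
      | coe x =>
        refine ⟨x, fun r hr => ?_⟩
        simp only [Nat.cast_le]
        exact ⟨fun _ => le_rfl, fun _ => hr⟩
    choose T hT using h1
    refine ⟨Finset.univ.sup fun v => max (T (E.wake v)) (T (E.crash v)), fun r hr v => ?_⟩
    have h2 := Finset.le_sup (f := fun v => max (T (E.wake v)) (T (E.crash v)))
      (Finset.mem_univ v)
    set t := Finset.univ.sup fun v => max (T (E.wake v)) (T (E.crash v))
    have h3 := max_le_iff.1 h2
    unfold Execution.Participates
    rw [← not_le, ← not_le, hT _ r (by omega), hT _ r (by omega), ← hT _ t h3.1, ← hT _ t h3.2]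
  obtain ⟨t, ht⟩ := hev
  obtain ⟨K, hK⟩ := exists_time_constant A (c := 1) le_rfl
  -- Once all nodes are stable in quiet times they remain so; never stabilizing therefore implies
  -- instability in the round `b` belonging to any `N`.
  have hbound : ∀ N : ℕ, Fintype.card V + 2 ≤ N → ((C.alg cap).prob V).real
      {ω | ¬ ∀ᶠ r in atTop, (C.alg cap).AllStable G E ω r} ≤ (N : ℝ)⁻¹ := by
    intro N hN
    set b := t + K * (N.size ^ 2 + ℓ (firstFrame t)) with hb
    have h1 := hK V G E C S cap δ θ ℓ hE hδ hlev hcap hdeg hgood N t b (by omega) (by omega) le_rfl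
      fun r hr _ => ht r hr
    rw [Real.rpow_neg_one] at h1
    refine le_trans (measureReal_mono ?_ (measure_ne_top _ _)) h1
    intro ω hω hs
    refine hω (eventually_atTop.2 ⟨b, fun r hr => ?_⟩)
    refine allStable_of_le hcap.one_le (inv ω) hr (fun s h2 _ v => ?_) hs
    exact (ht s (by omega) v).trans (ht b (by omega) v).symm
  have hzero : ((C.alg cap).prob V).real
      {ω | ¬ ∀ᶠ r in atTop, (C.alg cap).AllStable G E ω r} = 0 := by
    refine le_antisymm (ge_of_tendsto tendsto_inv_atTop_nhds_zero_nat ?_) measureReal_nonneg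
    exact eventually_atTop.2 ⟨_, hbound⟩
  rw [ae_iff]
  exact (measureReal_eq_zero_iff (measure_ne_top _ _)).1 hzero

end Time

/-! ### A clock for an unlimited number of frames

The frames are grouped into superframes numbered `0, 1, 2, …`; a bit on topic `1` marks the first
frame of a superframe, and the binary digits of its number are broadcast on topic `2`. -/

namespace Counting

/-- The number of frames in the superframe with number `k`. -/
def len (k : ℕ) : ℕ := k.size + 2

lemma len_mono {k k' : ℕ} (h : k ≤ k') : len k ≤ len k' := by
  have := Nat.size_le_size h
  unfold len; omega

lemma two_le_len (k : ℕ) : 2 ≤ len k := by unfold len; omega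

lemma lt_two_pow_len (k : ℕ) : k < 2 ^ len k :=
  (Nat.lt_size_self k).trans_le (Nat.pow_le_pow_right two_pos (by unfold len; omega))

/-- The stages of learning: waiting for the mark of a superframe, having read the lowest `i` digits
of its number, knowing number and position. -/
inductive St where
  | wait
  | read (i acc : ℕ)
  | known (k i : ℕ)

instance : Countable St :=
  Function.Injective.countable
    (f := fun s : St => match s with
      | .wait => (Sum.inl () : Unit ⊕ ((ℕ × ℕ) ⊕ (ℕ × ℕ)))
      | .read i a => Sum.inr (Sum.inl (i, a))
      | .known k i => Sum.inr (Sum.inr (k, i)))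
    fun s s' h => by cases s <;> cases s' <;> simp_all

/-- Number of the current superframe and position in it. -/
def adv (p : ℕ × ℕ) : ℕ × ℕ := if p.2 + 1 < len p.1 then (p.1, p.2 + 1) else (p.1 + 1, 0)

def pos : ℕ → ℕ × ℕ
  | 0 => (0, 0)
  | f + 1 => adv (pos f)

def out (s : St) (t : ℕ) : Bool :=
  match s with
  | .known k i => if t = 1 then decide (i = 0) else if t = 2 then k.testBit i else false
  | _ => false

/-- A mark seen while reading belongs to the first frame of superframe `acc + 1`, so the following
frame has position `1`. -/
def next (s : St) (m d : Bool) : St :=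
  match s with
  | .wait => if m then .read 1 d.toNat else .wait
  | .read i acc => if m then .known (acc + 1) 1 else .read (i + 1) (acc + d.toNat * 2 ^ i)
  | .known k i => .known (adv (k, i)).1 (adv (k, i)).2

/-- Apart from first frames of superframes, a reader knows its position, which is enough for the
level. Waiting processes have none, but they are too young for large exponents. -/
def lev : St → Option ℕ
  | .wait => none
  | .read i _ => some (14 * 2 ^ i)
  | .known _ i => some (14 * 2 ^ i)

def tru (f : ℕ) : St := .known (pos f).1 (pos f).2

def clock : Clock where
  St := St
  countable_St := inferInstance
  fresh := .wait
  root := tru 3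
  out := out
  next := next
  lev := lev

lemma pos_lt (f : ℕ) : (pos f).2 < len (pos f).1 := by
  cases f with
  | zero => exact (two_le_len 0).trans_lt' (by simp [pos])
  | succ f =>
    simp only [pos, adv]
    split_ifs with h
    · exact h
    · exact (two_le_len _).trans_lt' (by simp)

lemma pos_fst_le (f : ℕ) : (pos f).1 ≤ f := by
  induction f with
  | zero => simp [pos]
  | succ f ih =>
    simp only [pos, adv]
    split_ifs <;> simp only <;> omega

/-- Lengths of superframes do not decrease, so every earlier one is at most as long as the current
one. -/
lemma le_pos (f : ℕ) : f ≤ (pos f).1 * len (pos f).1 + (pos f).2 := by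
  induction f with
  | zero => simp
  | succ f ih =>
    have h1 := pos_lt f
    simp only [pos, adv]
    split_ifs with h
    · simp only; omega
    · have h2 := Nat.mul_le_mul_left ((pos f).1 + 1) (len_mono (Nat.le_succ (pos f).1))
      simp only [Nat.succ_eq_add_one] at h2 ⊢
      rw [add_mul, one_mul] at h2
      omega

lemma pos_add {f j : ℕ} (h : (pos f).2 + j < len (pos f).1) :
    pos (f + j) = ((pos f).1, (pos f).2 + j) := by
  induction j with
  | zero => simp
  | succ j ih =>
    rw [← add_assoc, pos, ih (by omega), adv]
    simp only
    rw [if_pos (by omega)]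
    rfl

lemma pos_next (f : ℕ) : pos (f + (len (pos f).1 - (pos f).2)) = ((pos f).1 + 1, 0) := by
  have h := pos_lt f
  have h1 : len (pos f).1 - (pos f).2 = (len (pos f).1 - (pos f).2 - 1) + 1 := by omega
  rw [h1, ← add_assoc, pos, pos_add (by omega), adv]
  simp only
  rw [if_neg (by omega)]

/-- The number of frames until the next superframe begins. -/
def rem (f : ℕ) : ℕ := if (pos f).2 = 0 then 0 else len (pos f).1 - (pos f).2

lemma rem_succ {f : ℕ} (h : (pos f).2 ≠ 0) : rem f = rem (f + 1) + 1 := by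
  have h1 := pos_lt f
  unfold rem
  simp only [pos, adv]
  split_ifs with h2 h3 h3 <;> simp_all <;> omega

/-- As `f + rem f` is the frame of the next mark, the bounds limit the stages: the first mark comes
within `len f₀` frames, the second within `len (f₀ + 1)` more. -/
def ok (f f₀ : ℕ) (s : St) : Prop :=
  match s with
  | .wait => f₀ ≤ f ∧ f + rem f ≤ f₀ + len f₀ ∧ (pos f).1 ≤ f₀ + 1 ∧
      ((pos f).2 ≠ 0 → (pos f).1 ≤ f₀)
  | .read i acc => f + rem f ≤ f₀ + len f₀ + len (f₀ + 1) ∧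
      ((pos f).2 ≠ 0 → i = (pos f).2 ∧ acc = (pos f).1 % 2 ^ i) ∧
      ((pos f).2 = 0 → (pos f).1 = acc + 1)
  | .known k i => pos f = (k, i)

lemma mod_two_pow_succ_testBit (k i : ℕ) :
    k % 2 ^ i + (k.testBit i).toNat * 2 ^ i = k % 2 ^ (i + 1) := by
  rw [Nat.toNat_testBit, Nat.mod_pow_succ, mul_comm]

lemma pos_of_zero {f : ℕ} (h : (pos f).2 = 0) : pos (f + 1) = ((pos f).1, 1) := by
  have := two_le_len (pos f).1
  rw [pos_add (by omega), h]

lemma ok_next (f f₀ : ℕ) (s : St) (h : ok f f₀ s) :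
    ok (f + 1) f₀ (next s (out (tru f) 1) (out (tru f) 2)) := by
  have ho1 : out (tru f) 1 = decide ((pos f).2 = 0) := rfl
  have ho2 : out (tru f) 2 = (pos f).1.testBit (pos f).2 := rfl
  rw [ho1, ho2]
  have hlt := pos_lt f
  cases s with
  | wait =>
    obtain ⟨h0, h1, h2, h3⟩ := h
    by_cases hz : (pos f).2 = 0
    · have hp := pos_of_zero hz
      have hl := len_mono h2
      have hr : rem f = 0 := by simp [rem, hz]
      have hr' : rem (f + 1) = len (pos f).1 - 1 := by simp [rem, hp]
      simp only [next, hz, decide_true, if_true, ok, hp]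
      refine ⟨by omega, fun _ => ⟨trivial, ?_⟩, by simp⟩
      have := mod_two_pow_succ_testBit (pos f).1 0
      simpa [Nat.mod_one] using this
    · have hr := rem_succ hz
      simp only [next, hz, decide_false, Bool.false_eq_true, if_false, ok]
      refine ⟨by omega, by omega, ?_, ?_⟩
      · have := h3 hz
        simp only [pos, adv]
        split_ifs <;> simp only <;> omega
      · have := h3 hz
        simp only [pos, adv]
        split_ifs <;> simp only <;> omega
  | read i acc =>
    obtain ⟨h1, h2, h3⟩ := h
    by_cases hz : (pos f).2 = 0
    · have hp := pos_of_zero hz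
      simp only [next, hz, decide_true, if_true, ok, hp, h3 hz]
    · have hr := rem_succ hz
      obtain ⟨hi, ha⟩ := h2 hz
      simp only [next, hz, decide_false, Bool.false_eq_true, if_false, ok]
      have hs : acc + ((pos f).1.testBit (pos f).2).toNat * 2 ^ i = (pos f).1 % 2 ^ (i + 1) := by
        rw [ha, ← hi, mod_two_pow_succ_testBit]
      rw [hs]
      refine ⟨by omega, ?_, ?_⟩
      · simp only [pos, adv]
        split_ifs with h4 <;> simp [hi]
      · simp only [pos, adv]
        split_ifs with h4
        · simp
        · intro _
          -- At the end of a superframe all its digits have been read, and the remainder modulo `2 ^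
          -- len` is its number.
          have h5 : i + 1 = len (pos f).1 := by omega
          simp only
          rw [h5, Nat.mod_eq_of_lt (lt_two_pow_len _)]
  | known k i =>
    have h : pos f = (k, i) := h
    simp only [next, ok, pos, h]

def spec : clock.Spec where
  tru := tru
  ok := ok
  delay f := len f + len (f + 1) + 1
  root_eq := rfl
  next_tru _ := rfl
  ok_fresh f := by
    have h := pos_lt f
    have h1 := pos_fst_le f
    have h2 := len_mono h1
    refine ⟨le_rfl, ?_, by omega, fun _ => h1⟩
    unfold rem
    split_ifs <;> omega
  ok_next := ok_next
  out_le f f₀ c i h := by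
    cases c with
    | wait => simp [clock, out]
    | read i acc => simp [clock, out]
    | known k i =>
      have h : pos f = (k, i) := h
      simp [clock, tru, h]
  known f f₀ c h hd := by
    cases c with
    | wait => exact absurd h.2.1 (by omega)
    | read i acc => exact absurd h.1 (by omega)
    | known k i =>
      have h : pos f = (k, i) := h
      change St.known k i = tru f
      rw [tru, h]

/-- The age that counts as old. -/
def oldAge (s : ℕ) : ℕ := 162 + 36 * (s + 4).size

lemma ageSpec : AgeSpec spec oldAge where
  mono s s' h := by
    have := Nat.size_le_size (Nat.add_le_add_right h 4)
    unfold oldAge; omega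
  ge s k h := by
    have h1 : k.size ≤ (s + 4).size := Nat.size_le_size (by omega)
    have h2 : (k + 1).size ≤ (s + 4).size := Nat.size_le_size (by omega)
    change 72 + 18 * (len k + len (k + 1) + 1) ≤ oldAge s
    unfold oldAge len; omega

lemma lev_ge (c : clock.St) (L : ℕ) (h : clock.lev c = some L) : 14 ≤ L := by
  cases c <;> simp only [clock, lev, reduceCtorEq, Option.some.injEq] at h <;>
    · subst h
      exact Nat.le_mul_of_pos_right _ (by positivity)

lemma capSpec : CapSpec id 0 where
  nonneg := le_rfl
  wt_le k := by rw [id, wt_succ, add_zero]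
  le_self _ := le_rfl
  one_le k := by simp

/-- Position `Λ.size` in the next superframe has level `14 * 2 ^ Λ.size`, between `Λ` and `28 * Λ`;
processes still waiting there began at most `len f₀` frames ago. If that superframe is too short for
this position, the frame number is below `Λ ^ 2`, which bounds all exponents. -/
lemma goodOften : GoodOften spec id 100 Nat.size := by
  intro Λ k hΛ
  obtain ⟨⟨K, I⟩, hp⟩ : ∃ p, pos k = p := ⟨_, rfl⟩
  have hlt := pos_lt k
  have hle := le_pos k
  have hfst := pos_fst_le k
  have hnext := pos_next k
  simp only [hp] at hlt hle hfst hnext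
  have hs1 : Λ < 2 ^ Λ.size := Nat.lt_size_self Λ
  have hs0 : 0 < Λ.size := Nat.size_pos.2 hΛ
  have hs2 : 2 ^ (Λ.size - 1) ≤ Λ := Nat.lt_size.1 (by omega)
  have hs3 : 2 ^ Λ.size = 2 * 2 ^ (Λ.size - 1) := by
    rw [← pow_succ']; congr 1; omega
  have hs4 : Λ.size ≤ Λ := Nat.size_le.2 Nat.lt_two_pow_self
  have hsq : Λ ≤ Λ ^ 2 := Nat.le_self_pow two_ne_zero Λ
  by_cases hK : Λ.size < len (K + 1)
  · have hlen : len K ≤ k.size + 2 := len_mono hfst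
    set g := k + (len K - I) + Λ.size with hg
    have hpg : pos g = (K + 1, Λ.size) := by
      rw [hg, pos_add] <;> rw [hnext] <;> simp [hK]
    refine ⟨g, by omega, by omega, Or.inr fun f₀ c hc => ?_⟩
    have key : ∀ L, L = 14 * 2 ^ Λ.size → Λ ≤ L ∧ 3 * L ≤ 100 * (Λ ^ 2 + k.size) := by
      intro L hL; omega
    have key' : clock.lev c.clk = some (14 * 2 ^ Λ.size) →
        (∀ L, clock.lev c.clk = some L → Λ ≤ L) ∧ (c.e ≤ 100 * (Λ ^ 2 + k.size) ∨
          ∃ L, clock.lev c.clk = some L ∧ 3 * L ≤ 100 * (Λ ^ 2 + k.size)) := by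
      intro h
      refine ⟨fun L hL => ?_, Or.inr ⟨_, h, (key _ rfl).2⟩⟩
      rw [h, Option.some.injEq] at hL
      exact (key L hL.symm).1
    have he := hc.e_le
    rcases hc.clk with h | h
    · apply key'
      rw [h]
      simp [clock, lev, spec, tru, hpg]
    · generalize c.clk = s at h key'
      cases s with
      | wait =>
        obtain ⟨h0, h1, -⟩ := h
        refine ⟨by simp [clock, lev], Or.inl ?_⟩
        by_cases hf : f₀ ≤ k
        · have : len f₀ ≤ k.size + 2 := len_mono hf
          omega
        · omega
      | read i acc =>
        apply key'
        have := (h.2.1 (by rw [hpg]; exact hs0.ne')).1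
        simp [clock, lev, this, hpg]
      | known k' i =>
        have h : pos g = (k', i) := h
        rw [hpg, Prod.mk.injEq] at h
        apply key'
        simp [clock, lev, h.2]
  · refine ⟨k, le_rfl, by omega, Or.inl fun f₀ c hc => ?_⟩
    have he := hc.e_le
    have h1 : len K ≤ Λ := (len_mono (Nat.le_add_right K 1)).trans (by omega)
    have h2 : K + 1 ≤ Λ := by
      have h3 : K + 1 < 2 ^ (K + 1).size := Nat.lt_size_self _
      have h4 : 2 ^ (K + 1).size ≤ 2 ^ (Λ.size - 1) :=
        Nat.pow_le_pow_right two_pos (by unfold len at hK; omega)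
      omega
    have h5 : (K + 1) * len K ≤ Λ ^ 2 := by rw [sq]; exact Nat.mul_le_mul h2 h1
    rw [add_mul] at h5
    omega

end Counting

/-! ### A clock for a limited number of frames

The processes agree on the number of the current frame modulo `2 ^ B`. In a frame whose number is
an odd multiple of `2 ^ i`, the binary digit number `i + 1` of its number is broadcast on topic `2`;
the parity of the number is broadcast on topic `1`. -/

namespace Cyclic

/-- `i` is the lowest position of a nonzero binary digit. -/
def IsLow (x i : ℕ) : Prop := x.testBit i = true ∧ ∀ j < i, x.testBit j = false

lemma exists_isLow {x : ℕ} (h : x ≠ 0) : ∃ i, IsLow x i := by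
  classical
  have h1 : ∃ i, x.testBit i = true := Nat.exists_testBit_of_ne_zero h
  exact ⟨Nat.find h1, Nat.find_spec h1, fun j hj => by simpa using Nat.find_min h1 hj⟩

noncomputable def low (x : ℕ) : ℕ := sInf {i | x.testBit i = true}

lemma IsLow.low_eq {x i : ℕ} (h : IsLow x i) : low x = i := by
  refine le_antisymm (Nat.sInf_le h.1) (le_csInf ⟨i, h.1⟩ fun j hj => ?_)
  by_contra hlt
  have h1 : x.testBit j = true := hj
  rw [h.2 j (by omega)] at h1
  exact absurd h1 (by simp)

lemma IsLow.ne_zero {x i : ℕ} (h : IsLow x i) : x ≠ 0 := by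
  rintro rfl
  simpa using h.1

lemma isLow_mod {x b i : ℕ} : IsLow (x % 2 ^ b) i ↔ i < b ∧ IsLow x i := by
  simp only [IsLow, Nat.testBit_mod_two_pow]
  constructor
  · rintro ⟨h1, h2⟩
    simp only [Bool.and_eq_true, decide_eq_true_eq] at h1
    refine ⟨h1.1, h1.2, fun j hj => ?_⟩
    simpa [hj.trans h1.1] using h2 j hj
  · rintro ⟨h1, h2, h3⟩
    exact ⟨by simp [h1, h2], fun j hj => by simp [h3 j hj]⟩

lemma isLow_two_pow (i : ℕ) : IsLow (2 ^ i) i :=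
  ⟨Nat.testBit_two_pow_self, fun j hj => by rw [Nat.testBit_two_pow]; simp; omega⟩

/-- `(b, σ)`: the number of the current frame is `σ` modulo `2 ^ b`. -/
abbrev St : Type := ℕ × ℕ

noncomputable def out (s : St) (t : ℕ) : Bool :=
  if t = 1 then s.2.testBit 0 else if t = 2 then s.2.testBit (low s.2 + 1) && decide (s.2 ≠ 0)
  else false

/-- Knowing `b` digits, a process waits for the residue `2 ^ (b - 1)`. The lowest nonzero digit of
the frame number then has position `b - 1`, so topic `2` carries the missing digit `b`. -/
def next (B : ℕ) (s : St) (m d : Bool) : St :=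
  if s.1 = B then (B, (s.2 + 1) % 2 ^ B)
  else if s.1 = 0 then (1, (m.toNat + 1) % 2)
  else if s.2 = 2 ^ (s.1 - 1) then (s.1 + 1, (s.2 + d.toNat * 2 ^ s.1 + 1) % 2 ^ (s.1 + 1))
  else (s.1, (s.2 + 1) % 2 ^ s.1)

/-- The doubly exponential growth is what lets `digits Δ` digits cover all levels needed below the
exponent cap. -/
noncomputable def lev (s : St) : Option ℕ :=
  if s.2 = 0 then none else some (14 * 2 ^ 2 ^ low s.2)

def tru (B f : ℕ) : St := (B, f % 2 ^ B)

noncomputable def clock (B : ℕ) : Clock where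
  St := St
  countable_St := inferInstance
  fresh := (0, 0)
  root := tru B 3
  out := out
  next := next B
  lev := lev

/-- Since frame `a`, where the present digits were complete, the residue that reveals the next digit
has not occurred; it occurs in any `2 ^ s.1` consecutive frames, so the process is young. -/
def ok (B f f₀ : ℕ) (s : St) : Prop :=
  s.1 ≤ B ∧ s.2 = f % 2 ^ s.1 ∧ (s.1 = 0 → f = f₀) ∧
    (0 < s.1 → s.1 < B → ∃ a, a ≤ f₀ + 2 ^ s.1 ∧ a ≤ f ∧
      ∀ g, a ≤ g → g < f → g % 2 ^ s.1 ≠ 2 ^ (s.1 - 1))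

lemma exists_mod_eq (a b : ℕ) (hb : 0 < b) :
    ∃ g, a ≤ g ∧ g < a + 2 ^ b ∧ g % 2 ^ b = 2 ^ (b - 1) := by
  have h1 : 2 ^ b = 2 * 2 ^ (b - 1) := by rw [← pow_succ']; congr 1; omega
  have h2 : 0 < 2 ^ (b - 1) := by positivity
  set m := 2 ^ b with hm
  set n := 2 ^ (b - 1)
  have h3 : a % m < m := Nat.mod_lt _ (by omega)
  have h4 := Nat.div_add_mod a m
  by_cases h : a % m ≤ n
  · refine ⟨m * (a / m) + n, by omega, by omega, ?_⟩
    rw [Nat.mul_add_mod, Nat.mod_eq_of_lt (by omega)]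
  · refine ⟨m * (a / m + 1) + n, by rw [mul_add]; omega, by rw [mul_add]; omega, ?_⟩
    rw [Nat.mul_add_mod, Nat.mod_eq_of_lt (by omega)]

lemma ok.le {B f f₀ : ℕ} {s : St} (h : ok B f f₀ s) (hs : s.1 < B) : f ≤ f₀ + 2 ^ (s.1 + 1) := by
  obtain ⟨-, -, h2, h3⟩ := h
  rcases Nat.eq_zero_or_pos s.1 with h0 | h0
  · exact (h2 h0).le.trans (Nat.le_add_right _ _)
  · obtain ⟨a, ha, -, hg⟩ := h3 h0 hs
    obtain ⟨g, h4, h5, h6⟩ := exists_mod_eq a s.1 h0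
    rw [pow_succ]
    by_contra hlt
    exact hg g h4 (by omega) h6

lemma toNat_testBit_zero (f : ℕ) : (f.testBit 0).toNat = f % 2 := by
  rw [Nat.toNat_testBit]; simp

lemma ok_next {B : ℕ} (hB : 0 < B) (f f₀ : ℕ) (s : St) (h : ok B f f₀ s) :
    ok B (f + 1) f₀ (next B s (out (tru B f) 1) (out (tru B f) 2)) := by
  obtain ⟨b, σ⟩ := s
  have hle := h.le
  obtain ⟨h1, h2, h3, h4⟩ := h
  simp only at h1 h2 h3 h4 hle
  have ho1 : out (tru B f) 1 = f.testBit 0 := by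
    simp [out, tru, hB]
  unfold next
  simp only
  by_cases hb : b = B
  · subst hb
    rw [if_pos rfl]
    refine ⟨le_rfl, by simp only; rw [h2, Nat.mod_add_mod], fun h0 => ?_, fun _ h0 => ?_⟩
    · simp only at h0; omega
    · simp only at h0; omega
  rw [if_neg hb]
  have hbB : b < B := by omega
  by_cases hb0 : b = 0
  · rw [if_pos hb0]
    have := h3 hb0
    subst this
    refine ⟨hB, ?_, fun h0 => by simp at h0, fun _ _ => ⟨f + 1, by simp, le_rfl, fun g _ _ => ?_⟩⟩
    · simp only [ho1, toNat_testBit_zero, pow_one]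
      omega
    · omega
  rw [if_neg hb0]
  by_cases hσ : σ = 2 ^ (b - 1)
  · rw [if_pos hσ]
    have hlow : IsLow f (b - 1) := by
      have := isLow_two_pow (b - 1)
      rw [← hσ, h2, isLow_mod] at this
      exact this.2
    have hlow' : IsLow (f % 2 ^ B) (b - 1) := isLow_mod.2 ⟨by omega, hlow⟩
    have ho2 : out (tru B f) 2 = f.testBit b := by
      have h5 : b - 1 + 1 = b := by omega
      have h6 := hlow'.ne_zero
      simp only [out, tru, hlow'.low_eq, h5, Nat.testBit_mod_two_pow]
      simp [hbB, h6]
    refine ⟨hbB, ?_, fun h0 => by simp at h0, fun _ _ => ⟨f + 1, ?_, le_rfl, fun g _ _ => ?_⟩⟩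
    · simp only [ho2]
      rw [h2, Counting.mod_two_pow_succ_testBit, Nat.mod_add_mod]
    · obtain ⟨a, ha, ha', hg⟩ := h4 (by omega) hbB
      obtain ⟨g, h5, h6, h7⟩ := exists_mod_eq a b (by omega)
      simp only [pow_succ]
      by_contra hlt
      exact hg g h5 (by omega) h7
    · omega
  · rw [if_neg hσ]
    refine ⟨h1, by simp only; rw [h2, Nat.mod_add_mod], fun h0 => absurd h0 hb0, fun h5 _ => ?_⟩
    obtain ⟨a, ha, ha', hg⟩ := h4 h5 hbB
    refine ⟨a, ha, by omega, fun g h6 h7 => ?_⟩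
    rcases Nat.lt_succ_iff_lt_or_eq.1 h7 with h8 | rfl
    · exact hg g h6 h8
    · rwa [h2] at hσ

/-- A nonzero residue already shows the lowest nonzero digit of the frame number, so partial
knowledge never yields a false bit. -/
lemma out_le {B : ℕ} (f f₀ : ℕ) (s : St) (t : ℕ) (h : ok B f f₀ s) (hs : out s t = true) :
    out (tru B f) t = true := by
  obtain ⟨b, σ⟩ := s
  obtain ⟨h1, h2, -, -⟩ := h
  simp only at h1 h2
  unfold out at hs ⊢
  split_ifs at hs ⊢ with h3 h4
  · simp only [h2, tru, Nat.testBit_mod_two_pow, Bool.and_eq_true, decide_eq_true_eq] at hs ⊢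
    exact ⟨by omega, hs.2⟩
  · simp only [tru, Bool.and_eq_true, decide_eq_true_eq] at hs ⊢
    obtain ⟨i, hi⟩ := exists_isLow hs.2
    have hi' := hi
    rw [h2, isLow_mod] at hi'
    have hi'' : IsLow (f % 2 ^ B) i := isLow_mod.2 ⟨by omega, hi'.2⟩
    rw [hi.low_eq, h2, Nat.testBit_mod_two_pow, Bool.and_eq_true, decide_eq_true_eq] at hs
    rw [hi''.low_eq, Nat.testBit_mod_two_pow, Bool.and_eq_true, decide_eq_true_eq]
    exact ⟨⟨by omega, hs.1.2⟩, decide_eq_true hi''.ne_zero⟩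

noncomputable def spec {B : ℕ} (hB : 0 < B) : (clock B).Spec where
  tru := tru B
  ok := ok B
  delay _ := 2 ^ B + 1
  root_eq := rfl
  next_tru f := by
    change next B (tru B f) _ _ = _
    simp [next, tru, Nat.mod_add_mod]
  ok_fresh f := ⟨Nat.zero_le _, by simp [clock, Nat.mod_one], fun _ => rfl,
    fun h => absurd h (lt_irrefl 0)⟩
  ok_next := ok_next hB
  out_le := out_le
  known f f₀ c h hd := by
    have h1 : c.1 = B := by
      by_contra hne
      have h2 := h.le (lt_of_le_of_ne h.1 hne)
      have h3 : 2 ^ (c.1 + 1) ≤ 2 ^ B :=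
        Nat.pow_le_pow_right two_pos (lt_of_le_of_ne h.1 hne)
      omega
    have h2 := h.2.1
    rw [h1] at h2
    exact Prod.ext h1 h2

/-- The age that counts as old. -/
def oldAge (B : ℕ) : ℕ := 72 + 18 * (2 ^ B + 1)

lemma ageSpec {B : ℕ} (hB : 0 < B) : AgeSpec (spec hB) fun _ => oldAge B where
  mono _ _ _ := le_rfl
  ge _ _ _ := le_rfl

lemma lev_ge {B : ℕ} (c : (clock B).St) (L : ℕ) (h : (clock B).lev c = some L) : 14 ≤ L := by
  simp only [clock, lev] at h
  split_ifs at h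
  rw [Option.some.injEq] at h
  subst h
  exact Nat.le_mul_of_pos_right _ (by positivity)

/-- The largest exponent for graphs of maximum degree `Δ`. -/
def maxExp (Δ : ℕ) : ℕ := Δ.size + 14

lemma capSpec (Δ : ℕ) : CapSpec (min · (maxExp Δ)) (wt (maxExp Δ)) where
  nonneg := wt_nonneg _
  wt_le k := by
    have h1 := wt_nonneg k
    have h2 := wt_nonneg (maxExp Δ)
    rcases min_choice (k + 1) (maxExp Δ) with h | h <;> rw [h]
    · rw [wt_succ]
      linarith
    · linarith
  le_self k := min_le_left _ _
  one_le k := le_min (by omega) (by unfold maxExp; omega)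

lemma mul_wt_maxExp_le {d Δ : ℕ} (h : d ≤ Δ) : (d : ℝ) * wt (maxExp Δ) ≤ 1 / 16000 := by
  have h1 : (d : ℝ) ≤ 2 ^ Δ.size := by
    have := h.trans (Nat.lt_size_self Δ).le
    exact_mod_cast this
  have h2 : wt (maxExp Δ) = ((2 : ℝ) ^ Δ.size * 16384)⁻¹ := by
    unfold wt maxExp
    rw [pow_add, one_div, inv_pow, mul_inv]
    norm_num
  rw [h2, mul_inv, ← mul_assoc]
  have h3 : (d : ℝ) * ((2 : ℝ) ^ Δ.size)⁻¹ ≤ 1 := by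
    rw [← div_eq_mul_inv]
    exact div_le_one_of_le₀ h1 (by positivity)
  linarith

/-- The number of binary digits of the number of the current frame on which the processes agree. -/
def digits (Δ : ℕ) : ℕ := Δ.size.size.size + 1

lemma digits_pos (Δ : ℕ) : 0 < digits Δ := Nat.succ_pos _

lemma two_pow_size_le {x : ℕ} (h : 0 < x) : 2 ^ x.size ≤ 2 * x := by
  have h1 : 0 < x.size := Nat.size_pos.2 h
  have h2 : 2 ^ (x.size - 1) ≤ x := Nat.lt_size.1 (by omega)
  have h3 : 2 ^ x.size = 2 * 2 ^ (x.size - 1) := by rw [← pow_succ']; congr 1; omega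
  omega

/-- For `j = Λ.size.size`, frames whose number is an odd multiple of `2 ^ j` recur every `2 ^ (j +
1)` frames. Their level is at least `Λ` and at most `56 * Λ ^ 2`, since `Λ.size < 2 ^ j ≤ 2 *
Λ.size`. If `j` is no available digit position, `Λ` exceeds `Δ.size` and the cap alone bounds the
exponents. -/
lemma goodOften (Δ : ℕ) :
    GoodOften (spec (digits_pos Δ)) (min · (maxExp Δ)) 200 fun _ => 0 := by
  intro Λ k hΛ
  set B := digits Δ with hB
  have hsq : Λ ≤ Λ ^ 2 := Nat.le_self_pow two_ne_zero Λ
  have hs4 : Λ.size ≤ Λ := Nat.size_le.2 Nat.lt_two_pow_self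
  have hj1 : 2 ^ Λ.size.size ≤ 2 * Λ.size := two_pow_size_le (Nat.size_pos.2 hΛ)
  have hj2 : Λ.size < 2 ^ Λ.size.size := Nat.lt_size_self _
  set j := Λ.size.size with hj
  simp only [add_zero]
  by_cases hjB : j < B
  · obtain ⟨g, hg1, hg2, hg3⟩ := exists_mod_eq k (j + 1) (Nat.succ_pos j)
    rw [Nat.add_sub_cancel] at hg3
    have hlow : IsLow g j := by
      have := isLow_two_pow j
      rw [← hg3, isLow_mod] at this
      exact this.2
    rw [pow_succ] at hg2
    refine ⟨g, hg1, by omega, Or.inr fun f₀ c hc => ?_⟩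
    have hL1 : Λ ≤ 14 * 2 ^ 2 ^ j := by
      have h1 : 2 ^ Λ.size ≤ 2 ^ 2 ^ j := Nat.pow_le_pow_right two_pos hj2.le
      have h2 := Nat.lt_size_self Λ
      omega
    have hL2 : 3 * (14 * 2 ^ 2 ^ j) ≤ 200 * Λ ^ 2 := by
      have h1 : 2 ^ 2 ^ j ≤ 2 ^ (2 * Λ.size) := Nat.pow_le_pow_right two_pos hj1
      have h2 : 2 ^ (2 * Λ.size) = (2 ^ Λ.size) ^ 2 := by rw [mul_comm, pow_mul]
      have h3 : (2 ^ Λ.size) ^ 2 ≤ (2 * Λ) ^ 2 := Nat.pow_le_pow_left (two_pow_size_le hΛ) 2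
      rw [mul_pow] at h3
      omega
    have key : ∀ b, j < b → c.clk = (b, g % 2 ^ b) →
        (∀ L, (clock B).lev c.clk = some L → Λ ≤ L) ∧ (c.e ≤ 200 * Λ ^ 2 ∨
          ∃ L, (clock B).lev c.clk = some L ∧ 3 * L ≤ 200 * Λ ^ 2) := by
      intro b hb h
      have h1 : IsLow (g % 2 ^ b) j := isLow_mod.2 ⟨hb, hlow⟩
      have h2 : (clock B).lev c.clk = some (14 * 2 ^ 2 ^ j) := by
        rw [h]
        simp [clock, lev, h1.low_eq, h1.ne_zero]
      refine ⟨fun L hL => ?_, Or.inr ⟨_, h2, hL2⟩⟩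
      rw [h2, Option.some.injEq] at hL
      exact hL ▸ hL1
    rcases hc.clk with h | h
    · exact key B hjB h
    · by_cases hb : j < c.clk.1
      · exact key _ hb (Prod.ext rfl h.2.1)
      · have he := hc.e_le
        have h1 : g ≤ f₀ + 2 ^ (c.clk.1 + 1) := ok.le h (by omega)
        have h2 : 2 ^ (c.clk.1 + 1) ≤ 2 ^ (j + 1) :=
          Nat.pow_le_pow_right two_pos (by omega)
        rw [pow_succ] at h2
        -- Only `b ≤ j` digits are known and `2 ^ j` divides the frame number, so the residue is `0`
        -- and no level is assigned; being young, the process has a small exponent anyway.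
        have h3 : c.clk.2 = 0 := by
          by_contra hne
          obtain ⟨i, hi⟩ := exists_isLow hne
          have h4 : c.clk.2 = g % 2 ^ c.clk.1 := h.2.1
          rw [h4, isLow_mod] at hi
          have h5 := hi.2.low_eq
          rw [hlow.low_eq] at h5
          omega
        refine ⟨fun L hL => ?_, Or.inl (by omega)⟩
        simp [clock, lev, h3] at hL
  · refine ⟨k, le_rfl, by omega, Or.inl fun f₀ c hc => ?_⟩
    refine (hc.e_cap (maxExp Δ) (by unfold maxExp; omega) fun k => min_le_right _ _).trans ?_
    have h1 : Δ.size < Λ := by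
      by_contra hlt
      have := Nat.size_le_size (Nat.size_le_size (not_lt.1 hlt))
      have h2 : Δ.size.size.size + 1 ≤ j := not_lt.1 hjB
      omega
    unfold maxExp
    omega

end Cyclic

/-! ### Final estimates -/

lemma size_le_log (x : ℕ) : (x.size : ℝ) ≤ 1 + 2 * Real.log x := by
  rcases Nat.eq_zero_or_pos x with rfl | hx
  · simp
  have h0 : 0 < x.size := Nat.size_pos.2 hx
  have h1 : 2 ^ (x.size - 1) ≤ x := Nat.lt_size.1 (by omega)
  have h2 : ((2 : ℝ) ^ (x.size - 1)) ≤ x := by exact_mod_cast h1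
  have h3 := Real.log_le_log (by positivity) h2
  rw [Real.log_pow, Nat.cast_sub h0, Nat.cast_one] at h3
  have h4 : (1 : ℝ) ≤ x.size := by exact_mod_cast h0
  nlinarith [Real.log_two_gt_d9]

lemma half_le_log {n : ℕ} (hn : 2 ≤ n) : 1 / 2 ≤ Real.log n := by
  have h1 : (2 : ℝ) ≤ n := by exact_mod_cast hn
  have := Real.log_le_log two_pos h1
  linarith [Real.log_two_gt_d9]

lemma size_sq_le {n : ℕ} (hn : 2 ≤ n) : (n.size : ℝ) ^ 2 ≤ 16 * Real.log n ^ 2 := by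
  have h1 := size_le_log n
  have h2 := half_le_log hn
  have h3 : (n.size : ℝ) ≤ 4 * Real.log n := by linarith
  have h4 := pow_le_pow_left₀ (Nat.cast_nonneg n.size) h3 2
  linarith

lemma size_firstFrame_le (t : ℕ) : ((firstFrame t).size : ℝ) ≤ 5 + 2 * Real.log t := by
  rcases Nat.eq_zero_or_pos t with rfl | ht
  · have h1 : (firstFrame 0).size = 2 := rfl
    simp [h1]
    norm_num
  have h1 : (firstFrame t).size ≤ (4 * t).size :=
    Nat.size_le_size (by unfold firstFrame; omega)
  have h2 : ((firstFrame t).size : ℝ) ≤ (4 * t).size := by exact_mod_cast h1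
  have h3 := size_le_log (4 * t)
  have ht' : (t : ℝ) ≠ 0 := by exact_mod_cast ht.ne'
  rw [Nat.cast_mul, Real.log_mul (by norm_num) ht', show ((4 : ℕ) : ℝ) = 2 ^ 2 by norm_num,
    Real.log_pow] at h3
  have := Real.log_two_lt_d9
  push_cast at h3
  linarith

lemma oldAge_isBigO :
    (fun t : ℕ => (Counting.oldAge t : ℝ)) =O[atTop] (fun t : ℕ => Real.log t) := by
  refine IsBigO.of_bound 540 (eventually_atTop.2 ⟨4, fun s hs => ?_⟩)
  have h1 := half_le_log (show 2 ≤ s by omega)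
  rw [Real.norm_of_nonneg (Nat.cast_nonneg _), Real.norm_of_nonneg (by linarith)]
  have h2 : (s + 4).size ≤ (s * s).size := Nat.size_le_size (by nlinarith)
  have h3 : ((s + 4).size : ℝ) ≤ (s * s).size := by exact_mod_cast h2
  have h4 := size_le_log (s * s)
  have hs' : (s : ℝ) ≠ 0 := by positivity
  rw [Nat.cast_mul, Real.log_mul hs' hs'] at h4
  unfold Counting.oldAge
  push_cast
  linarith

/-- Because of the three nested `Nat.size`, `2 ^ digits Δ` is at most `4 * Δ.size.size`. -/
lemma oldAge_digits_isBigO :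
    (fun Δ : ℕ => (Cyclic.oldAge (Cyclic.digits Δ) : ℝ)) =O[atTop]
      (fun Δ : ℕ => Real.log (Real.log Δ)) := by
  have hev : ∀ᶠ Δ : ℕ in atTop, 3 ≤ Real.log Δ :=
    (Real.tendsto_log_atTop.comp tendsto_natCast_atTop_atTop).eventually_ge_atTop 3
  refine IsBigO.of_bound 450 (hev.mono fun Δ h => ?_)
  have hll : 1 ≤ Real.log (Real.log Δ) := by
    rw [Real.le_log_iff_exp_le (by linarith)]
    linarith [Real.exp_one_lt_d9]
  rw [Real.norm_of_nonneg (Nat.cast_nonneg _), Real.norm_of_nonneg (by linarith)]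
  have hΔ : 0 < Δ := by
    rcases Nat.eq_zero_or_pos Δ with rfl | h0
    · simp at h
      linarith
    · exact h0
  have h0 : 0 < Δ.size := Nat.size_pos.2 hΔ
  have h1 := Cyclic.two_pow_size_le (Nat.size_pos.2 h0)
  have h2 : Cyclic.oldAge (Cyclic.digits Δ) ≤ 90 + 72 * Δ.size.size := by
    unfold Cyclic.oldAge Cyclic.digits
    rw [pow_succ]; omega
  have h3 : (Cyclic.oldAge (Cyclic.digits Δ) : ℝ) ≤ 90 + 72 * Δ.size.size := by exact_mod_cast h2
  have h4 := size_le_log Δ.size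
  have h5 : (Δ.size : ℝ) ≤ Real.log Δ ^ 2 := by nlinarith [size_le_log Δ]
  have h6 := Real.log_le_log (by exact_mod_cast h0) h5
  rw [Real.log_pow] at h6
  push_cast at h6
  linarith

/-- With fewer than two nodes `log n = 0`, so the waiting time gives no help; but then either there
is nothing to stabilize or the required probability is `1 - 1 = 0`. -/
lemma Algorithm.solvesMISWithin_of {A : Algorithm} {V : Type} [Fintype V] {G : SimpleGraph V}
    {E : Execution V} {c : ℝ} {τ : ℕ → ℝ}
    (h : 2 ≤ Fintype.card V → ∀ t T : ℕ, τ t ≤ T → E.Quiet t T →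
      (A.prob V).real {ω | ¬ A.AllStable G E ω (t + T)} ≤ (Fintype.card V : ℝ) ^ (-c)) :
    A.SolvesMISWithin G E c τ := by
  intro t T hT hq
  by_cases h2 : 2 ≤ Fintype.card V
  · exact one_sub_le_prob (h h2 t T hT hq)
  by_cases h0 : Fintype.card V = 0
  · have := Fintype.card_eq_zero_iff.1 h0
    refine one_sub_le_prob ?_
    have h3 : {ω | A.AllStable G E ω (t + T)}ᶜ = ∅ := by
      ext ω
      simp only [Set.mem_compl_iff, Set.mem_ofPred_eq, Set.mem_empty_iff_false, iff_false, not_not]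
      exact fun v => isEmptyElim v
    rw [h3]
    rw [measureReal_empty]
    positivity
  · rw [show Fintype.card V = 1 by omega]
    simp

lemma card_filter_adj_le {V : Type} [Fintype V] (G : SimpleGraph V) [DecidableRel G.Adj] {Δ : ℕ}
    (h : G.maxDegree ≤ Δ) (v : V) {_ : DecidablePred (G.Adj v)} :
    (Finset.univ.filter (G.Adj v)).card ≤ Δ := by
  refine le_trans (le_of_eq ?_) ((G.degree_le_maxDegree v).trans h)
  rw [← G.card_neighborFinset_eq_degree]
  congr 1
  ext u
  simp

end Beeping

theorem mainTheorem5 :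
    -- no knowledge about the graph, `δ = O(log t)`, time `O(log² n + log t)`
    (∃ (A : Beeping.Algorithm) (δ : ℕ → ℕ), Monotone δ ∧
      (fun t : ℕ => (δ t : ℝ)) =O[atTop] (fun t : ℕ => Real.log t) ∧
      (∀ (V : Type) [Fintype V] (G : SimpleGraph V) (E : Beeping.Execution V),
        Beeping.SimpleWakeUp G E δ → A.LasVegas G E) ∧
      ∀ c : ℝ, 1 ≤ c → ∃ C : ℝ,
        ∀ (V : Type) [Fintype V] (G : SimpleGraph V) (E : Beeping.Execution V),
          Beeping.SimpleWakeUp G E δ →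
          A.SolvesMISWithin G E c
            (fun t => C * (Real.log (Fintype.card V) ^ 2 + Real.log t))) ∧
    -- known upper bound `Δ` on the maximum degree, `δ = O(log log Δ)`, time `O(log² n)`
    (∃ (A : ℕ → Beeping.Algorithm) (δ : ℕ → ℕ),
      (fun Δ : ℕ => (δ Δ : ℝ)) =O[atTop] (fun Δ : ℕ => Real.log (Real.log Δ)) ∧
      (∀ (Δ : ℕ) (V : Type) [Fintype V] (G : SimpleGraph V) [DecidableRel G.Adj]
        (E : Beeping.Execution V), G.maxDegree ≤ Δ →
        Beeping.SimpleWakeUp G E (fun _ => δ Δ) → (A Δ).LasVegas G E) ∧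
      ∀ c : ℝ, 1 ≤ c → ∃ C : ℝ,
        ∀ (Δ : ℕ) (V : Type) [Fintype V] (G : SimpleGraph V) [DecidableRel G.Adj]
          (E : Beeping.Execution V), G.maxDegree ≤ Δ →
          Beeping.SimpleWakeUp G E (fun _ => δ Δ) →
          (A Δ).SolvesMISWithin G E c
            (fun _ => C * Real.log (Fintype.card V) ^ 2)) := by
  refine ⟨⟨Beeping.Counting.clock.alg id, Beeping.Counting.oldAge,
    Beeping.Counting.ageSpec.mono, Beeping.oldAge_isBigO, ?_, ?_⟩,
    ⟨fun Δ => (Beeping.Cyclic.clock (Beeping.Cyclic.digits Δ)).alg (min · (Beeping.Cyclic.maxExp Δ)),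
      fun Δ => Beeping.Cyclic.oldAge (Beeping.Cyclic.digits Δ), Beeping.oldAge_digits_isBigO,
      ?_, ?_⟩⟩
  · intro V _ G E hE
    exact Beeping.lasVegas hE Beeping.Counting.ageSpec Beeping.Counting.lev_ge
      Beeping.Counting.capSpec (by norm_num) Beeping.Counting.goodOften
  · intro c hc
    obtain ⟨K, hK⟩ := Beeping.exists_time_constant 100 hc
    refine ⟨36 * K, fun V _ G E hE => Beeping.Algorithm.solvesMISWithin_of ?_⟩
    intro hn t T hT hq
    refine hK V G E _ _ _ _ _ _ hE Beeping.Counting.ageSpec Beeping.Counting.lev_ge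
      Beeping.Counting.capSpec (by norm_num) Beeping.Counting.goodOften _ t _ le_rfl hn ?_ hq
    have h1 := Beeping.size_sq_le hn
    have h2 := Beeping.size_firstFrame_le t
    have h3 := Beeping.half_le_log hn
    have h4 : (0 : ℝ) ≤ Real.log t := Real.log_natCast_nonneg t
    -- Since `log n ≥ 1/2`, the constant `5` is at most `20 * log n ^ 2`, and `16 + 20 = 36`.
    have h5 : ((Fintype.card V).size : ℝ) ^ 2 + (Beeping.firstFrame t).size ≤
        36 * (Real.log (Fintype.card V) ^ 2 + Real.log t) := by nlinarith
    have h6 : ((K * ((Fintype.card V).size ^ 2 + (Beeping.firstFrame t).size) : ℕ) : ℝ) ≤ T := by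
      push_cast
      refine (mul_le_mul_of_nonneg_left h5 (Nat.cast_nonneg K)).trans (le_of_eq_of_le ?_ hT)
      ring
    exact Nat.add_le_add_left (by exact_mod_cast h6) t
  · intro Δ V _ G _ E hΔ hE
    exact Beeping.lasVegas hE (Beeping.Cyclic.ageSpec _) Beeping.Cyclic.lev_ge
      (Beeping.Cyclic.capSpec Δ)
      (fun v => Beeping.Cyclic.mul_wt_maxExp_le (Beeping.card_filter_adj_le G hΔ v))
      (Beeping.Cyclic.goodOften Δ)
  · intro c hc
    obtain ⟨K, hK⟩ := Beeping.exists_time_constant 200 hc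
    refine ⟨16 * K, fun Δ V _ G _ E hΔ hE => Beeping.Algorithm.solvesMISWithin_of ?_⟩
    intro hn t T hT hq
    refine hK V G E _ _ _ _ _ _ hE (Beeping.Cyclic.ageSpec _) Beeping.Cyclic.lev_ge
      (Beeping.Cyclic.capSpec Δ)
      (fun v => Beeping.Cyclic.mul_wt_maxExp_le (Beeping.card_filter_adj_le G hΔ v))
      (Beeping.Cyclic.goodOften Δ) _ t _ le_rfl hn ?_ hq
    have h1 := Beeping.size_sq_le hn
    have h2 : ((K * ((Fintype.card V).size ^ 2 + 0) : ℕ) : ℝ) ≤ T := by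
      push_cast
      rw [add_zero]
      refine (mul_le_mul_of_nonneg_left h1 (Nat.cast_nonneg K)).trans (le_of_eq_of_le ?_ hT)
      ring
    exact Nat.add_le_add_left (by exact_mod_cast h2) t
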